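/- Conventions. Let $V \subset \mathbb{R}^d$ be open. A Finsler metric on $V$ is a function $F : V \times \mathbb{R}^d \to [0,\infty)$ with $F(x,tv) = tF(x,v)$ for $t \ge 0$, smooth on $V \times (\mathbb{R}^d \setminus \{0\})$, such that the matrix $g_{ij}(x,v) = \frac12 \frac{\partial^2 F^2}{\partial v^i \partial v^j}(x,v)$ is positive definite for all $x \in V$ and $v \ne 0$. The dual metric is $F_*(x,\xi) = \sup\{\xi\cdot v : F(x,v)=1\}$, the Legendre transform is $(\mathcal{L}_x v)_i = \sum_j g_{ij}(x,v)v^j$, and the cosphere at $x$ is $S_x^* = \{\xi \in \mathbb{R}^d : F_*(x,\xi)=1\}$. A (constant speed, forward) geodesic is a solution of $\ddot c^a = -\sum_{j,k}\gamma^a_{jk}(c,\dot c)\,\dot c^j\dot c^k$, with $\gamma^a_{jk} = \sum_i \frac{g^{ai}}{2}(\partial_{x_k}g_{ij}+\partial_{x_j}g_{ik}-\partial_{x_i}g_{jk})$, where $(g^{ai})$ is the inverse of $(g_{ij})$. The length of a curve is $L(c) = \int F(c,\dot c)\,dt$. For an open set $U_0 \subset V$, $d^+(p,q)$ is the infimum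 of $L(c)$ over $C^1$ curves in $U_0$ from $p$ to $q$, and $d^-(p,q)=d^+(q,p)$. A geodesic from $p$ to $q$ is minimizing if its length is $d^+(p,q)$. An open set $U \subset U_0$ is geodesically convex if for all $p,q\in U$ there is a minimizing geodesic from $p$ to $q$ contained in $U$. Proposition. Let $U_0 \subset \mathbb{R}^d$ be a bounded open set and let $F$ be a Finsler metric on an open set $V$ containing the closure of $U_0$. Then there are constants $K, r, C > 0$ such that the following holds. Let $U \subset U_0$ be open and geodesically convex, with Euclidean diameter $\operatorname{diam} U \le r$, and let $W$ be the set of points at Euclidean distance less than $K \operatorname{diam} U$ from $U$. Let $\phi = \phi(x,y,\xi)$ be a real-valued function, smooth for $x \in W$, $y \in U$, $\xi \in \mathbb{R}^d\setminus\{0\}$, that solves the eikonal equation $$F_*(x,\nabla_x\phi(x,y,\xi)) = F_*(y,\xi),$$ satisfies $\phi(x,y,\xi)=0$ for all $x \in W$ with $\xi\cdot(x-y)=0$, and is oriented so that $\nabla_x\phi(x,y,\xi)=\xi$ at $x=y$. Let $x_0 \neq x_1$ be points of $U$, and define $\Psi : S_{x_0}^* \to \mathbb{R}$ by $\Psi(\xi)=\phi(x_1,x_0,\xi)$.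 Let $v^+$ be the unit tangent vector at $x_0$ (with $F(x_0,v^+)=1$) of a minimizing geodesic in $U$ from $x_0$ to $x_1$, let $v^-$ be the unit tangent vector at $x_0$ of a minimizing geodesic in $U$ from $x_1$ to $x_0$, and put $\xi^\pm = \mathcal{L}_{x_0}v^\pm$. Then: 1. $\xi^+\ne\xi^-$, and $\Psi$ has exactly two critical points on $S_{x_0}^*$, namely $\xi^+$ and $\xi^-$; 2. $\Psi(\xi^+) = d^+(x_0,x_1)$ and $\Psi(\xi^-) = -d^-(x_0,x_1)$; 3. the Hessians $H_\pm$ of $\Psi$ at $\xi^\pm$, viewed as quadratic forms on $T_{\xi^\pm}S_{x_0}^*$, satisfy $$H_+(\zeta) \le -C\,d^+(x_0,x_1)\,|\zeta|^2 \quad\text{and}\quad H_-(\zeta)\ge C\,d^-(x_0,x_1)\,|\zeta|^2 .$$ In particular both critical points are nondegenerate, with Hessian eigenvalues of magnitude at least $C\,d^\pm(x_0,x_1)$; the constant $C$ does not depend on $U$, $\phi$, $x_0$ or $x_1$. -/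

import Mathlib

open Set Filter Topology
open scoped ContDiff

noncomputable section

namespace Finsler

/-- Points, tangent vectors and covectors in coordinates; a covector `ξ` acts on a vector `v` by
the dot product `inner ℝ ξ v`. -/
abbrev Sp (d : ℕ) := EuclideanSpace ℝ (Fin d)

variable {d : ℕ}

/-- The partial derivative `∂f/∂x_i` at `x`. -/
def pd (f : Sp d → ℝ) (i : Fin d) (x : Sp d) : ℝ :=
  fderiv ℝ f x (EuclideanSpace.single i 1)

/-- `g_ij(x,v) = (1/2) ∂²F²/∂v^i∂v^j (x,v)`. -/
def metricCoeff (F : Sp d → Sp d → ℝ) (x v : Sp d) : Matrix (Fin d) (Fin d) ℝ :=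
  Matrix.of fun i j => (1 / 2) * pd (fun u => pd (fun w => F x w ^ 2) j u) i v

/-- `F` is a (not necessarily reversible) Finsler metric over the open set `V`. -/
structure IsFinsler (V : Set (Sp d)) (F : Sp d → Sp d → ℝ) : Prop where
  nonneg : ∀ x ∈ V, ∀ v, 0 ≤ F x v
  homogeneous : ∀ x ∈ V, ∀ v, ∀ t : ℝ, 0 ≤ t → F x (t • v) = t * F x v
  smooth : ContDiffOn ℝ ∞ (fun z : Sp d × Sp d => F z.1 z.2) (V ×ˢ {0}ᶜ)
  posDef : ∀ x ∈ V, ∀ v, v ≠ 0 → (metricCoeff F x v).PosDef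

/-- The dual metric `F_*(x,ξ) = sup {ξ(v) : F(x,v) = 1}`. -/
def dual (F : Sp d → Sp d → ℝ) (x ξ : Sp d) : ℝ :=
  sSup {s : ℝ | ∃ v : Sp d, F x v = 1 ∧ s = inner ℝ ξ v}

/-- The Legendre transform `(ℒ_x v)_i = ∑_j g_ij(x,v) v^j`. -/
def legendre (F : Sp d → Sp d → ℝ) (x v : Sp d) : Sp d :=
  WithLp.toLp 2 fun i => ∑ j, metricCoeff F x v i j * v j

/-- The formal Christoffel symbols
`γ^a_jk = ∑_i (g^{ai}/2) (∂_{x_k} g_ij + ∂_{x_j} g_ik - ∂_{x_i} g_jk)`. -/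
def christoffel (F : Sp d → Sp d → ℝ) (x v : Sp d) (a j k : Fin d) : ℝ :=
  ∑ i, (metricCoeff F x v)⁻¹ a i / 2 *
    (pd (fun z => metricCoeff F z v i j) k x + pd (fun z => metricCoeff F z v i k) j x
      - pd (fun z => metricCoeff F z v j k) i x)

/-- The velocity of a curve parametrized by `[0,1]` (one-sided at the end points). -/
def velocity (c : ℝ → Sp d) (t : ℝ) : Sp d := derivWithin c (Icc 0 1) t

/-- The length `∫ F(c, c') dt` of a curve parametrized by `[0,1]`. -/
def length (F : Sp d → Sp d → ℝ) (c : ℝ → Sp d) : ℝ :=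
  ∫ t in (0 : ℝ)..1, F (c t) (velocity c t)

/-- `c : [0,1] → S` is a `C¹` curve from `p` to `q`. -/
structure IsPath (S : Set (Sp d)) (p q : Sp d) (c : ℝ → Sp d) : Prop where
  contDiff : ContDiffOn ℝ 1 c (Icc 0 1)
  mapsTo : MapsTo c (Icc 0 1) S
  source : c 0 = p
  target : c 1 = q

/-- The forward distance `d_+(p,q)` in `S`: the infimum of the lengths of curves in `S` from `p`
to `q`. -/
def dPlus (F : Sp d → Sp d → ℝ) (S : Set (Sp d)) (p q : Sp d) : ℝ :=
  sInf {l : ℝ | ∃ c, IsPath S p q c ∧ l = length F c}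

/-- The backward distance `d_-(p,q) = d_+(q,p)`. -/
def dMinus (F : Sp d → Sp d → ℝ) (S : Set (Sp d)) (p q : Sp d) : ℝ := dPlus F S q p

/-- `c : [0,1] → ℝ^d` is a constant speed forward geodesic. -/
structure IsGeodesic (F : Sp d → Sp d → ℝ) (c : ℝ → Sp d) : Prop where
  contDiff : ContDiffOn ℝ 2 c (Icc 0 1)
  equation : ∀ t ∈ Icc (0 : ℝ) 1, ∀ a : Fin d,
    derivWithin (velocity c) (Icc 0 1) t a =
      -∑ j, ∑ k, christoffel F (c t) (velocity c t) a j k * velocity c t j * velocity c t k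

/-- `c` is a forward geodesic from `p` to `q`, contained in `U`, whose length is the forward
distance from `p` to `q` in `U₀`. -/
structure IsMinimizingGeodesic (F : Sp d → Sp d → ℝ) (U₀ U : Set (Sp d)) (p q : Sp d)
    (c : ℝ → Sp d) : Prop where
  geodesic : IsGeodesic F c
  path : IsPath U p q c
  minimizing : length F c = dPlus F U₀ p q

/-- Any two points of `U` are joined, in either direction, by a minimizing geodesic in `U`. -/
def GeodesicallyConvex (F : Sp d → Sp d → ℝ) (U₀ U : Set (Sp d)) : Prop :=
  ∀ p ∈ U, ∀ q ∈ U, ∃ c, IsMinimizingGeodesic F U₀ U p q c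

/-- The direction of `v`, normalized to have `F(x,·)`-length one. -/
def unit (F : Sp d → Sp d → ℝ) (x v : Sp d) : Sp d := (F x v)⁻¹ • v

/-- `φ(x,y,ξ)`, for `x ∈ W`, `y ∈ U` and `ξ ≠ 0`, is a smooth solution of the eikonal equation
`F_*(x, ∇_x φ) = F_*(y,ξ)` which vanishes on the hyperplane through `y` conormal to `ξ`, with
the orientation `∇_x φ = ξ` at `x = y`. -/
structure IsEikonalPhase (F : Sp d → Sp d → ℝ) (W U : Set (Sp d))
    (φ : Sp d → Sp d → Sp d → ℝ) : Prop where
  smooth : ContDiffOn ℝ ∞ (fun z : Sp d × Sp d × Sp d => φ z.1 z.2.1 z.2.2) (W ×ˢ U ×ˢ {0}ᶜ)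
  eikonal : ∀ x ∈ W, ∀ y ∈ U, ∀ ξ, ξ ≠ 0 →
    dual F x (gradient (fun z => φ z y ξ) x) = dual F y ξ
  vanishing : ∀ x ∈ W, ∀ y ∈ U, ∀ ξ, ξ ≠ 0 → inner ℝ ξ (x - y) = 0 → φ x y ξ = 0
  orientation : ∀ y ∈ U, ∀ ξ, ξ ≠ 0 → gradient (fun z => φ z y ξ) y = ξ

/-- The cosphere `S_x^* = {ξ : F_*(x,ξ) = 1}`. -/
def cosphere (F : Sp d → Sp d → ℝ) (x : Sp d) : Set (Sp d) := {ξ | dual F x ξ = 1}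

/-- The tangent space of the cosphere `S_x^*` at `ξ`, the kernel of the differential of
`F_*(x,·)` at `ξ`. -/
def cosphereTangent (F : Sp d → Sp d → ℝ) (x ξ : Sp d) : Submodule ℝ (Sp d) :=
  LinearMap.ker (fderiv ℝ (dual F x) ξ : Sp d →ₗ[ℝ] ℝ)

/-- `η` is a smooth curve in the hypersurface `S`, defined near parameter `0`, passing through
`ξ` with velocity `ζ` at parameter `0`. -/
structure IsCurveThrough (S : Set (Sp d)) (ξ ζ : Sp d) (η : ℝ → Sp d) : Prop where
  smooth : ContDiffAt ℝ ∞ η 0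
  mem : ∀ᶠ a in 𝓝 (0 : ℝ), η a ∈ S
  base : η 0 = ξ
  vel : HasDerivAt η ζ 0

/-- `ξ ∈ S` is a critical point of the function `Ψ` on the hypersurface `S`. -/
def IsCritical (S : Set (Sp d)) (Ψ : Sp d → ℝ) (ξ : Sp d) : Prop :=
  ξ ∈ S ∧ ∀ ζ η, IsCurveThrough S ξ ζ η → HasDerivAt (fun a => Ψ (η a)) 0 0

/-- `H` is the Hessian at `ξ` of the function `Ψ` on the hypersurface `S` with tangent space `T`
at `ξ`, for a critical point `ξ`: the second derivative of `Ψ` along any curve in `S` through `ξ`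
with velocity `ζ` is `H ζ`. -/
def IsHessian (S : Set (Sp d)) (Ψ : Sp d → ℝ) (ξ : Sp d) (T : Submodule ℝ (Sp d))
    (H : QuadraticForm ℝ T) : Prop :=
  ∀ (ζ : T) (η : ℝ → Sp d), IsCurveThrough S ξ ζ η →
    iteratedDeriv 2 (fun a => Ψ (η a)) 0 = H ζ

end Finsler

end

/-! Fix `x₀` and write `u_ξ = φ(·, x₀, ξ)` for a unit covector `ξ`. The eikonal equation reads
`F_*(x, ∇u_ξ) = 1`, so duality gives `⟨∇u_ξ, w⟩ ≤ F(x, w)`, with equality only if `w` is a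
nonnegative multiple of `ray`. Hence `u_ξ` is a calibration: along a curve in `W` it grows by at
most the speed bound (`IsEikonal.sub_le`), and a constant speed curve achieving this is a
characteristic (`IsEikonal.eq_ray_of_sub_eq`). A geodesic tangent to `ray` at one time is a
characteristic (`IsGeodesic.velocity_eq_ray`). Testing all `u_ξ` on the two minimizing geodesics
gives `-d⁻ ≤ Ψ ≤ d⁺`, attained at `ξ⁻` and `ξ⁺`; these are extrema, hence critical.

There are no others. If `ξ` is critical, follow the characteristic of `u_ξ` from `x₁` to the
hyperplane through `x₀` conormal to `ξ`. Derivatives of `φ` in `ξ` along the cosphere are first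
integrals of the characteristics, so they still vanish at the foot point, and since `φ` vanishes on
all the hyperplanes, tilting the hyperplane shows that the foot point is `x₀`
(`IsEikonalPhase.eq_of_isCritical`). The characteristic thus joins `x₀` and `x₁` in time `τ = Ψ(ξ)`.
Calibrating it by `u_{ξ±}`, and the geodesics by `u_ξ`, forces `τ = d⁺` or `τ = -d⁻` and then `ξ =
ξ⁺` or `ξ = ξ⁻`.

For the Hessians, vary `ξ` along a curve in the cosphere with velocity `ζ`. The second parameter
derivative of the phase is zero at `x₀` and decreases along a characteristic at the rate `⟨q, H_ξξ
q⟩ ≥ κ|q|²`, where `q` is the gradient of the first parameter derivative. Initially `q = ζ`, and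
`|q|` at least keeps half its size for a short time (`IsEikonalFamily.exists_paramDeriv_two_eq`).

Uniformity in `φ` is the delicate point, as no bounds on `φ` are given. The vanishing condition and
the equation bound the spatial Hessian of `u_ξ` at `x₀`, and a Riccati inequality propagates the
bound along short characteristics. That the characteristic reaches the hyperplane inside `W` follows
from `‖∇u_ξ - ξ‖` being small, proved by a first-failure argument in a domain of dependence
(`IsEikonal.norm_gradient_sub_le_of_coneNorm_le`). -/

noncomputable section

namespace Finsler

variable {d : ℕ}

/-! ### Partial gradients -/

section PartialGradients

variable {A B : Type*} [NormedAddCommGroup A] [NormedSpace ℝ A] [NormedAddCommGroup B]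
  [NormedSpace ℝ B]

theorem fderiv_fderiv_comm {f : A → B} {z : A} (hf : ContDiffAt ℝ ∞ f z) (u w : A) :
    fderiv ℝ (fderiv ℝ f) z u w = fderiv ℝ (fderiv ℝ f) z w u :=
  (hf.isSymmSndFDerivAt (by
    rw [minSmoothness_of_isRCLikeNormedField]
    exact WithTop.coe_le_coe.2 (le_top : (2 : ℕ∞) ≤ ⊤))).eq u w

theorem _root_.ContDiffAt.fderiv_infty {f : A → B} {z : A} (hf : ContDiffAt ℝ ∞ f z) :
    ContDiffAt ℝ ∞ (fderiv ℝ f) z :=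
  hf.fderiv_right (by simp)

theorem _root_.ContDiffAt.differentiableAt_infty {f : A → B} {z : A} (hf : ContDiffAt ℝ ∞ f z) :
    DifferentiableAt ℝ f z :=
  hf.differentiableAt (by simp)

theorem fderiv_apply_comm {f : A → B} {z : A} (hf : ContDiffAt ℝ ∞ f z) (u w : A) :
    fderiv ℝ (fun y => fderiv ℝ f y u) z w = fderiv ℝ (fun y => fderiv ℝ f y w) z u := by
  have h := hf.fderiv_infty.differentiableAt_infty
  rw [fderiv_clm_apply h (differentiableAt_const u), fderiv_clm_apply h (differentiableAt_const w)]
  simpa using fderiv_fderiv_comm hf w u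

theorem hasFDerivAt_fst_slot {C : Type*} [NormedAddCommGroup C] [NormedSpace ℝ C] {f : A × C → B}
    {x : A} {y : C} (h : DifferentiableAt ℝ f (x, y)) :
    HasFDerivAt (fun w => f (w, y)) ((fderiv ℝ f (x, y)).comp (.inl ℝ A C)) x :=
  h.hasFDerivAt.comp x (hasFDerivAt_prodMk_left x y)

theorem hasFDerivAt_snd_slot {C : Type*} [NormedAddCommGroup C] [NormedSpace ℝ C] {f : A × C → B}
    {x : A} {y : C} (h : DifferentiableAt ℝ f (x, y)) :
    HasFDerivAt (fun w => f (x, w)) ((fderiv ℝ f (x, y)).comp (.inr ℝ A C)) y :=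
  h.hasFDerivAt.comp y (hasFDerivAt_prodMk_right x y)

/-- The partial gradient with respect to the first variable. -/
def gradFst (f : Sp d × A → ℝ) (z : Sp d × A) : Sp d :=
  (InnerProductSpace.toDual ℝ (Sp d)).symm ((fderiv ℝ f z).comp (.inl ℝ (Sp d) A))

/-- The partial gradient with respect to the second variable. -/
def gradSnd (f : A × Sp d → ℝ) (z : A × Sp d) : Sp d :=
  (InnerProductSpace.toDual ℝ (Sp d)).symm ((fderiv ℝ f z).comp (.inr ℝ A (Sp d)))

theorem inner_gradFst (f : Sp d × A → ℝ) (z : Sp d × A) (u : Sp d) :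
    inner ℝ (gradFst f z) u = fderiv ℝ f z (u, 0) := by
  simp [gradFst]

theorem inner_gradSnd (f : A × Sp d → ℝ) (z : A × Sp d) (u : Sp d) :
    inner ℝ (gradSnd f z) u = fderiv ℝ f z (0, u) := by
  simp [gradSnd]

theorem contDiffAt_gradFst {f : Sp d × A → ℝ} {z : Sp d × A} (h : ContDiffAt ℝ ∞ f z) :
    ContDiffAt ℝ ∞ (gradFst f) z :=
  (LinearIsometryEquiv.contDiff _).contDiffAt.comp z (h.fderiv_infty.clm_comp contDiffAt_const)

theorem contDiffAt_gradSnd {f : A × Sp d → ℝ} {z : A × Sp d} (h : ContDiffAt ℝ ∞ f z) :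
    ContDiffAt ℝ ∞ (gradSnd f) z :=
  (LinearIsometryEquiv.contDiff _).contDiffAt.comp z (h.fderiv_infty.clm_comp contDiffAt_const)

theorem inner_fderiv_gradFst {f : Sp d × A → ℝ} {z : Sp d × A} (h : ContDiffAt ℝ ∞ f z)
    (w : Sp d × A) (u : Sp d) :
    inner ℝ (fderiv ℝ (gradFst f) z w) u = fderiv ℝ (fderiv ℝ f) z w (u, 0) := by
  have h1 : (fun y => inner ℝ (gradFst f y) u) = fun y => fderiv ℝ f y (u, 0) :=
    funext fun y => inner_gradFst f y u
  have h2 := congrArg (fun g => fderiv ℝ g z w) h1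
  rw [fderiv_inner_apply ℝ (contDiffAt_gradFst h).differentiableAt_infty
    (differentiableAt_const u), fderiv_clm_apply h.fderiv_infty.differentiableAt_infty
    (differentiableAt_const _)] at h2
  simpa using h2

theorem inner_fderiv_gradSnd {f : A × Sp d → ℝ} {z : A × Sp d} (h : ContDiffAt ℝ ∞ f z)
    (w : A × Sp d) (u : Sp d) :
    inner ℝ (fderiv ℝ (gradSnd f) z w) u = fderiv ℝ (fderiv ℝ f) z w (0, u) := by
  have h1 : (fun y => inner ℝ (gradSnd f y) u) = fun y => fderiv ℝ f y (0, u) :=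
    funext fun y => inner_gradSnd f y u
  have h2 := congrArg (fun g => fderiv ℝ g z w) h1
  rw [fderiv_inner_apply ℝ (contDiffAt_gradSnd h).differentiableAt_infty
    (differentiableAt_const u), fderiv_clm_apply h.fderiv_infty.differentiableAt_infty
    (differentiableAt_const _)] at h2
  simpa using h2

theorem gradient_fst_slot {f : Sp d × A → ℝ} {x : Sp d} {y : A}
    (h : DifferentiableAt ℝ f (x, y)) : gradient (fun w => f (w, y)) x = gradFst f (x, y) := by
  rw [gradient, (hasFDerivAt_fst_slot h).fderiv, gradFst]

end PartialGradients

/-! ### Finsler metrics: the Legendre transform -/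

section Metric

variable {V : Set (Sp d)} {F : Sp d → Sp d → ℝ}

/-- The square of the metric as a function of position and velocity. -/
def sq (F : Sp d → Sp d → ℝ) (z : Sp d × Sp d) : ℝ := F z.1 z.2 ^ 2

/-- The Legendre transform as a function of position and velocity. -/
def momentum (F : Sp d → Sp d → ℝ) (z : Sp d × Sp d) : Sp d := (1 / 2 : ℝ) • gradSnd (sq F) z

theorem IsFinsler.contDiffAt (hV : IsOpen V) (hF : IsFinsler V F) {x v : Sp d} (hx : x ∈ V)
    (hv : v ≠ 0) : ContDiffAt ℝ ∞ (fun z : Sp d × Sp d => F z.1 z.2) (x, v) :=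
  hF.smooth.contDiffAt ((hV.prod isOpen_compl_singleton).mem_nhds ⟨hx, hv⟩)

theorem IsFinsler.contDiffAt_sq (hV : IsOpen V) (hF : IsFinsler V F) {x v : Sp d} (hx : x ∈ V)
    (hv : v ≠ 0) : ContDiffAt ℝ ∞ (sq F) (x, v) :=
  (hF.contDiffAt hV hx hv).pow 2

theorem IsFinsler.contDiffAt_momentum (hV : IsOpen V) (hF : IsFinsler V F) {x v : Sp d}
    (hx : x ∈ V) (hv : v ≠ 0) : ContDiffAt ℝ ∞ (momentum F) (x, v) :=
  (contDiffAt_gradSnd (hF.contDiffAt_sq hV hx hv)).const_smul _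

theorem fderiv_sq_snd (F : Sp d → Sp d → ℝ) (z : Sp d × Sp d) (u : Sp d) :
    fderiv ℝ (sq F) z (0, u) = 2 * inner ℝ (momentum F z) u := by
  rw [momentum, real_inner_smul_left, inner_gradSnd]; ring

theorem IsFinsler.inner_fderiv_momentum (hV : IsOpen V) (hF : IsFinsler V F) {x v : Sp d}
    (hx : x ∈ V) (hv : v ≠ 0) (w : Sp d × Sp d) (u : Sp d) :
    inner ℝ (fderiv ℝ (momentum F) (x, v) w) u
      = 1 / 2 * fderiv ℝ (fderiv ℝ (sq F)) (x, v) w (0, u) := by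
  have h := hF.contDiffAt_sq hV hx hv
  have : fderiv ℝ (momentum F) (x, v) = (1 / 2 : ℝ) • fderiv ℝ (gradSnd (sq F)) (x, v) :=
    fderiv_fun_const_smul (contDiffAt_gradSnd h).differentiableAt_infty (1 / 2 : ℝ)
  rw [this, smul_apply, real_inner_smul_left, inner_fderiv_gradSnd h]

theorem IsFinsler.inner_fderiv_momentum_comm (hV : IsOpen V) (hF : IsFinsler V F) {x v : Sp d}
    (hx : x ∈ V) (hv : v ≠ 0) (w u : Sp d) :
    inner ℝ (fderiv ℝ (momentum F) (x, v) (0, w)) u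
      = inner ℝ (fderiv ℝ (momentum F) (x, v) (0, u)) w := by
  rw [hF.inner_fderiv_momentum hV hx hv, hF.inner_fderiv_momentum hV hx hv,
    fderiv_fderiv_comm (hF.contDiffAt_sq hV hx hv)]

theorem pd_sq {x u : Sp d} (h : DifferentiableAt ℝ (sq F) (x, u)) (j : Fin d) :
    pd (fun w => F x w ^ 2) j u = 2 * momentum F (x, u) j := by
  have h1 := (hasFDerivAt_snd_slot h).fderiv
  have h2 := fderiv_sq_snd F (x, u) (EuclideanSpace.single j 1)
  simp only [EuclideanSpace.inner_single_right, one_mul, conj_trivial] at h2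
  rw [pd, ← h2]
  change fderiv ℝ (fun w => sq F (x, w)) u _ = _
  rw [h1]; simp

theorem IsFinsler.metricCoeff_eq (hV : IsOpen V) (hF : IsFinsler V F) {x v : Sp d}
    (hx : x ∈ V) (hv : v ≠ 0) (i j : Fin d) :
    metricCoeff F x v i j
      = fderiv ℝ (momentum F) (x, v) (0, EuclideanSpace.single i 1) j := by
  have h1 : (fun u => pd (fun w => F x w ^ 2) j u) =ᶠ[𝓝 v] fun u => 2 * momentum F (x, u) j := by
    filter_upwards [isOpen_compl_singleton.mem_nhds hv] with u hu
    exact pd_sq (hF.contDiffAt_sq hV hx hu).differentiableAt_infty j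
  have h2 := hasFDerivAt_snd_slot (hF.contDiffAt_momentum hV hx hv).differentiableAt_infty
  have h3 : HasFDerivAt (fun u => 2 * momentum F (x, u) j)
      ((2 : ℝ) • ((EuclideanSpace.proj j : Sp d →L[ℝ] ℝ).comp
        ((fderiv ℝ (momentum F) (x, v)).comp (.inr ℝ (Sp d) (Sp d))))) v :=
    (((EuclideanSpace.proj j : Sp d →L[ℝ] ℝ).hasFDerivAt).comp v h2).const_mul 2
  simp only [metricCoeff, Matrix.of_apply]
  rw [pd, h1.fderiv_eq, h3.fderiv]
  simp

theorem IsFinsler.inner_fderiv_momentum_eq_sum (hV : IsOpen V) (hF : IsFinsler V F) {x v : Sp d}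
    (hx : x ∈ V) (hv : v ≠ 0) (u w : Sp d) :
    inner ℝ (fderiv ℝ (momentum F) (x, v) (0, u)) w
      = ∑ i, ∑ j, metricCoeff F x v i j * u i * w j := by
  have hu : u = ∑ i, u i • EuclideanSpace.single i (1 : ℝ) := by
    ext k; simp [Finset.sum_apply, Pi.single_apply]
  have h : fderiv ℝ (momentum F) (x, v) (0, u) =
      ∑ i, u i • fderiv ℝ (momentum F) (x, v) (0, EuclideanSpace.single i 1) := by
    have : ((0, u) : Sp d × Sp d) = ∑ i, u i • ((0, EuclideanSpace.single i 1) : Sp d × Sp d) := by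
      refine Prod.ext ?_ ?_
      · simp [Prod.fst_sum]
      · simpa [Prod.snd_sum] using hu
    rw [this, map_sum]; simp only [map_smul]
  rw [h, sum_inner]
  refine Finset.sum_congr rfl fun i _ => ?_
  rw [real_inner_smul_left, PiLp.inner_apply, Finset.mul_sum]
  refine Finset.sum_congr rfl fun j _ => ?_
  rw [hF.metricCoeff_eq hV hx hv]
  simp; ring

theorem IsFinsler.metric_pos (hV : IsOpen V) (hF : IsFinsler V F) {x v : Sp d}
    (hx : x ∈ V) (hv : v ≠ 0) {u : Sp d} (hu : u ≠ 0) :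
    0 < inner ℝ (fderiv ℝ (momentum F) (x, v) (0, u)) u := by
  rw [hF.inner_fderiv_momentum_eq_sum hV hx hv]
  have h := ((Matrix.posDef_iff_dotProduct_mulVec).1 (hF.posDef x hx v hv)).2
    (x := u.ofLp) (by simpa using hu)
  simp only [dotProduct, Matrix.mulVec, star_trivial, Finset.mul_sum] at h
  refine h.trans_eq (Finset.sum_congr rfl fun i _ => Finset.sum_congr rfl fun j _ => ?_)
  ring

theorem IsFinsler.momentum_smul (hV : IsOpen V) (hF : IsFinsler V F) {x v : Sp d}
    (hx : x ∈ V) (hv : v ≠ 0) {t : ℝ} (ht : 0 < t) :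
    momentum F (x, t • v) = t • momentum F (x, v) := by
  have htv : t • v ≠ 0 := smul_ne_zero ht.ne' hv
  refine ext_inner_right ℝ fun u => ?_
  have h1 : HasFDerivAt (fun w => sq F (x, t • w)) (((fderiv ℝ (sq F) (x, t • v)).comp
      (.inr ℝ (Sp d) (Sp d))).comp (t • .id ℝ (Sp d))) v :=
    HasFDerivAt.comp (g := fun w => sq F (x, w)) v
      (hasFDerivAt_snd_slot (hF.contDiffAt_sq hV hx htv).differentiableAt_infty)
      ((hasFDerivAt_id v).const_smul t)
  have h2 : HasFDerivAt (fun w => t ^ 2 * sq F (x, w)) (t ^ 2 • ((fderiv ℝ (sq F) (x, v)).comp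
      (.inr ℝ (Sp d) (Sp d)))) v :=
    (hasFDerivAt_snd_slot (hF.contDiffAt_sq hV hx hv).differentiableAt_infty).const_mul _
  have h3 : (fun w => sq F (x, t • w)) = fun w => t ^ 2 * sq F (x, w) := by
    funext w; simp only [sq]; rw [hF.homogeneous x hx w t ht.le]; ring
  rw [h3] at h1
  have h4 := congrArg (fun g => g u) (h1.unique h2)
  simp only [ContinuousLinearMap.comp_apply, smul_apply,
    ContinuousLinearMap.id_apply, ContinuousLinearMap.inr_apply, smul_eq_mul] at h4
  rw [show ((0, t • u) : Sp d × Sp d) = t • (0, u) by simp, map_smul, fderiv_sq_snd,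
    fderiv_sq_snd, smul_eq_mul] at h4
  rw [real_inner_smul_left]
  have : t * (2 * t) ≠ 0 := by positivity
  field_simp at h4
  linarith

/-- Euler's identity for the function `F²`, homogeneous of degree two in the velocity. -/
theorem IsFinsler.inner_momentum_self (hV : IsOpen V) (hF : IsFinsler V F) {x v : Sp d}
    (hx : x ∈ V) (hv : v ≠ 0) : inner ℝ (momentum F (x, v)) v = F x v ^ 2 := by
  have h1 : HasDerivAt (fun t : ℝ => sq F (x, t • v))
      (((fderiv ℝ (sq F) (x, v)).comp (.inr ℝ (Sp d) (Sp d))) v) 1 := by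
    have h := hasFDerivAt_snd_slot (hF.contDiffAt_sq hV hx hv).differentiableAt_infty
    have h' : HasDerivAt (fun t : ℝ => t • v) v 1 := by
      simpa using (hasDerivAt_id (1 : ℝ)).smul_const v
    exact HasFDerivAt.comp_hasDerivAt_of_eq (l := fun w => sq F (x, w)) 1 h h' (by simp)
  have h2 : HasDerivAt (fun t : ℝ => t ^ 2 * sq F (x, v)) (2 * sq F (x, v)) 1 := by
    simpa using ((hasDerivAt_pow 2 (1 : ℝ)).mul_const (sq F (x, v)))
  have h3 : (fun t : ℝ => sq F (x, t • v)) =ᶠ[𝓝 1] fun t => t ^ 2 * sq F (x, v) := by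
    filter_upwards [lt_mem_nhds one_pos] with t ht
    simp only [sq]; rw [hF.homogeneous x hx v t ht.le]; ring
  have h4 := h1.unique (h2.congr_of_eventuallyEq h3)
  simp only [ContinuousLinearMap.comp_apply, ContinuousLinearMap.inr_apply, fderiv_sq_snd,
    sq] at h4
  linarith

/-- Euler's identity for the momentum, homogeneous of degree one. -/
theorem IsFinsler.fderiv_momentum_self (hV : IsOpen V) (hF : IsFinsler V F) {x v : Sp d}
    (hx : x ∈ V) (hv : v ≠ 0) : fderiv ℝ (momentum F) (x, v) (0, v) = momentum F (x, v) := by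
  have h1 : HasDerivAt (fun t : ℝ => momentum F (x, t • v))
      (((fderiv ℝ (momentum F) (x, v)).comp (.inr ℝ (Sp d) (Sp d))) v) 1 := by
    have h := hasFDerivAt_snd_slot (hF.contDiffAt_momentum hV hx hv).differentiableAt_infty
    have h' : HasDerivAt (fun t : ℝ => t • v) v 1 := by
      simpa using (hasDerivAt_id (1 : ℝ)).smul_const v
    exact HasFDerivAt.comp_hasDerivAt_of_eq (l := fun w => momentum F (x, w)) 1 h h' (by simp)
  have h2 : HasDerivAt (fun t : ℝ => t • momentum F (x, v)) (momentum F (x, v)) 1 := by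
    simpa using (hasDerivAt_id (1 : ℝ)).smul_const (momentum F (x, v))
  have h3 : (fun t : ℝ => momentum F (x, t • v)) =ᶠ[𝓝 1] fun t => t • momentum F (x, v) := by
    filter_upwards [lt_mem_nhds one_pos] with t ht
    exact hF.momentum_smul hV hx hv ht
  simpa using h1.unique (h2.congr_of_eventuallyEq h3)

/-- Both Euler identities together give `F² = g_v(v, v)`, so positive definiteness upgrades
nonnegativity. -/
theorem IsFinsler.pos (hV : IsOpen V) (hF : IsFinsler V F) {x v : Sp d}
    (hx : x ∈ V) (hv : v ≠ 0) : 0 < F x v := by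
  have h := hF.metric_pos hV hx hv hv
  rw [hF.fderiv_momentum_self hV hx hv, hF.inner_momentum_self hV hx hv] at h
  exact lt_of_le_of_ne (hF.nonneg x hx v) fun h0 => by simp [← h0] at h

theorem IsFinsler.apply_zero (hF : IsFinsler V F) {x : Sp d} (hx : x ∈ V) : F x 0 = 0 := by
  simpa using hF.homogeneous x hx 0 0 le_rfl

theorem IsFinsler.legendre_eq (hV : IsOpen V) (hF : IsFinsler V F) {x v : Sp d}
    (hx : x ∈ V) (hv : v ≠ 0) : legendre F x v = momentum F (x, v) := by
  refine ext_inner_right ℝ fun u => ?_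
  rw [← hF.fderiv_momentum_self hV hx hv, hF.inner_fderiv_momentum_comm hV hx hv,
    hF.inner_fderiv_momentum_eq_sum hV hx hv, PiLp.inner_apply]
  refine Finset.sum_congr rfl fun i _ => ?_
  simp only [legendre, RCLike.inner_apply, conj_trivial, Finset.mul_sum]
  exact Finset.sum_congr rfl fun j _ => by ring

end Metric

/-! ### Fundamental inequality, dual metric and the Hamiltonian. -/

section Duality

variable {V : Set (Sp d)} {F : Sp d → Sp d → ℝ}

/-- Strict convexity of `F²` along the line from `v` to `w`, which avoids the origin, the only place
where smoothness fails: the graph lies strictly above its tangent at `v`, whose slope is evaluated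
by Euler's identity. -/
theorem IsFinsler.two_mul_inner_momentum_lt (hV : IsOpen V) (hF : IsFinsler V F) {x v w : Sp d}
    (hx : x ∈ V) (hv : v ≠ 0) (h : ∀ t : ℝ, w ≠ t • v) :
    2 * inner ℝ (momentum F (x, v)) w < F x v ^ 2 + F x w ^ 2 := by
  have hne : ∀ τ : ℝ, v + τ • (w - v) ≠ 0 := by
    intro τ h0
    rcases eq_or_ne τ 0 with rfl | hτ
    · simp [hv] at h0
    · refine h ((τ - 1) / τ) ?_
      have h1 : τ • w = (τ - 1) • v := by
        rw [← sub_eq_zero, ← h0]; module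
      rw [div_eq_inv_mul, mul_smul, ← h1, smul_smul, inv_mul_cancel₀ hτ, one_smul]
  have hγ : ∀ τ : ℝ, HasDerivAt (fun τ : ℝ => v + τ • (w - v)) (w - v) τ := by
    intro τ
    simpa using ((hasDerivAt_id τ).smul_const (w - v)).const_add v
  have hk : ∀ τ : ℝ, HasDerivAt (fun τ : ℝ => sq F (x, v + τ • (w - v)))
      (2 * inner ℝ (momentum F (x, v + τ • (w - v))) (w - v)) τ := by
    intro τ
    have h1 := hasFDerivAt_snd_slot
      (hF.contDiffAt_sq hV hx (hne τ)).differentiableAt_infty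
    have h2 := HasFDerivAt.comp_hasDerivAt (l := fun w => sq F (x, w)) τ h1 (hγ τ)
    simpa [fderiv_sq_snd, Function.comp_def] using h2
  have hk' : ∀ τ : ℝ, HasDerivAt
      (fun τ : ℝ => 2 * inner ℝ (momentum F (x, v + τ • (w - v))) (w - v))
      (2 * inner ℝ (fderiv ℝ (momentum F) (x, v + τ • (w - v)) (0, w - v)) (w - v)) τ := by
    intro τ
    have h1 := hasFDerivAt_snd_slot
      (hF.contDiffAt_momentum hV hx (hne τ)).differentiableAt_infty
    have h2 := HasFDerivAt.comp_hasDerivAt (l := fun w => momentum F (x, w)) τ h1 (hγ τ)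
    have h3 := (h2.inner ℝ (hasDerivAt_const τ (w - v))).const_mul 2
    simpa [Function.comp_def] using h3
  have hwv : w - v ≠ 0 := sub_ne_zero.2 fun e => h 1 (by simpa using e)
  have hmono : StrictMono
      (fun τ : ℝ => 2 * inner ℝ (momentum F (x, v + τ • (w - v))) (w - v)) := by
    refine strictMono_of_deriv_pos fun τ => ?_
    rw [(hk' τ).deriv]
    exact mul_pos two_pos (hF.metric_pos hV hx (hne τ) hwv)
  obtain ⟨c, hc, hc'⟩ := exists_hasDerivAt_eq_slope _ _ (zero_lt_one' ℝ)
    (fun τ _ => (hk τ).continuousAt.continuousWithinAt) (fun τ _ => hk τ)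
  have h1 := hmono hc.1
  simp only [zero_smul, add_zero] at h1
  rw [hc'] at h1
  simp only [sub_zero, div_one, one_smul, zero_smul, add_zero, add_sub_cancel, sq,
    inner_sub_right, hF.inner_momentum_self hV hx hv] at h1
  linarith

/-- Rescaling `w` to the length of `v` turns the additive inequality into the multiplicative one.
Nonpositive multiples of `v`, excluded there, are settled by the sign. -/
theorem IsFinsler.inner_momentum_lt (hV : IsOpen V) (hF : IsFinsler V F) {x v w : Sp d}
    (hx : x ∈ V) (hv : v ≠ 0) (hw : w ≠ 0) (h : ∀ t : ℝ, 0 < t → w ≠ t • v) :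
    inner ℝ (momentum F (x, v)) w < F x v * F x w := by
  have hFv := hF.pos hV hx hv
  have hFw := hF.pos hV hx hw
  by_cases h' : ∃ t : ℝ, w = t • v
  · obtain ⟨t, rfl⟩ := h'
    have ht : t ≤ 0 := not_lt.1 fun ht => h t ht rfl
    rw [inner_smul_right, hF.inner_momentum_self hV hx hv]
    have : t * F x v ^ 2 ≤ 0 := mul_nonpos_of_nonpos_of_nonneg ht (by positivity)
    nlinarith [mul_pos hFv hFw]
  · push Not at h'
    have hs : 0 < F x v / F x w := by positivity
    have h1 := hF.two_mul_inner_momentum_lt hV hx hv (w := (F x v / F x w) • w) (by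
      intro t ht
      refine h' ((F x v / F x w)⁻¹ * t) ?_
      rw [mul_smul, ← ht, smul_smul, inv_mul_cancel₀ hs.ne', one_smul])
    rw [hF.homogeneous x hx w _ hs.le, inner_smul_right, div_mul_cancel₀ _ hFw.ne'] at h1
    have h2 : F x v / F x w * inner ℝ (momentum F (x, v)) w < F x v ^ 2 := by linarith
    rw [div_mul_eq_mul_div, div_lt_iff₀ hFw] at h2
    nlinarith

theorem IsFinsler.inner_momentum_le (hV : IsOpen V) (hF : IsFinsler V F) {x v : Sp d}
    (hx : x ∈ V) (hv : v ≠ 0) (w : Sp d) :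
    inner ℝ (momentum F (x, v)) w ≤ F x v * F x w := by
  rcases eq_or_ne w 0 with rfl | hw
  · simp [hF.apply_zero hx]
  by_cases h : ∃ t : ℝ, 0 < t ∧ w = t • v
  · obtain ⟨t, ht, rfl⟩ := h
    rw [inner_smul_right, hF.inner_momentum_self hV hx hv, hF.homogeneous x hx v t ht.le]
    exact le_of_eq (by ring)
  · push Not at h
    exact (hF.inner_momentum_lt hV hx hv hw h).le

theorem IsFinsler.eq_of_inner_momentum_eq (hV : IsOpen V) (hF : IsFinsler V F) {x v w : Sp d}
    (hx : x ∈ V) (hv : v ≠ 0) (hvw : F x v = F x w)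
    (h : inner ℝ (momentum F (x, v)) w = F x v * F x w) : w = v := by
  have hFv := hF.pos hV hx hv
  have hw : w ≠ 0 := by rintro rfl; rw [hF.apply_zero hx] at hvw; exact hFv.ne' hvw
  by_contra hne
  refine (hF.inner_momentum_lt hV hx hv hw fun t ht e => hne ?_).ne h
  rw [e, hF.homogeneous x hx v t ht.le] at hvw
  have : t = 1 := by
    have := mul_right_cancel₀ hFv.ne' ((one_mul _).trans hvw)
    exact this.symm
  rw [e, this, one_smul]

theorem IsFinsler.momentum_ne_zero (hV : IsOpen V) (hF : IsFinsler V F) {x v : Sp d}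
    (hx : x ∈ V) (hv : v ≠ 0) : momentum F (x, v) ≠ 0 := by
  intro h
  have h1 := hF.inner_momentum_self hV hx hv
  have h2 := hF.pos hV hx hv
  rw [h, inner_zero_left] at h1
  exact h2.ne' (by simpa using h1.symm)

/-- The fundamental inequality used in both directions gives equal lengths; its equality case then
gives equal vectors. -/
theorem IsFinsler.momentum_injective (hV : IsOpen V) (hF : IsFinsler V F) {x v w : Sp d}
    (hx : x ∈ V) (hv : v ≠ 0) (hw : w ≠ 0) (h : momentum F (x, v) = momentum F (x, w)) :
    w = v := by
  have h1 := hF.inner_momentum_self hV hx hv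
  have h2 := hF.inner_momentum_self hV hx hw
  have h3 := hF.inner_momentum_le hV hx hv w
  have h4 := hF.inner_momentum_le hV hx hw v
  have hFv := hF.pos hV hx hv
  have hFw := hF.pos hV hx hw
  rw [h] at h1 h3
  have h5 : F x v = F x w := by
    rw [h1] at h4; rw [h2] at h3
    exact le_antisymm (by nlinarith) (by nlinarith)
  refine hF.eq_of_inner_momentum_eq hV hx hv h5 ?_
  rw [h, h2, h5]; ring

theorem IsFinsler.fderiv_snd_mul (hV : IsOpen V) (hF : IsFinsler V F) {x v : Sp d}
    (hx : x ∈ V) (hv : v ≠ 0) (u : Sp d) :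
    F x v * fderiv ℝ (fun w => F x w) v u = inner ℝ (momentum F (x, v)) u := by
  have h0 := hasFDerivAt_snd_slot (hF.contDiffAt hV hx hv).differentiableAt_infty
  have h1 := h0.pow 2
  have h2 := hasFDerivAt_snd_slot (hF.contDiffAt_sq hV hx hv).differentiableAt_infty
  have h3 := congrArg (fun g => g u) (h1.unique h2)
  simp only [smul_apply, ContinuousLinearMap.comp_apply,
    ContinuousLinearMap.inr_apply, fderiv_sq_snd, smul_eq_mul] at h3
  rw [h0.fderiv]
  simp only [ContinuousLinearMap.comp_apply, ContinuousLinearMap.inr_apply]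
  simp at h3
  linarith

/-- Maximize `⟨ξ, u⟩ / F(x, u)` over the Euclidean sphere, with maximum `m`. By homogeneity `m F -
ξ` has a minimum at the maximizer, so `ξ = m dF` there, and `F dF` is the momentum. -/
theorem IsFinsler.momentum_surjective (hV : IsOpen V) (hF : IsFinsler V F) {x ξ : Sp d}
    (hx : x ∈ V) (hξ : ξ ≠ 0) : ∃ v, v ≠ 0 ∧ momentum F (x, v) = ξ := by
  have hne : ∀ u ∈ Metric.sphere (0 : Sp d) 1, u ≠ 0 := fun u hu =>
    ne_zero_of_mem_unit_sphere (⟨u, hu⟩ : Metric.sphere (0 : Sp d) 1)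
  have hcont : ContinuousOn (fun u => inner ℝ ξ u / F x u) (Metric.sphere (0 : Sp d) 1) := by
    intro u hu
    refine ContinuousAt.continuousWithinAt (ContinuousAt.div (by fun_prop) ?_
      (hF.pos hV hx (hne u hu)).ne')
    exact (hasFDerivAt_snd_slot
      (hF.contDiffAt hV hx (hne u hu)).differentiableAt_infty).continuousAt
  have hmem : ∀ w : Sp d, w ≠ 0 → ‖w‖⁻¹ • w ∈ Metric.sphere (0 : Sp d) 1 := by
    intro w hw
    simp [norm_smul, norm_ne_zero_iff.2 hw]
  obtain ⟨u, hu, hmax⟩ := (isCompact_sphere (0 : Sp d) 1).exists_isMaxOn ⟨_, hmem ξ hξ⟩ hcont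
  have hu0 := hne u hu
  have hFu := hF.pos hV hx hu0
  set m := inner ℝ ξ u / F x u with hm
  have hle : ∀ w, w ≠ 0 → inner ℝ ξ w ≤ m * F x w := by
    intro w hw
    have h1 := hmax (hmem w hw)
    have hn : 0 < ‖w‖⁻¹ := inv_pos.2 (norm_pos_iff.2 hw)
    simp only [mem_ofPred_eq] at h1
    rw [inner_smul_right, hF.homogeneous x hx w _ hn.le, mul_div_mul_left _ _ hn.ne',
      div_le_iff₀ (hF.pos hV hx hw)] at h1
    exact h1
  have hmpos : 0 < m := by
    have h1 := hle ξ hξ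
    rw [real_inner_self_eq_norm_sq] at h1
    have h2 : 0 < ‖ξ‖ ^ 2 := by positivity
    exact pos_of_mul_pos_left (h2.trans_le h1) (hF.pos hV hx hξ).le
  have hmin : IsLocalMin (fun w => m * F x w - inner ℝ ξ w) u := by
    filter_upwards [isOpen_compl_singleton.mem_nhds hu0] with w hw
    have : m * F x u - inner ℝ ξ u = 0 := by rw [hm, div_mul_cancel₀ _ hFu.ne', sub_self]
    rw [this]; linarith [hle w hw]
  have hd := (hasFDerivAt_snd_slot (hF.contDiffAt hV hx hu0).differentiableAt_infty).differentiableAt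
  have hd' : DifferentiableAt ℝ (fun w => F x w) u := hd
  have h1 := hmin.hasFDerivAt_eq_zero ((hd'.hasFDerivAt.const_mul m).sub
    (innerSL ℝ ξ).hasFDerivAt)
  refine ⟨(m / F x u) • u, smul_ne_zero (by positivity) hu0, ?_⟩
  rw [hF.momentum_smul hV hx hu0 (by positivity)]
  refine ext_inner_right ℝ fun w => ?_
  have h2 := congrArg (fun g => g w) h1
  simp only [sub_apply, smul_apply, smul_eq_mul,
    innerSL_apply_apply, zero_apply] at h2
  rw [real_inner_smul_left, ← hF.fderiv_snd_mul hV hx hu0]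
  field_simp
  linarith

/-- The inverse of the Legendre transform, as a function of position and covector. -/
def colegendre (F : Sp d → Sp d → ℝ) (z : Sp d × Sp d) : Sp d :=
  Classical.epsilon fun v => v ≠ 0 ∧ momentum F (z.1, v) = z.2

theorem IsFinsler.colegendre_spec (hV : IsOpen V) (hF : IsFinsler V F) {x ξ : Sp d}
    (hx : x ∈ V) (hξ : ξ ≠ 0) :
    colegendre F (x, ξ) ≠ 0 ∧ momentum F (x, colegendre F (x, ξ)) = ξ :=
  Classical.epsilon_spec (hF.momentum_surjective hV hx hξ)

theorem IsFinsler.colegendre_momentum (hV : IsOpen V) (hF : IsFinsler V F) {x v : Sp d}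
    (hx : x ∈ V) (hv : v ≠ 0) : colegendre F (x, momentum F (x, v)) = v := by
  obtain ⟨h1, h2⟩ := hF.colegendre_spec hV hx (hF.momentum_ne_zero hV hx hv)
  exact hF.momentum_injective hV hx hv h1 h2.symm

theorem IsFinsler.dual_momentum (hV : IsOpen V) (hF : IsFinsler V F) {x v : Sp d}
    (hx : x ∈ V) (hv : v ≠ 0) : dual F x (momentum F (x, v)) = F x v := by
  have hFv := hF.pos hV hx hv
  refine IsGreatest.csSup_eq ⟨⟨(F x v)⁻¹ • v, ?_, ?_⟩, ?_⟩
  · rw [hF.homogeneous x hx v _ (inv_pos.2 hFv).le, inv_mul_cancel₀ hFv.ne']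
  · rw [inner_smul_right, hF.inner_momentum_self hV hx hv]; field_simp
  · rintro s ⟨w, hw, rfl⟩
    simpa [hw] using hF.inner_momentum_le hV hx hv w

theorem IsFinsler.apply_colegendre (hV : IsOpen V) (hF : IsFinsler V F) {x ξ : Sp d}
    (hx : x ∈ V) (hξ : ξ ≠ 0) : F x (colegendre F (x, ξ)) = dual F x ξ := by
  obtain ⟨h1, h2⟩ := hF.colegendre_spec hV hx hξ
  rw [← hF.dual_momentum hV hx h1, h2]

theorem IsFinsler.dual_pos (hV : IsOpen V) (hF : IsFinsler V F) {x ξ : Sp d}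
    (hx : x ∈ V) (hξ : ξ ≠ 0) : 0 < dual F x ξ := by
  rw [← hF.apply_colegendre hV hx hξ]
  exact hF.pos hV hx (hF.colegendre_spec hV hx hξ).1

theorem IsFinsler.inner_le_dual_mul (hV : IsOpen V) (hF : IsFinsler V F) {x ξ : Sp d}
    (hx : x ∈ V) (hξ : ξ ≠ 0) (w : Sp d) : inner ℝ ξ w ≤ dual F x ξ * F x w := by
  obtain ⟨h1, h2⟩ := hF.colegendre_spec hV hx hξ
  have := hF.inner_momentum_le hV hx h1 w
  rwa [h2, hF.apply_colegendre hV hx hξ] at this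

theorem IsFinsler.inner_colegendre (hV : IsOpen V) (hF : IsFinsler V F) {x ξ : Sp d}
    (hx : x ∈ V) (hξ : ξ ≠ 0) : inner ℝ ξ (colegendre F (x, ξ)) = dual F x ξ ^ 2 := by
  obtain ⟨h1, h2⟩ := hF.colegendre_spec hV hx hξ
  have := hF.inner_momentum_self hV hx h1
  rwa [h2, hF.apply_colegendre hV hx hξ] at this

theorem IsFinsler.colegendre_smul (hV : IsOpen V) (hF : IsFinsler V F) {x ξ : Sp d}
    (hx : x ∈ V) (hξ : ξ ≠ 0) {t : ℝ} (ht : 0 < t) :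
    colegendre F (x, t • ξ) = t • colegendre F (x, ξ) := by
  obtain ⟨h1, h2⟩ := hF.colegendre_spec hV hx hξ
  have h3 := hF.momentum_smul hV hx h1 ht
  rw [h2] at h3
  rw [← h3, hF.colegendre_momentum hV hx (smul_ne_zero ht.ne' h1)]

theorem IsFinsler.dual_smul (hV : IsOpen V) (hF : IsFinsler V F) {x ξ : Sp d}
    (hx : x ∈ V) (hξ : ξ ≠ 0) {t : ℝ} (ht : 0 < t) :
    dual F x (t • ξ) = t * dual F x ξ := by
  rw [← hF.apply_colegendre hV hx (smul_ne_zero ht.ne' hξ), hF.colegendre_smul hV hx hξ ht,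
    hF.homogeneous x hx _ t ht.le, hF.apply_colegendre hV hx hξ]

theorem ne_zero_of_dual_eq_one {x ξ : Sp d} (h : dual F x ξ = 1) : ξ ≠ 0 := by
  rintro rfl
  have h1 : dual F x 0 = 0 := by
    unfold dual
    rcases Set.eq_empty_or_nonempty {s : ℝ | ∃ v : Sp d, F x v = 1 ∧ s = inner ℝ (0 : Sp d) v}
      with h | h
    -- Without unit vectors the supremum is zero by default, so no hypothesis on `F` or `x` is
    -- needed.
    · rw [h, Real.sSup_empty]
    · have : {s : ℝ | ∃ v : Sp d, F x v = 1 ∧ s = inner ℝ (0 : Sp d) v} = {0} := by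
        refine (Set.Nonempty.subset_singleton_iff h).1 ?_
        rintro s ⟨v, -, rfl⟩; simp
      rw [this, csSup_singleton]
  rw [h1] at h; exact zero_ne_one h

/-- Inverse function theorem for `(x, v) ↦ (x, momentum)`: the derivative is injective because the
metric is positive definite, and global injectivity of the momentum identifies the local inverse
with `colegendre`. -/
theorem IsFinsler.contDiffAt_colegendre (hV : IsOpen V) (hF : IsFinsler V F) {x ξ : Sp d}
    (hx : x ∈ V) (hξ : ξ ≠ 0) : ContDiffAt ℝ ∞ (colegendre F) (x, ξ) := by
  obtain ⟨hv, hvξ⟩ := hF.colegendre_spec hV hx hξ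
  set v := colegendre F (x, ξ) with hvdef
  let Φ : Sp d × Sp d → Sp d × Sp d := fun z => (z.1, momentum F z)
  have hmom := hF.contDiffAt_momentum hV hx hv
  have hΦ : ContDiffAt ℝ ∞ Φ (x, v) := contDiffAt_fst.prodMk hmom
  let D : Sp d × Sp d →L[ℝ] Sp d × Sp d :=
    (ContinuousLinearMap.fst ℝ (Sp d) (Sp d)).prod (fderiv ℝ (momentum F) (x, v))
  have hD : HasFDerivAt Φ D (x, v) :=
    hasFDerivAt_fst.prodMk hmom.differentiableAt_infty.hasFDerivAt
  have hinj : Function.Injective (D : Sp d × Sp d →ₗ[ℝ] Sp d × Sp d) := by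
    refine (injective_iff_map_eq_zero _).2 ?_
    rintro ⟨u, w⟩ h
    obtain ⟨h1, h2⟩ := Prod.mk.inj h
    simp only [ContinuousLinearMap.coe_fst', ContinuousLinearMap.coe_coe] at h1 h2
    subst h1
    by_contra hw
    have hw' : w ≠ 0 := fun e => hw (by simp [e])
    have := hF.metric_pos hV hx hv hw'
    rw [h2] at this; simp at this
  let e : (Sp d × Sp d) ≃L[ℝ] (Sp d × Sp d) :=
    (LinearEquiv.ofInjectiveEndo _ hinj).toContinuousLinearEquiv
  have he : (e : Sp d × Sp d →L[ℝ] Sp d × Sp d) = D := by ext1 <;> ext1 <;> rfl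
  have hD' : HasFDerivAt Φ (e : Sp d × Sp d →L[ℝ] Sp d × Sp d) (x, v) := by rw [he]; exact hD
  have hn : (∞ : WithTop ℕ∞) ≠ 0 := by simp
  have hinv := hΦ.to_localInverse hD' hn
  have hΦv : Φ (x, v) = (x, ξ) := by simp only [Φ, hvξ]
  have hpt := hΦ.localInverse_apply_image hD' hn
  have hright : ∀ᶠ z in 𝓝 (Φ (x, v)), Φ (hΦ.localInverse hD' hn z) = z :=
    (hΦ.hasStrictFDerivAt' hD' hn).eventually_right_inverse
  have hnear : ∀ᶠ z in 𝓝 (Φ (x, v)), hΦ.localInverse hD' hn z ∈ V ×ˢ ({0}ᶜ : Set (Sp d)) := by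
    refine hinv.continuousAt.eventually_mem ?_
    rw [hpt]
    exact (hV.prod isOpen_compl_singleton).mem_nhds ⟨hx, hv⟩
  rw [hΦv] at hinv hright hnear
  refine (contDiffAt_snd.comp _ hinv).congr_of_eventuallyEq ?_
  filter_upwards [hright, hnear] with z hz hz'
  set y := hΦ.localInverse hD' hn z
  have : colegendre F z = colegendre F (y.1, momentum F (y.1, y.2)) := by rw [← hz]
  rw [this, hF.colegendre_momentum hV hz'.1 hz'.2]; rfl

/-- The covector derivative of `colegendre` inverts the metric: with `z` the image of `w` the
pairing is `g(z, z)`. This convexity of the Hamiltonian is the source of nondegeneracy. -/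
theorem IsFinsler.inner_fderiv_colegendre_pos (hV : IsOpen V) (hF : IsFinsler V F) {x ξ : Sp d}
    (hx : x ∈ V) (hξ : ξ ≠ 0) {w : Sp d} (hw : w ≠ 0) :
    0 < inner ℝ w (fderiv ℝ (colegendre F) (x, ξ) (0, w)) := by
  obtain ⟨hv, hvξ⟩ := hF.colegendre_spec hV hx hξ
  set v := colegendre F (x, ξ) with hvdef
  have h1 : HasFDerivAt (fun η => (x, colegendre F (x, η))) ((ContinuousLinearMap.inr ℝ _ _).comp
      ((fderiv ℝ (colegendre F) (x, ξ)).comp (.inr ℝ _ _))) ξ :=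
    (hasFDerivAt_prodMk_right x v).comp ξ
      (hasFDerivAt_snd_slot (hF.contDiffAt_colegendre hV hx hξ).differentiableAt_infty)
  have h2 := (hF.contDiffAt_momentum hV hx hv).differentiableAt_infty.hasFDerivAt.comp ξ h1
  have h3 : (momentum F ∘ fun η => (x, colegendre F (x, η))) =ᶠ[𝓝 ξ] id := by
    filter_upwards [isOpen_compl_singleton.mem_nhds hξ] with η hη
    exact (hF.colegendre_spec hV hx hη).2
  have h4 := congrArg (fun g => g w) ((h2.congr_of_eventuallyEq h3.symm).unique (hasFDerivAt_id ξ))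
  simp only [ContinuousLinearMap.comp_apply, ContinuousLinearMap.inr_apply,
    ContinuousLinearMap.id_apply] at h4
  set z := fderiv ℝ (colegendre F) (x, ξ) (0, w)
  have hz : z ≠ 0 := by
    intro hz; rw [hz] at h4
    refine hw (h4.symm.trans ?_)
    exact map_zero (fderiv ℝ (momentum F) (x, v))
  nth_rewrite 1 [← h4]
  exact hF.metric_pos hV hx hv hz

/-- The Hamiltonian, half the square of the dual metric. -/
def ham (F : Sp d → Sp d → ℝ) (z : Sp d × Sp d) : ℝ := 1 / 2 * inner ℝ z.2 (colegendre F z)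

/-- Half the gradient in position of the squared metric, as a function of position and covector. -/
def force (F : Sp d → Sp d → ℝ) (z : Sp d × Sp d) : Sp d :=
  (1 / 2 : ℝ) • gradFst (sq F) (z.1, colegendre F z)

theorem IsFinsler.ham_eq (hV : IsOpen V) (hF : IsFinsler V F) {x ξ : Sp d}
    (hx : x ∈ V) (hξ : ξ ≠ 0) : ham F (x, ξ) = 1 / 2 * dual F x ξ ^ 2 := by
  rw [ham, hF.inner_colegendre hV hx hξ]

theorem IsFinsler.contDiffAt_ham (hV : IsOpen V) (hF : IsFinsler V F) {x ξ : Sp d}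
    (hx : x ∈ V) (hξ : ξ ≠ 0) : ContDiffAt ℝ ∞ (ham F) (x, ξ) :=
  contDiffAt_const.mul (contDiffAt_snd.inner ℝ (hF.contDiffAt_colegendre hV hx hξ))

theorem IsFinsler.contDiffAt_force (hV : IsOpen V) (hF : IsFinsler V F) {x ξ : Sp d}
    (hx : x ∈ V) (hξ : ξ ≠ 0) : ContDiffAt ℝ ∞ (force F) (x, ξ) := by
  have h := hF.colegendre_spec hV hx hξ
  have h1 := (contDiffAt_gradFst (hF.contDiffAt_sq hV hx h.1)).comp (x, ξ)
    (contDiffAt_fst.prodMk (hF.contDiffAt_colegendre hV hx hξ))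
  exact h1.const_smul (1 / 2 : ℝ)

theorem IsFinsler.contDiffAt_dual (hV : IsOpen V) (hF : IsFinsler V F) {x ξ : Sp d}
    (hx : x ∈ V) (hξ : ξ ≠ 0) :
    ContDiffAt ℝ ∞ (fun z : Sp d × Sp d => dual F z.1 z.2) (x, ξ) := by
  have h := hF.colegendre_spec hV hx hξ
  refine ((hF.contDiffAt hV hx h.1).comp (x, ξ)
    (contDiffAt_fst.prodMk (hF.contDiffAt_colegendre hV hx hξ))).congr_of_eventuallyEq ?_
  filter_upwards [(hV.prod isOpen_compl_singleton).mem_nhds ⟨hx, hξ⟩] with z hz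
  exact (hF.apply_colegendre hV hz.1 hz.2).symm

/-- Differentiating the Hamiltonian both as `½⟨ξ, v⟩` and as `½F²(x, v)` with `v = colegendre`, the
unknown derivative of `v` drops out of twice the first minus the second. So `colegendre` and `force`
are the two sides of Hamilton's equations. -/
theorem IsFinsler.fderiv_ham (hV : IsOpen V) (hF : IsFinsler V F) {x ξ : Sp d}
    (hx : x ∈ V) (hξ : ξ ≠ 0) (u w : Sp d) :
    fderiv ℝ (ham F) (x, ξ) (u, w)
      = inner ℝ (colegendre F (x, ξ)) w - inner ℝ (force F (x, ξ)) u := by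
  obtain ⟨hv, hvξ⟩ := hF.colegendre_spec hV hx hξ
  have hc := (hF.contDiffAt_colegendre hV hx hξ).differentiableAt_infty
  have h1 : fderiv ℝ (ham F) (x, ξ) (u, w) = 1 / 2 * (inner ℝ w (colegendre F (x, ξ))
      + inner ℝ ξ (fderiv ℝ (colegendre F) (x, ξ) (u, w))) := by
    have := ((hasFDerivAt_snd (p := (x, ξ))).inner ℝ hc.hasFDerivAt).const_mul (1 / 2)
    rw [show fderiv ℝ (ham F) (x, ξ) = _ from this.fderiv]
    simp; ring
  have h2 : fderiv ℝ (ham F) (x, ξ) (u, w) = 1 / 2 * fderiv ℝ (sq F) (x, colegendre F (x, ξ))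
      (u, fderiv ℝ (colegendre F) (x, ξ) (u, w)) := by
    have h3 := ((hF.contDiffAt_sq hV hx hv).differentiableAt_infty.hasFDerivAt.comp (x, ξ)
      ((hasFDerivAt_fst (p := (x, ξ))).prodMk hc.hasFDerivAt)).const_mul (1 / 2)
    have h4 : ham F =ᶠ[𝓝 (x, ξ)]
        fun z => 1 / 2 * (sq F ∘ fun z : Sp d × Sp d => (z.1, colegendre F z)) z := by
      filter_upwards [(hV.prod isOpen_compl_singleton).mem_nhds ⟨hx, hξ⟩] with z hz
      simp only [Function.comp_apply, sq]
      rw [hF.apply_colegendre hV hz.1 hz.2]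
      exact hF.ham_eq hV hz.1 hz.2
    rw [h4.fderiv_eq, h3.fderiv]
    simp
  have h5 : fderiv ℝ (sq F) (x, colegendre F (x, ξ))
      (u, fderiv ℝ (colegendre F) (x, ξ) (u, w)) = 2 * inner ℝ (force F (x, ξ)) u
      + 2 * inner ℝ ξ (fderiv ℝ (colegendre F) (x, ξ) (u, w)) := by
    set y := fderiv ℝ (colegendre F) (x, ξ) (u, w)
    rw [show (u, y) = (u, 0) + (0, y) by simp, map_add, fderiv_sq_snd, hvξ, force,
      real_inner_smul_left, inner_gradFst]
    ring
  rw [h5] at h2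
  rw [real_inner_comm w]
  linarith

end Duality

/-! ### The geodesic equation in Euler–Lagrange form. -/

section Geodesic

variable {V : Set (Sp d)} {F : Sp d → Sp d → ℝ}

theorem eq_sum_single (u : Sp d) : u = ∑ i, u i • EuclideanSpace.single i (1 : ℝ) := by
  ext k; simp [Finset.sum_apply, Pi.single_apply]

theorem IsFinsler.differentiableAt_metricCoeff (hV : IsOpen V) (hF : IsFinsler V F) {x v : Sp d}
    (hx : x ∈ V) (hv : v ≠ 0) (i j : Fin d) :
    DifferentiableAt ℝ (fun z => metricCoeff F z v i j) x := by
  have h1 := (hasFDerivAt_fst_slot (f := fun y : Sp d × Sp d =>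
    fderiv ℝ (momentum F) y (0, EuclideanSpace.single i 1))
    ((hF.contDiffAt_momentum hV hx hv).fderiv_infty.differentiableAt_infty.clm_apply
      (differentiableAt_const _))).differentiableAt
  have h2 := ((EuclideanSpace.proj j : Sp d →L[ℝ] ℝ).differentiableAt).comp x h1
  refine h2.congr_of_eventuallyEq ?_
  filter_upwards [hV.mem_nhds hx] with z hz
  simp [hF.metricCoeff_eq hV hz hv]

theorem IsFinsler.metricCoeff_comm (hV : IsOpen V) (hF : IsFinsler V F) {x v : Sp d}
    (hx : x ∈ V) (hv : v ≠ 0) (i j : Fin d) : metricCoeff F x v i j = metricCoeff F x v j i := by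
  have h := hF.inner_fderiv_momentum_comm hV hx hv (EuclideanSpace.single i 1)
    (EuclideanSpace.single j 1)
  simpa [hF.metricCoeff_eq hV hx hv, EuclideanSpace.inner_single_right] using h

theorem IsFinsler.momentum_apply (hV : IsOpen V) (hF : IsFinsler V F) {x v : Sp d}
    (hx : x ∈ V) (hv : v ≠ 0) (b : Fin d) :
    momentum F (x, v) b = ∑ j, metricCoeff F x v b j * v j := by
  rw [← hF.legendre_eq hV hx hv]; rfl

theorem IsFinsler.fderiv_momentum_fst (hV : IsOpen V) (hF : IsFinsler V F) {x v : Sp d}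
    (hx : x ∈ V) (hv : v ≠ 0) (u : Sp d) (b : Fin d) :
    fderiv ℝ (momentum F) (x, v) (u, 0) b
      = ∑ j, ∑ k, pd (fun z => metricCoeff F z v b j) k x * v j * u k := by
  have h1 : HasFDerivAt (fun z => momentum F (z, v) b) _ x :=
    ((EuclideanSpace.proj b : Sp d →L[ℝ] ℝ).hasFDerivAt).comp x
      (hasFDerivAt_fst_slot (hF.contDiffAt_momentum hV hx hv).differentiableAt_infty)
  have h2 : HasFDerivAt (fun z => ∑ j, metricCoeff F z v b j * v j)
      (∑ j, v j • fderiv ℝ (fun z => metricCoeff F z v b j) x) x :=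
    HasFDerivAt.fun_sum fun j _ =>
      (hF.differentiableAt_metricCoeff hV hx hv b j).hasFDerivAt.mul_const (v j)
  have h3 : (fun z => momentum F (z, v) b) =ᶠ[𝓝 x] fun z => ∑ j, metricCoeff F z v b j * v j := by
    filter_upwards [hV.mem_nhds hx] with z hz using hF.momentum_apply hV hz hv b
  have h4 := congrArg (fun g => g u) (h1.unique (h2.congr_of_eventuallyEq h3))
  simp only [ContinuousLinearMap.comp_apply, ContinuousLinearMap.inl_apply,
    sum_apply, smul_apply, smul_eq_mul] at h4
  change fderiv ℝ (momentum F) (x, v) (u, 0) b = _ at h4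
  rw [h4]
  refine Finset.sum_congr rfl fun j _ => ?_
  conv_lhs => rw [eq_sum_single u]
  rw [map_sum, Finset.mul_sum]
  refine Finset.sum_congr rfl fun k _ => ?_
  rw [map_smul, smul_eq_mul, pd]; ring

theorem IsFinsler.fderiv_sq_fst (hV : IsOpen V) (hF : IsFinsler V F) {x v : Sp d}
    (hx : x ∈ V) (hv : v ≠ 0) (b : Fin d) :
    fderiv ℝ (sq F) (x, v) (EuclideanSpace.single b 1, 0)
      = ∑ j, ∑ k, pd (fun z => metricCoeff F z v j k) b x * v j * v k := by
  have h1 := hasFDerivAt_fst_slot (hF.contDiffAt_sq hV hx hv).differentiableAt_infty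
  have h2 : HasFDerivAt (fun z => ∑ j, ∑ k, metricCoeff F z v j k * v j * v k)
      (∑ j, ∑ k, v k • v j • fderiv ℝ (fun z => metricCoeff F z v j k) x) x :=
    HasFDerivAt.fun_sum fun j _ => HasFDerivAt.fun_sum fun k _ =>
      ((hF.differentiableAt_metricCoeff hV hx hv j k).hasFDerivAt.mul_const (v j)).mul_const (v k)
  have h3 : (fun z => sq F (z, v)) =ᶠ[𝓝 x]
      fun z => ∑ j, ∑ k, metricCoeff F z v j k * v j * v k := by
    filter_upwards [hV.mem_nhds hx] with z hz
    rw [sq, ← hF.inner_momentum_self hV hz hv, ← hF.fderiv_momentum_self hV hz hv,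
      hF.inner_fderiv_momentum_eq_sum hV hz hv]
  have h4 := congrArg (fun g => g (EuclideanSpace.single b 1))
    (h1.unique (h2.congr_of_eventuallyEq h3))
  simp only [ContinuousLinearMap.comp_apply, ContinuousLinearMap.inl_apply,
    sum_apply, smul_apply, smul_eq_mul] at h4
  rw [h4]
  refine Finset.sum_congr rfl fun j _ => Finset.sum_congr rfl fun k _ => ?_
  rw [pd]; ring

theorem IsFinsler.sum_metricCoeff_christoffel (hF : IsFinsler V F) {x v : Sp d}
    (hx : x ∈ V) (hv : v ≠ 0) (b j k : Fin d) :
    ∑ a, metricCoeff F x v b a * christoffel F x v a j k =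
      1 / 2 * (pd (fun z => metricCoeff F z v b j) k x + pd (fun z => metricCoeff F z v b k) j x
        - pd (fun z => metricCoeff F z v j k) b x) := by
  have hdet : IsUnit (metricCoeff F x v).det :=
    (Matrix.isUnit_iff_isUnit_det _).1 (hF.posDef x hx v hv).isUnit
  have hmul := Matrix.mul_nonsing_inv _ hdet
  set G : Fin d → ℝ := fun i => pd (fun z => metricCoeff F z v i j) k x +
    pd (fun z => metricCoeff F z v i k) j x - pd (fun z => metricCoeff F z v j k) i x
  have h1 : ∀ a, christoffel F x v a j k = ∑ i, (metricCoeff F x v)⁻¹ a i / 2 * G i :=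
    fun a => rfl
  simp only [h1, Finset.mul_sum]
  rw [Finset.sum_comm]
  have h2 : ∀ i, ∑ a, metricCoeff F x v b a * ((metricCoeff F x v)⁻¹ a i / 2 * G i)
      = (1 : Matrix (Fin d) (Fin d) ℝ) b i * (1 / 2 * G i) := by
    intro i
    rw [← hmul, Matrix.mul_apply, Finset.sum_mul]
    exact Finset.sum_congr rfl fun a _ => by ring
  simp only [h2, Matrix.one_apply, ite_mul, one_mul, zero_mul]
  simp [G]

/-- Euler–Lagrange form of the geodesic equation: lowering the index of the Christoffel symbols
leaves three sums, two of which agree after exchanging `j` and `k` and cancel the derivative of the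
metric along `v`. -/
theorem IsFinsler.fderiv_momentum_geodesic (hV : IsOpen V) (hF : IsFinsler V F) {x v w : Sp d}
    (hx : x ∈ V) (hv : v ≠ 0)
    (hw : ∀ a, w a = -∑ j, ∑ k, christoffel F x v a j k * v j * v k) :
    fderiv ℝ (momentum F) (x, v) (v, w) = (1 / 2 : ℝ) • gradFst (sq F) (x, v) := by
  ext b
  have hsplit : ((v, w) : Sp d × Sp d) = (v, 0) + (0, w) := by simp
  have h1 : fderiv ℝ (momentum F) (x, v) (0, w) b
      = -∑ j, ∑ k, (1 / 2 * (pd (fun z => metricCoeff F z v b j) k x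
        + pd (fun z => metricCoeff F z v b k) j x
        - pd (fun z => metricCoeff F z v j k) b x)) * v j * v k := by
    have h2 := hF.inner_fderiv_momentum_eq_sum hV hx hv w (EuclideanSpace.single b 1)
    simp only [EuclideanSpace.inner_single_right, one_mul, conj_trivial] at h2
    have h3 : ∀ i, ∑ j, metricCoeff F x v i j * w i * (EuclideanSpace.single b (1 : ℝ) : Sp d) j
        = metricCoeff F x v b i * w i := by
      intro i
      rw [hF.metricCoeff_comm hV hx hv b i]
      simp
    rw [h2, Finset.sum_congr rfl fun i _ => h3 i]
    simp only [hw, ← hF.sum_metricCoeff_christoffel hx hv]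
    simp only [mul_neg, Finset.sum_neg_distrib, Finset.mul_sum, Finset.sum_mul, neg_inj]
    rw [Finset.sum_comm]
    refine Finset.sum_congr rfl fun j _ => ?_
    rw [Finset.sum_comm]
    exact Finset.sum_congr rfl fun k _ => Finset.sum_congr rfl fun a _ => by ring
  have h4 : gradFst (sq F) (x, v) b = fderiv ℝ (sq F) (x, v) (EuclideanSpace.single b 1, 0) := by
    have := inner_gradFst (sq F) (x, v) (EuclideanSpace.single b 1)
    simpa [EuclideanSpace.inner_single_right] using this
  rw [hsplit, map_add, PiLp.add_apply, h1, hF.fderiv_momentum_fst hV hx hv, PiLp.smul_apply, h4,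
    hF.fderiv_sq_fst hV hx hv, smul_eq_mul]
  have h5 : ∑ j, ∑ k, pd (fun z => metricCoeff F z v b k) j x * v j * v k
      = ∑ j, ∑ k, pd (fun z => metricCoeff F z v b j) k x * v j * v k := by
    rw [Finset.sum_comm]
    exact Finset.sum_congr rfl fun j _ => Finset.sum_congr rfl fun k _ => by ring
  have h6 : ∑ j, ∑ k, (1 / 2 * (pd (fun z => metricCoeff F z v b j) k x
        + pd (fun z => metricCoeff F z v b k) j x
        - pd (fun z => metricCoeff F z v j k) b x)) * v j * v k
      = 1 / 2 * (∑ j, ∑ k, pd (fun z => metricCoeff F z v b j) k x * v j * v k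
        + ∑ j, ∑ k, pd (fun z => metricCoeff F z v b k) j x * v j * v k
        - ∑ j, ∑ k, pd (fun z => metricCoeff F z v j k) b x * v j * v k) := by
    rw [← Finset.sum_add_distrib, ← Finset.sum_sub_distrib, Finset.mul_sum]
    refine Finset.sum_congr rfl fun j _ => ?_
    rw [← Finset.sum_add_distrib, ← Finset.sum_sub_distrib, Finset.mul_sum]
    exact Finset.sum_congr rfl fun k _ => by ring
  rw [h6, h5]; ring

theorem IsFinsler.gradFst_sq_smul (hV : IsOpen V) (hF : IsFinsler V F) {x v : Sp d}
    (hx : x ∈ V) (hv : v ≠ 0) {t : ℝ} (ht : 0 < t) :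
    gradFst (sq F) (x, t • v) = t ^ 2 • gradFst (sq F) (x, v) := by
  have htv : t • v ≠ 0 := smul_ne_zero ht.ne' hv
  rw [← gradient_fst_slot (hF.contDiffAt_sq hV hx htv).differentiableAt_infty, gradFst,
    ← map_smul, gradient]
  congr 1
  have h1 := (hasFDerivAt_fst_slot
    (hF.contDiffAt_sq hV hx hv).differentiableAt_infty).const_mul (t ^ 2)
  have h2 : (fun z => sq F (z, t • v)) =ᶠ[𝓝 x] fun z => t ^ 2 * sq F (z, v) := by
    filter_upwards [hV.mem_nhds hx] with z hz
    simp only [sq]; rw [hF.homogeneous z hz v t ht.le]; ring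
  rw [h2.fderiv_eq, h1.fderiv]

theorem IsFinsler.force_smul (hV : IsOpen V) (hF : IsFinsler V F) {x ξ : Sp d}
    (hx : x ∈ V) (hξ : ξ ≠ 0) {t : ℝ} (ht : 0 < t) :
    force F (x, t • ξ) = t ^ 2 • force F (x, ξ) := by
  rw [force, force]
  simp only
  rw [hF.colegendre_smul hV hx hξ ht,
    hF.gradFst_sq_smul hV hx (hF.colegendre_spec hV hx hξ).1 ht, smul_comm]

theorem IsFinsler.force_momentum (hV : IsOpen V) (hF : IsFinsler V F) {x v : Sp d}
    (hx : x ∈ V) (hv : v ≠ 0) :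
    force F (x, momentum F (x, v)) = (1 / 2 : ℝ) • gradFst (sq F) (x, v) := by
  rw [force]; simp only; rw [hF.colegendre_momentum hV hx hv]

/-! ### Geodesics as solutions of Hamilton's equations -/

theorem IsGeodesic.hasDerivWithinAt {c : ℝ → Sp d} (hc : IsGeodesic F c) {t : ℝ}
    (ht : t ∈ Icc (0 : ℝ) 1) : HasDerivWithinAt c (velocity c t) (Icc 0 1) t :=
  ((hc.contDiff.differentiableOn (by simp)) t ht).hasDerivWithinAt

theorem IsGeodesic.differentiableOn_velocity {c : ℝ → Sp d} (hc : IsGeodesic F c) :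
    DifferentiableOn ℝ (velocity c) (Icc 0 1) :=
  (hc.contDiff.derivWithin (m := 1) (uniqueDiffOn_Icc zero_lt_one) (by norm_num)).differentiableOn
    (by simp)

theorem IsGeodesic.hasDerivWithinAt_momentum (hV : IsOpen V) (hF : IsFinsler V F) {c : ℝ → Sp d}
    (hc : IsGeodesic F c) {t : ℝ} (ht : t ∈ Icc (0 : ℝ) 1) (hct : c t ∈ V)
    (hv : velocity c t ≠ 0) :
    HasDerivWithinAt (fun s => momentum F (c s, velocity c s))
      (force F (c t, momentum F (c t, velocity c t))) (Icc 0 1) t := by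
  rw [hF.force_momentum hV hct hv, ← hF.fderiv_momentum_geodesic hV hct hv (hc.equation t ht)]
  have h := (hF.contDiffAt_momentum hV hct hv).differentiableAt_infty.hasFDerivAt
  exact h.comp_hasDerivWithinAt t ((hc.hasDerivWithinAt ht).prodMk
    (hc.differentiableOn_velocity t ht).hasDerivWithinAt)

theorem IsFinsler.exists_le_mul_norm (hV : IsOpen V) (hF : IsFinsler V F) {K : Set (Sp d)}
    (hK : IsCompact K) (hKV : K ⊆ V) :
    ∃ C > 0, ∀ x ∈ K, ∀ v, F x v ≤ C * ‖v‖ ∧ ‖v‖ ≤ C * F x v := by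
  have hne : ∀ u ∈ Metric.sphere (0 : Sp d) 1, u ≠ 0 := fun u hu =>
    ne_zero_of_mem_unit_sphere (⟨u, hu⟩ : Metric.sphere (0 : Sp d) 1)
  have hcpt : IsCompact (K ×ˢ Metric.sphere (0 : Sp d) 1) := hK.prod (isCompact_sphere _ _)
  have hcont : ContinuousOn (fun z : Sp d × Sp d => F z.1 z.2)
      (K ×ˢ Metric.sphere (0 : Sp d) 1) := fun z hz =>
    (hF.contDiffAt hV (hKV hz.1) (hne _ hz.2)).continuousAt.continuousWithinAt
  have hcont' : ContinuousOn (fun z : Sp d × Sp d => (F z.1 z.2)⁻¹)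
      (K ×ˢ Metric.sphere (0 : Sp d) 1) :=
    hcont.inv₀ fun z hz => (hF.pos hV (hKV hz.1) (hne _ hz.2)).ne'
  obtain ⟨C₁, hC₁⟩ := hcpt.exists_bound_of_continuousOn hcont
  obtain ⟨C₂, hC₂⟩ := hcpt.exists_bound_of_continuousOn hcont'
  refine ⟨max 1 (max C₁ C₂), by positivity, fun x hx v => ?_⟩
  rcases eq_or_ne v 0 with rfl | hv
  · simp [hF.apply_zero (hKV hx)]
  have hn : 0 < ‖v‖ := norm_pos_iff.2 hv
  have hmem : (x, ‖v‖⁻¹ • v) ∈ K ×ˢ Metric.sphere (0 : Sp d) 1 := ⟨hx, by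
    simp [norm_smul, hn.ne']⟩
  have h1 := hC₁ _ hmem
  have h2 := hC₂ _ hmem
  have hFv := hF.pos hV (hKV hx) hv
  simp only [hF.homogeneous x (hKV hx) v _ (inv_pos.2 hn).le, norm_inv, norm_mul,
    Real.norm_of_nonneg hFv.le, norm_norm, mul_inv, inv_inv] at h1 h2
  rw [inv_mul_le_iff₀ hn] at h1
  rw [mul_inv_le_iff₀ hFv] at h2
  constructor
  · nlinarith [le_max_left C₁ C₂, le_max_right 1 (max C₁ C₂)]
  · nlinarith [le_max_right C₁ C₂, le_max_right 1 (max C₁ C₂)]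

/-- Where the velocity is nonzero this is conservation of the Hamiltonian. Since `F²` need not be
smooth on zero vectors, a time of zero velocity is treated separately: there `F²` is quadratically
small in the time difference, so its derivative vanishes too. -/
theorem IsGeodesic.speed_eq (hV : IsOpen V) (hF : IsFinsler V F) {c : ℝ → Sp d}
    (hc : IsGeodesic F c) (hcV : MapsTo c (Icc 0 1) V) {t : ℝ} (ht : t ∈ Icc (0 : ℝ) 1) :
    F (c t) (velocity c t) = F (c 0) (velocity c 0) := by
  have hcc : ContinuousOn c (Icc 0 1) := hc.contDiff.continuousOn
  obtain ⟨C, hC, hCF⟩ := hF.exists_le_mul_norm hV (isCompact_Icc.image_of_continuousOn hcc)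
    (image_subset_iff.2 hcV)
  have hder : ∀ t ∈ Icc (0 : ℝ) 1,
      HasDerivWithinAt (fun s => sq F (c s, velocity c s)) 0 (Icc 0 1) t := by
    intro t ht
    rcases eq_or_ne (velocity c t) 0 with hv | hv
    · have h1 := (hc.differentiableOn_velocity t ht).hasDerivWithinAt.isBigO_sub
      have h2 : (fun s => sq F (c s, velocity c s)) =O[𝓝[Icc 0 1] t]
          fun s => ‖velocity c s - velocity c t‖ ^ 2 := by
        refine Asymptotics.IsBigO.of_bound (C ^ 2) ?_
        filter_upwards [self_mem_nhdsWithin] with s hs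
        have h3 := (hCF _ (mem_image_of_mem c hs) (velocity c s)).1
        have h4 := hF.nonneg _ (hcV hs) (velocity c s)
        rw [hv, sub_zero, sq, Real.norm_of_nonneg (by positivity),
          Real.norm_of_nonneg (by positivity), ← mul_pow]
        gcongr
      have h3 : (fun s => ‖velocity c s - velocity c t‖ ^ 2) =O[𝓝[Icc 0 1] t]
          fun s => (s - t) ^ 2 :=
        ((h1.comp_tendsto (tendsto_id.prodMk (tendsto_const_pure (b := t)))).norm_left).pow 2
      have h5 : (fun s : ℝ => (s - t) ^ 2) =o[𝓝[Icc 0 1] t] fun s => s - t :=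
        by simpa using (Asymptotics.isLittleO_pow_sub_sub t one_lt_two).mono nhdsWithin_le_nhds
      refine hasDerivWithinAt_iff_isLittleO.2 ?_
      simpa [sq, hv, hF.apply_zero (hcV ht)] using (h2.trans h3).trans_isLittleO h5
    · have h1 := hc.hasDerivWithinAt_momentum hV hF ht (hcV ht) hv
      have hm := hF.momentum_ne_zero hV (hcV ht) hv
      have h2 := (hF.contDiffAt_ham hV (hcV ht) hm).differentiableAt_infty.hasFDerivAt
      have h3 := (h2.comp_hasDerivWithinAt_of_eq t
        ((hc.hasDerivWithinAt ht).prodMk h1) rfl).const_mul 2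
      rw [hF.fderiv_ham hV (hcV ht) hm, hF.colegendre_momentum hV (hcV ht) hv, real_inner_comm,
        sub_self, mul_zero] at h3
      refine h3.congr_of_eventuallyEq_of_mem ?_ ht
      have hne : ∀ᶠ s in 𝓝[Icc 0 1] t, velocity c s ≠ 0 :=
        (hc.differentiableOn_velocity.continuousOn t ht).eventually_ne hv
      filter_upwards [hne, self_mem_nhdsWithin] with s hs hs'
      simp only [Function.comp_apply, sq]
      rw [hF.ham_eq hV (hcV hs') (hF.momentum_ne_zero hV (hcV hs') hs),
        hF.dual_momentum hV (hcV hs') hs]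
      ring
  have h := constant_of_derivWithin_zero (fun t ht => (hder t ht).differentiableWithinAt)
    (fun t ht => (hder t (Ico_subset_Icc_self ht)).derivWithin
      (uniqueDiffOn_Icc zero_lt_one t (Ico_subset_Icc_self ht))) t ht
  simp only [sq] at h
  exact (sq_eq_sq₀ (hF.nonneg _ (hcV ht) _) (hF.nonneg _ (hcV (by simp)) _)).1 h

end Geodesic

/-! ### Eikonal solutions and their characteristics. -/

section Eikonal

variable {V W : Set (Sp d)} {F : Sp d → Sp d → ℝ} {u : Sp d → ℝ}

/-- `u` is a smooth solution on `W` of the eikonal equation `F_*(x, ∇u) = 1`. -/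
structure IsEikonal (F : Sp d → Sp d → ℝ) (W : Set (Sp d)) (u : Sp d → ℝ) : Prop where
  smooth : ContDiffOn ℝ ∞ u W
  dual_eq : ∀ x ∈ W, dual F x (gradient u x) = 1

/-- The unit vector field whose integral curves are the characteristics of `u`. -/
def ray (F : Sp d → Sp d → ℝ) (u : Sp d → ℝ) (x : Sp d) : Sp d := colegendre F (x, gradient u x)

theorem inner_gradient (u : Sp d → ℝ) (x w : Sp d) :
    inner ℝ (gradient u x) w = fderiv ℝ u x w := by
  simp [gradient]

theorem contDiffAt_gradient {x : Sp d} (h : ContDiffAt ℝ ∞ u x) :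
    ContDiffAt ℝ ∞ (gradient u) x :=
  (LinearIsometryEquiv.contDiff _).contDiffAt.comp x h.fderiv_infty

theorem inner_fderiv_gradient {x : Sp d} (h : ContDiffAt ℝ ∞ u x) (a b : Sp d) :
    inner ℝ (fderiv ℝ (gradient u) x a) b = fderiv ℝ (fderiv ℝ u) x a b := by
  have h1 : (fun y => inner ℝ (gradient u y) b) = fun y => fderiv ℝ u y b :=
    funext fun y => inner_gradient u y b
  have h2 := congrArg (fun g => fderiv ℝ g x a) h1
  rw [fderiv_inner_apply ℝ (contDiffAt_gradient h).differentiableAt_infty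
    (differentiableAt_const _), fderiv_clm_apply h.fderiv_infty.differentiableAt_infty
    (differentiableAt_const _)] at h2
  simpa using h2

theorem inner_fderiv_gradient_comm {x : Sp d} (h : ContDiffAt ℝ ∞ u x) (a b : Sp d) :
    inner ℝ (fderiv ℝ (gradient u) x a) b = inner ℝ a (fderiv ℝ (gradient u) x b) := by
  rw [inner_fderiv_gradient h, fderiv_fderiv_comm h, ← inner_fderiv_gradient h, real_inner_comm]

namespace IsEikonal

theorem contDiffAt (hu : IsEikonal F W u) (hW : IsOpen W) {x : Sp d} (hx : x ∈ W) :
    ContDiffAt ℝ ∞ u x :=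
  hu.smooth.contDiffAt (hW.mem_nhds hx)

theorem gradient_ne_zero (hu : IsEikonal F W u) {x : Sp d} (hx : x ∈ W) : gradient u x ≠ 0 :=
  ne_zero_of_dual_eq_one (hu.dual_eq x hx)

theorem ray_ne_zero (hV : IsOpen V) (hF : IsFinsler V F) (hWV : W ⊆ V) (hu : IsEikonal F W u)
    {x : Sp d} (hx : x ∈ W) : ray F u x ≠ 0 :=
  (hF.colegendre_spec hV (hWV hx) (hu.gradient_ne_zero hx)).1

theorem momentum_ray (hV : IsOpen V) (hF : IsFinsler V F) (hWV : W ⊆ V) (hu : IsEikonal F W u)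
    {x : Sp d} (hx : x ∈ W) : momentum F (x, ray F u x) = gradient u x :=
  (hF.colegendre_spec hV (hWV hx) (hu.gradient_ne_zero hx)).2

theorem apply_ray (hV : IsOpen V) (hF : IsFinsler V F) (hWV : W ⊆ V) (hu : IsEikonal F W u)
    {x : Sp d} (hx : x ∈ W) : F x (ray F u x) = 1 := by
  rw [ray, hF.apply_colegendre hV (hWV hx) (hu.gradient_ne_zero hx), hu.dual_eq x hx]

theorem inner_gradient_ray (hV : IsOpen V) (hF : IsFinsler V F) (hWV : W ⊆ V)
    (hu : IsEikonal F W u) {x : Sp d} (hx : x ∈ W) : inner ℝ (gradient u x) (ray F u x) = 1 := by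
  rw [ray, hF.inner_colegendre hV (hWV hx) (hu.gradient_ne_zero hx), hu.dual_eq x hx, one_pow]

theorem inner_gradient_le (hV : IsOpen V) (hF : IsFinsler V F) (hWV : W ⊆ V)
    (hu : IsEikonal F W u) {x : Sp d} (hx : x ∈ W) (w : Sp d) :
    inner ℝ (gradient u x) w ≤ F x w := by
  simpa [hu.dual_eq x hx] using hF.inner_le_dual_mul hV (hWV hx) (hu.gradient_ne_zero hx) w

theorem contDiffAt_pair (hu : IsEikonal F W u) (hW : IsOpen W) {x : Sp d} (hx : x ∈ W) :
    ContDiffAt ℝ ∞ (fun y => (y, gradient u y)) x :=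
  contDiffAt_id.prodMk (contDiffAt_gradient (hu.contDiffAt hW hx))

theorem contDiffAt_ray (hV : IsOpen V) (hF : IsFinsler V F) (hWV : W ⊆ V) (hu : IsEikonal F W u)
    (hW : IsOpen W) {x : Sp d} (hx : x ∈ W) : ContDiffAt ℝ ∞ (ray F u) x :=
  (hF.contDiffAt_colegendre hV (hWV hx) (hu.gradient_ne_zero hx)).comp x
    (hu.contDiffAt_pair hW hx)

/-- Differentiate `H(x, ∇u) = 1/2` and use the symmetry of the Hessian: along characteristics the
gradient obeys the second Hamilton equation. -/
theorem fderiv_gradient_ray (hV : IsOpen V) (hF : IsFinsler V F) (hWV : W ⊆ V)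
    (hu : IsEikonal F W u) (hW : IsOpen W) {x : Sp d} (hx : x ∈ W) :
    fderiv ℝ (gradient u) x (ray F u x) = force F (x, gradient u x) := by
  refine ext_inner_right ℝ fun w => ?_
  have hne := hu.gradient_ne_zero hx
  have hg := (contDiffAt_gradient (hu.contDiffAt hW hx)).differentiableAt_infty
  have h1 := (hF.contDiffAt_ham hV (hWV hx) hne).differentiableAt_infty.hasFDerivAt.comp x
    ((hasFDerivAt_id x).prodMk hg.hasFDerivAt)
  have h2 : (ham F ∘ fun y => (id y, gradient u y)) =ᶠ[𝓝 x] fun _ => 1 / 2 := by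
    filter_upwards [hW.mem_nhds hx] with y hy
    simp only [Function.comp_apply, id]
    rw [hF.ham_eq hV (hWV hy) (hu.gradient_ne_zero hy), hu.dual_eq y hy]; norm_num
  have h3 := congrArg (fun g => g w)
    (h1.unique ((hasFDerivAt_const (1 / 2 : ℝ) x).congr_of_eventuallyEq h2))
  simp only [ContinuousLinearMap.comp_apply, ContinuousLinearMap.prod_apply,
    ContinuousLinearMap.id_apply, zero_apply] at h3
  rw [hF.fderiv_ham hV (hWV hx) hne, sub_eq_zero] at h3
  rw [inner_fderiv_gradient_comm (hu.contDiffAt hW hx), ← h3]; rfl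

end IsEikonal

/-- Grönwall uniqueness in both time directions; times before `t₀` are handled by reflection. -/
theorem eq_zero_of_norm_deriv_le {E : Type*} [NormedAddCommGroup E] [NormedSpace ℝ E]
    {f f' : ℝ → E} {a b t₀ K : ℝ} (ht₀ : t₀ ∈ Icc a b)
    (hf : ∀ t ∈ Icc a b, HasDerivWithinAt f (f' t) (Icc a b) t)
    (hK : ∀ t ∈ Icc a b, ‖f' t‖ ≤ K * ‖f t‖) (h0 : f t₀ = 0) {t : ℝ} (ht : t ∈ Icc a b) :
    f t = 0 := by
  have key : ∀ (g g' : ℝ → E) (p q : ℝ), (∀ t ∈ Icc p q, HasDerivWithinAt g (g' t) (Icc p q) t) →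
      (∀ t ∈ Icc p q, ‖g' t‖ ≤ K * ‖g t‖) → g p = 0 → ∀ t ∈ Icc p q, g t = 0 := by
    intro g g' p q hg hgK hp
    refine eq_zero_of_abs_deriv_le_mul_abs_self_of_eq_zero_right
      (fun t ht => (hg t ht).continuousWithinAt) (fun t ht => ?_) hp
      (fun t ht => hgK t (Ico_subset_Icc_self ht))
    exact (hg t (Ico_subset_Icc_self ht)).mono_of_mem_nhdsWithin (Icc_mem_nhdsGE_of_mem ht)
  rcases le_total t₀ t with h | h
  · exact key f f' t₀ b
      (fun s hs => (hf s ⟨ht₀.1.trans hs.1, hs.2⟩).mono (Icc_subset_Icc_left ht₀.1))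
      (fun s hs => hK s ⟨ht₀.1.trans hs.1, hs.2⟩) h0 t ⟨h, ht.2⟩
  · have hneg : ∀ s ∈ Icc (-t₀) (-a), -s ∈ Icc a b := fun s hs =>
      ⟨by linarith [hs.2], by linarith [hs.1, ht₀.2]⟩
    have := key (fun s => f (-s)) (fun s => -f' (-s)) (-t₀) (-a) (fun s hs => by
      have h1 := (hf (-s) (hneg s hs)).scomp s ((hasDerivAt_neg s).hasDerivWithinAt
        (s := Icc (-t₀) (-a))) (fun r hr => hneg r hr)
      simpa [Function.comp_def] using h1) (fun s hs => by simpa using hK _ (hneg s hs))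
      (by simpa using h0) (-t) ⟨by linarith, by linarith [ht.1]⟩
    simpa using this

/-- A geodesic tangent to a characteristic of an eikonal solution is a characteristic. -/
theorem IsGeodesic.velocity_eq_ray (hV : IsOpen V) (hF : IsFinsler V F) (hW : IsOpen W)
    (hWV : W ⊆ V) (hu : IsEikonal F W u) {c : ℝ → Sp d} (hc : IsGeodesic F c)
    (hcW : MapsTo c (Icc 0 1) W) {L : ℝ} (hL : 0 < L) {t₀ : ℝ} (ht₀ : t₀ ∈ Icc (0 : ℝ) 1)
    (h0 : velocity c t₀ = L • ray F u (c t₀)) {t : ℝ} (ht : t ∈ Icc (0 : ℝ) 1) :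
    velocity c t = L • ray F u (c t) := by
  have hcc : ContinuousOn c (Icc 0 1) := hc.contDiff.continuousOn
  have hvc : ContinuousOn (velocity c) (Icc 0 1) := hc.differentiableOn_velocity.continuousOn
  have hrc : ContinuousOn (fun t => L • ray F u (c t)) (Icc 0 1) := fun t ht =>
    (ContinuousAt.comp_continuousWithinAt (g := ray F u)
      (hu.contDiffAt_ray hV hF hWV hW (hcW ht)).continuousAt (hcc t ht)).const_smul L
  have hloc : ∀ s ∈ Icc (0 : ℝ) 1, velocity c s = L • ray F u (c s) →
      ∀ᶠ t in 𝓝[Icc 0 1] s, velocity c t = L • ray F u (c t) := by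
    intro s hs hsv
    have hx := hcW hs
    have hxV := hWV hx
    have hp := hu.gradient_ne_zero hx
    have hne : velocity c s ≠ 0 := by
      rw [hsv]; exact smul_ne_zero hL.ne' (hu.ray_ne_zero hV hF hWV hx)
    have hLp : L • gradient u (c s) ≠ 0 := smul_ne_zero hL.ne' hp
    have hmom : momentum F (c s, velocity c s) = L • gradient u (c s) := by
      rw [hsv, hF.momentum_smul hV hxV (hu.ray_ne_zero hV hF hWV hx) hL,
        hu.momentum_ray hV hF hWV hx]
    -- Along the geodesic, `f` is the derivative of the defect `π` between the momentum and `L ∇u`.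
    -- It vanishes where the covector is `L ∇u`, so a local Lipschitz bound controls it by `π`
    -- itself and Grönwall applies.
    let f : Sp d × Sp d → Sp d := fun z =>
      force F z - L • fderiv ℝ (gradient u) z.1 (colegendre F z)
    have hf : ContDiffAt ℝ 1 f (c s, L • gradient u (c s)) := by
      refine ContDiffAt.of_le ?_ (n := ∞) (WithTop.coe_le_coe.2 (le_top : (1 : ℕ∞) ≤ ⊤))
      refine (hF.contDiffAt_force hV hxV hLp).sub (ContDiffAt.const_smul L ?_)
      refine ContDiffAt.clm_apply ?_ (hF.contDiffAt_colegendre hV hxV hLp)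
      exact ((contDiffAt_gradient (hu.contDiffAt hW hx)).fderiv_infty).comp
        (c s, L • gradient u (c s)) contDiffAt_fst
    have hf0 : ∀ x ∈ W, f (x, L • gradient u x) = 0 := by
      intro x hx
      simp only [f]
      rw [hF.force_smul hV (hWV hx) (hu.gradient_ne_zero hx) hL,
        hF.colegendre_smul hV (hWV hx) (hu.gradient_ne_zero hx) hL, map_smul]
      have := hu.fderiv_gradient_ray hV hF hWV hW hx
      rw [ray] at this
      rw [this, smul_smul, pow_two, sub_self]
    obtain ⟨K, N, hN, hlip⟩ := hf.exists_lipschitzOnWith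
    have hmc : ContinuousWithinAt (fun t => (c t, momentum F (c t, velocity c t))) (Icc 0 1) s :=
      (hcc s hs).prodMk (hc.hasDerivWithinAt_momentum hV hF hs hxV hne).continuousWithinAt
    have hgc : ContinuousWithinAt (fun t => (c t, L • gradient u (c t))) (Icc 0 1) s :=
      (hcc s hs).prodMk ((ContinuousAt.comp_continuousWithinAt (g := gradient u)
        (contDiffAt_gradient (hu.contDiffAt hW hx)).continuousAt (hcc s hs)).const_smul L)
    have e1 : ∀ᶠ t in 𝓝[Icc 0 1] s, (c t, momentum F (c t, velocity c t)) ∈ N :=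
      hmc.eventually_mem (by simpa only [hmom] using hN)
    have e2 : ∀ᶠ t in 𝓝[Icc 0 1] s, (c t, L • gradient u (c t)) ∈ N := hgc.eventually_mem hN
    have e3 : ∀ᶠ t in 𝓝[Icc 0 1] s, velocity c t ≠ 0 := (hvc s hs).eventually_ne hne
    obtain ⟨ε, hε, hball⟩ := Metric.mem_nhdsWithin_iff.1 (e1.and (e2.and e3))
    set a := max 0 (s - ε / 2)
    set b := min 1 (s + ε / 2)
    have hab : ∀ t ∈ Icc a b, t ∈ Icc (0 : ℝ) 1 ∧ t ∈ Metric.ball s ε ∩ Icc 0 1 := by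
      intro t ht
      have h1 : (0 : ℝ) ≤ t := (le_max_left _ _).trans ht.1
      have h2 : t ≤ 1 := ht.2.trans (min_le_left _ _)
      have h3 : s - ε / 2 ≤ t := (le_max_right _ _).trans ht.1
      have h4 : t ≤ s + ε / 2 := ht.2.trans (min_le_right _ _)
      refine ⟨⟨h1, h2⟩, ?_, h1, h2⟩
      rw [Metric.mem_ball, Real.dist_eq, abs_lt]; constructor <;> linarith
    have hsab : s ∈ Icc a b :=
      ⟨max_le hs.1 (by linarith), le_min hs.2 (by linarith)⟩
    let π : ℝ → Sp d := fun t => momentum F (c t, velocity c t) - L • gradient u (c t)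
    have hπ : ∀ t ∈ Icc a b, HasDerivWithinAt π (f (c t, momentum F (c t, velocity c t)))
        (Icc a b) t := by
      intro t ht
      obtain ⟨ht1, ht2⟩ := hab t ht
      have hvt := (hball ht2).2.2
      have h1 := hc.hasDerivWithinAt_momentum hV hF ht1 (hWV (hcW ht1)) hvt
      have h2 := (contDiffAt_gradient
        (hu.contDiffAt hW (hcW ht1))).differentiableAt_infty.hasFDerivAt
      have h3 := (h2.comp_hasDerivWithinAt t (hc.hasDerivWithinAt ht1)).const_smul L
      have h4 := (h1.sub h3).mono (fun r hr => (hab r hr).1 : Icc a b ⊆ Icc 0 1)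
      simp only [f]
      rw [hF.colegendre_momentum hV (hWV (hcW ht1)) hvt]
      exact h4
    have hbound : ∀ t ∈ Icc a b, ‖f (c t, momentum F (c t, velocity c t))‖ ≤ K * ‖π t‖ := by
      intro t ht
      obtain ⟨ht1, ht2⟩ := hab t ht
      have h1 := hlip.norm_sub_le (hball ht2).1 (hball ht2).2.1
      rw [hf0 _ (hcW ht1), sub_zero] at h1
      refine h1.trans (le_of_eq ?_)
      congr 1
      simp [Prod.norm_def, π]
    have hzero := fun t ht => eq_zero_of_norm_deriv_le (t := t) hsab hπ hbound
      (by simp only [π]; rw [hmom, sub_self]) ht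
    refine Metric.mem_nhdsWithin_iff.2 ⟨ε / 2, by positivity, fun t ht => ?_⟩
    have htab : t ∈ Icc a b := by
      have h1 := ht.1
      rw [Metric.mem_ball, Real.dist_eq, abs_lt] at h1
      exact ⟨max_le ht.2.1 (by linarith), le_min ht.2.2 (by linarith)⟩
    obtain ⟨ht1, ht2⟩ := hab t htab
    have h1 : momentum F (c t, velocity c t) = L • gradient u (c t) := sub_eq_zero.1 (hzero t htab)
    have h2 := hF.colegendre_momentum hV (hWV (hcW ht1)) (hball ht2).2.2
    rw [h1, hF.colegendre_smul hV (hWV (hcW ht1)) (hu.gradient_ne_zero (hcW ht1)) hL] at h2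
    exact h2.symm
  -- The set of times where the velocities agree is relatively open by `hloc` and closed by
  -- continuity; connectedness spreads agreement at `t₀` to the whole interval.
  have := isPreconnected_Icc.induction₂ (s := Icc (0 : ℝ) 1)
    (fun s t => velocity c s = L • ray F u (c s) ↔ velocity c t = L • ray F u (c t))
    (fun s hs => by
      by_cases h : velocity c s = L • ray F u (c s)
      · filter_upwards [hloc s hs h] with t ht using ⟨fun _ => ht, fun _ => h⟩
      · have h1 : ∀ᶠ t in 𝓝[Icc 0 1] s, velocity c t - L • ray F u (c t) ≠ 0 :=
          ((hvc s hs).sub (hrc s hs)).eventually_ne (sub_ne_zero.2 h)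
        filter_upwards [h1] with t ht using ⟨fun h' => absurd h' h,
          fun h' => absurd h' (sub_ne_zero.1 ht)⟩)
    (fun _ _ _ _ _ _ => Iff.trans) (fun _ _ _ _ => Iff.symm) ht₀ ht
  exact this.1 h0

end Eikonal

/-! ### Calibration of curves by eikonal solutions. -/

section Calibration

variable {V W : Set (Sp d)} {F : Sp d → Sp d → ℝ} {u : Sp d → ℝ} {c c' : ℝ → Sp d} {L : ℝ}

theorem IsGeodesic.length_eq (hV : IsOpen V) (hF : IsFinsler V F) (hc : IsGeodesic F c)
    (hcV : MapsTo c (Icc 0 1) V) : length F c = F (c 0) (velocity c 0) := by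
  rw [length, intervalIntegral.integral_congr (g := fun _ => F (c 0) (velocity c 0))]
  · simp
  · intro t ht
    rw [uIcc_of_le zero_le_one] at ht
    exact hc.speed_eq hV hF hcV ht

theorem IsGeodesic.speed_pos (hV : IsOpen V) (hF : IsFinsler V F) (hc : IsGeodesic F c)
    (hcV : MapsTo c (Icc 0 1) V) (hne : c 0 ≠ c 1) : 0 < F (c 0) (velocity c 0) := by
  refine lt_of_le_of_ne (hF.nonneg _ (hcV (by simp)) _) fun h0 => hne ?_
  have h1 : ∀ t ∈ Icc (0 : ℝ) 1, HasDerivWithinAt c 0 (Icc 0 1) t := by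
    intro t ht
    have h2 : velocity c t = 0 := by
      by_contra h
      exact (hF.pos hV (hcV ht) h).ne' ((hc.speed_eq hV hF hcV ht).trans h0.symm)
    rw [← h2]; exact hc.hasDerivWithinAt ht
  exact (constant_of_derivWithin_zero (fun t ht => (h1 t ht).differentiableWithinAt)
    (fun t ht => (h1 t (Ico_subset_Icc_self ht)).derivWithin
      (uniqueDiffOn_Icc zero_lt_one t (Ico_subset_Icc_self ht))) 1 (by simp)).symm

theorem IsEikonal.hasDerivWithinAt_comp (hu : IsEikonal F W u) (hW : IsOpen W)
    {s : Set ℝ} {t : ℝ} {w : Sp d} (hc : HasDerivWithinAt c w s t) (ht : c t ∈ W) :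
    HasDerivWithinAt (fun r => u (c r)) (inner ℝ (gradient u (c t)) w) s t := by
  rw [inner_gradient]
  exact (hu.contDiffAt hW ht).differentiableAt_infty.hasFDerivAt.comp_hasDerivWithinAt t hc

/-- The calibration inequality `⟨∇u, c'⟩ ≤ F(c, c') ≤ L` in integrated form. -/
theorem IsEikonal.monotoneOn_sub (hV : IsOpen V) (hF : IsFinsler V F) (hW : IsOpen W)
    (hWV : W ⊆ V) (hu : IsEikonal F W u)
    (hc : ∀ t ∈ Icc (0 : ℝ) 1, HasDerivWithinAt c (c' t) (Icc 0 1) t)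
    (hcW : MapsTo c (Icc 0 1) W) (hL : ∀ t ∈ Icc (0 : ℝ) 1, F (c t) (c' t) ≤ L) :
    MonotoneOn (fun t => L * t - u (c t)) (Icc 0 1) := by
  have hd : ∀ t ∈ Icc (0 : ℝ) 1, HasDerivWithinAt (fun t => L * t - u (c t))
      (L - inner ℝ (gradient u (c t)) (c' t)) (Icc 0 1) t := fun t ht => by
    have h := ((hasDerivWithinAt_id t (Icc 0 1)).const_mul L).sub
      (hu.hasDerivWithinAt_comp hW (hc t ht) (hcW ht))
    rwa [mul_one] at h
  refine monotoneOn_of_hasDerivWithinAt_nonneg (convex_Icc 0 1)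
    (fun t ht => (hd t ht).continuousWithinAt)
    (fun t ht => (hd t (interior_subset ht)).mono interior_subset) (fun t ht => ?_)
  have ht' := interior_subset ht
  linarith [hu.inner_gradient_le hV hF hWV (hcW ht') (c' t), hL t ht']

theorem IsEikonal.sub_le (hV : IsOpen V) (hF : IsFinsler V F) (hW : IsOpen W)
    (hWV : W ⊆ V) (hu : IsEikonal F W u)
    (hc : ∀ t ∈ Icc (0 : ℝ) 1, HasDerivWithinAt c (c' t) (Icc 0 1) t)
    (hcW : MapsTo c (Icc 0 1) W) (hL : ∀ t ∈ Icc (0 : ℝ) 1, F (c t) (c' t) ≤ L) :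
    u (c 1) - u (c 0) ≤ L := by
  have := hu.monotoneOn_sub hV hF hW hWV hc hcW hL (by simp : (0 : ℝ) ∈ Icc (0 : ℝ) 1)
    (by simp : (1 : ℝ) ∈ Icc (0 : ℝ) 1) zero_le_one
  simp only [mul_zero, mul_one] at this
  linarith

/-- A curve of speed at most `L` along which `u` increases by `L` is a characteristic. -/
theorem IsEikonal.eq_ray_of_sub_eq (hV : IsOpen V) (hF : IsFinsler V F) (hW : IsOpen W)
    (hWV : W ⊆ V) (hu : IsEikonal F W u)
    (hc : ∀ t ∈ Icc (0 : ℝ) 1, HasDerivWithinAt c (c' t) (Icc 0 1) t)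
    (hcW : MapsTo c (Icc 0 1) W) (hL0 : 0 < L) (hL : ∀ t ∈ Icc (0 : ℝ) 1, F (c t) (c' t) = L)
    (h : u (c 1) - u (c 0) = L) {t : ℝ} (ht : t ∈ Icc (0 : ℝ) 1) :
    c' t = L • ray F u (c t) := by
  have hmono := hu.monotoneOn_sub hV hF hW hWV hc hcW fun t ht => (hL t ht).le
  -- A monotone function with equal end values is constant, so the calibration inequality is an
  -- equality at every time, end points included.
  have hconst : ∀ t ∈ Icc (0 : ℝ) 1, L * t - u (c t) = -u (c 0) := by
    intro t ht
    have h1 := hmono (by simp : (0 : ℝ) ∈ Icc (0 : ℝ) 1) ht ht.1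
    have h2 := hmono ht (by simp : (1 : ℝ) ∈ Icc (0 : ℝ) 1) ht.2
    simp only [mul_zero, mul_one] at h1 h2
    linarith
  have hd : HasDerivWithinAt (fun t => L * t - u (c t))
      (L - inner ℝ (gradient u (c t)) (c' t)) (Icc 0 1) t := by
    have h := ((hasDerivWithinAt_id t (Icc 0 1)).const_mul L).sub
      (hu.hasDerivWithinAt_comp hW (hc t ht) (hcW ht))
    rwa [mul_one] at h
  have hd0 : HasDerivWithinAt (fun t => L * t - u (c t)) 0 (Icc 0 1) t :=
    (hasDerivWithinAt_const t (Icc 0 1) (-u (c 0))).congr hconst (hconst t ht)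
  have h3 := (uniqueDiffOn_Icc zero_lt_one t ht).eq_deriv _ hd hd0
  have hx := hWV (hcW ht)
  have hr := hu.apply_ray hV hF hWV (hcW ht)
  have hr0 := hu.ray_ne_zero hV hF hWV (hcW ht)
  have hLr : F (c t) (L • ray F u (c t)) = L := by
    rw [hF.homogeneous _ hx _ L hL0.le, hr, mul_one]
  refine hF.eq_of_inner_momentum_eq hV hx (smul_ne_zero hL0.ne' hr0) (by rw [hLr, hL t ht]) ?_
  rw [hF.momentum_smul hV hx hr0 hL0, hu.momentum_ray hV hF hWV (hcW ht), hLr, hL t ht,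
    real_inner_smul_left]
  have : inner ℝ (gradient u (c t)) (c' t) = L := by linarith
  rw [this]

/-- `L` may have either sign, so characteristics run backwards are covered. -/
theorem IsEikonal.sub_eq_of_ray (hV : IsOpen V) (hF : IsFinsler V F) (hW : IsOpen W)
    (hWV : W ⊆ V) (hu : IsEikonal F W u)
    (hc : ∀ t ∈ Icc (0 : ℝ) 1, HasDerivWithinAt c (L • ray F u (c t)) (Icc 0 1) t)
    (hcW : MapsTo c (Icc 0 1) W) : u (c 1) - u (c 0) = L := by
  have hd : ∀ t ∈ Icc (0 : ℝ) 1, HasDerivWithinAt (fun t => u (c t) - L * t) 0 (Icc 0 1) t := by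
    intro t ht
    have := (hu.hasDerivWithinAt_comp hW (hc t ht) (hcW ht)).sub
      ((hasDerivWithinAt_id t (Icc 0 1)).const_mul L)
    rw [inner_smul_right, hu.inner_gradient_ray hV hF hWV (hcW ht), sub_self] at this
    exact this
  have := constant_of_derivWithin_zero (fun t ht => (hd t ht).differentiableWithinAt)
    (fun t ht => (hd t (Ico_subset_Icc_self ht)).derivWithin
      (uniqueDiffOn_Icc zero_lt_one t (Ico_subset_Icc_self ht))) 1 (by simp)
  simp only [mul_one, mul_zero, sub_zero] at this
  linarith

end Calibration

/-! ### Uniform bounds on the compact cosphere bundle. -/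

section Bounds

variable {V W K : Set (Sp d)} {F : Sp d → Sp d → ℝ} {u : Sp d → ℝ} {B κ : ℝ}

/-- The unit cosphere bundle over `K`. -/
def cosphereBundle (F : Sp d → Sp d → ℝ) (K : Set (Sp d)) : Set (Sp d × Sp d) :=
  {z | z.1 ∈ K ∧ dual F z.1 z.2 = 1}

/-- The bundle is the continuous image of `K` times the Euclidean sphere under radial normalization.
-/
theorem IsFinsler.isCompact_cosphereBundle (hV : IsOpen V) (hF : IsFinsler V F)
    (hK : IsCompact K) (hKV : K ⊆ V) : IsCompact (cosphereBundle F K) := by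
  have hne : ∀ u ∈ Metric.sphere (0 : Sp d) 1, u ≠ 0 := fun u hu =>
    ne_zero_of_mem_unit_sphere (⟨u, hu⟩ : Metric.sphere (0 : Sp d) 1)
  have hcont : ContinuousOn (fun z : Sp d × Sp d => (z.1, (dual F z.1 z.2)⁻¹ • z.2))
      (K ×ˢ Metric.sphere (0 : Sp d) 1) := by
    intro z hz
    have h1 := (hF.contDiffAt_dual hV (hKV hz.1) (hne _ hz.2)).continuousAt
    have h2 := (hF.dual_pos hV (hKV hz.1) (hne _ hz.2)).ne'
    exact (continuousAt_fst.prodMk ((h1.inv₀ h2).smul continuousAt_snd)).continuousWithinAt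
  convert (hK.prod (isCompact_sphere (0 : Sp d) 1)).image_of_continuousOn hcont using 1
  ext ⟨x, ξ⟩
  constructor
  · rintro ⟨hx, hξ⟩
    have hξ0 := ne_zero_of_dual_eq_one hξ
    have hn : 0 < ‖ξ‖⁻¹ := inv_pos.2 (norm_pos_iff.2 hξ0)
    refine ⟨(x, ‖ξ‖⁻¹ • ξ), ⟨hx, ?_⟩, ?_⟩
    · simp [norm_smul, hξ0]
    · simp only at hx hξ ⊢
      rw [hF.dual_smul hV (hKV hx) hξ0 hn, hξ, mul_one, inv_inv, smul_smul, mul_inv_cancel₀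
        (norm_ne_zero_iff.2 hξ0), one_smul]
  · rintro ⟨⟨x', ξ'⟩, ⟨hx, hξ⟩, h⟩
    obtain ⟨rfl, rfl⟩ := Prod.mk.inj h
    have h2 := hF.dual_pos hV (hKV hx) (hne _ hξ)
    refine ⟨hx, ?_⟩
    simp only
    rw [hF.dual_smul hV (hKV hx) (hne _ hξ) (inv_pos.2 h2), inv_mul_cancel₀ h2.ne']

/-- Uniform bounds for the Hamiltonian and its derivatives on the cosphere bundle over `K`. -/
structure HamiltonianBounds (F : Sp d → Sp d → ℝ) (K : Set (Sp d)) (B κ : ℝ) : Prop where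
  one_le : 1 ≤ B
  kappa_pos : 0 < κ
  norm_covector : ∀ x ∈ K, ∀ ξ, dual F x ξ = 1 → ‖ξ‖ ≤ B
  norm_colegendre : ∀ x ∈ K, ∀ ξ, dual F x ξ = 1 → ‖colegendre F (x, ξ)‖ ≤ B
  norm_force : ∀ x ∈ K, ∀ ξ, dual F x ξ = 1 → ‖force F (x, ξ)‖ ≤ B
  norm_fderiv_colegendre : ∀ x ∈ K, ∀ ξ, dual F x ξ = 1 → ‖fderiv ℝ (colegendre F) (x, ξ)‖ ≤ B
  norm_fderiv_force : ∀ x ∈ K, ∀ ξ, dual F x ξ = 1 → ‖fderiv ℝ (force F) (x, ξ)‖ ≤ B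
  coercive : ∀ x ∈ K, ∀ ξ, dual F x ξ = 1 → ∀ w,
    κ * ‖w‖ ^ 2 ≤ inner ℝ w (fderiv ℝ (colegendre F) (x, ξ) (0, w))

theorem IsFinsler.exists_hamiltonianBounds (hV : IsOpen V) (hF : IsFinsler V F)
    (hK : IsCompact K) (hKV : K ⊆ V) : ∃ B κ, HamiltonianBounds F K B κ := by
  have hZ := hF.isCompact_cosphereBundle hV hK hKV
  have hne : ∀ u ∈ Metric.sphere (0 : Sp d) 1, u ≠ 0 := fun u hu =>
    ne_zero_of_mem_unit_sphere (⟨u, hu⟩ : Metric.sphere (0 : Sp d) 1)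
  have hco : ∀ z ∈ cosphereBundle F K, ContDiffAt ℝ ∞ (colegendre F) z := fun z hz =>
    hF.contDiffAt_colegendre hV (hKV hz.1) (ne_zero_of_dual_eq_one hz.2)
  have hfo : ∀ z ∈ cosphereBundle F K, ContDiffAt ℝ ∞ (force F) z := fun z hz =>
    hF.contDiffAt_force hV (hKV hz.1) (ne_zero_of_dual_eq_one hz.2)
  obtain ⟨B₁, h1⟩ := hZ.exists_bound_of_continuousOn (f := fun z => z.2) continuousOn_snd
  obtain ⟨B₂, h2⟩ := hZ.exists_bound_of_continuousOn (f := colegendre F)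
    fun z hz => (hco z hz).continuousAt.continuousWithinAt
  obtain ⟨B₃, h3⟩ := hZ.exists_bound_of_continuousOn (f := force F)
    fun z hz => (hfo z hz).continuousAt.continuousWithinAt
  obtain ⟨B₄, h4⟩ := hZ.exists_bound_of_continuousOn (f := fderiv ℝ (colegendre F))
    fun z hz => (hco z hz).fderiv_infty.continuousAt.continuousWithinAt
  obtain ⟨B₅, h5⟩ := hZ.exists_bound_of_continuousOn (f := fderiv ℝ (force F))
    fun z hz => (hfo z hz).fderiv_infty.continuousAt.continuousWithinAt
  -- An upper bound for the reciprocal of the quadratic form on unit vectors gives the coercivity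
  -- constant, and it exists even if the compact set is empty.
  have hcont : ContinuousOn (fun y : (Sp d × Sp d) × Sp d =>
      (inner ℝ y.2 (fderiv ℝ (colegendre F) y.1 (0, y.2)))⁻¹)
      (cosphereBundle F K ×ˢ Metric.sphere (0 : Sp d) 1) := by
    intro y hy
    have hz := hy.1
    refine ContinuousAt.continuousWithinAt (ContinuousAt.inv₀ ?_
      (hF.inner_fderiv_colegendre_pos hV (hKV hz.1) (ne_zero_of_dual_eq_one hz.2)
        (hne _ hy.2)).ne')
    refine continuousAt_snd.inner (ContinuousAt.clm_apply ?_ (by fun_prop))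
    exact ContinuousAt.comp (g := fderiv ℝ (colegendre F)) (hco _ hz).fderiv_infty.continuousAt
      continuousAt_fst
  obtain ⟨B₆, h6⟩ := (hZ.prod (isCompact_sphere (0 : Sp d) 1)).exists_bound_of_continuousOn hcont
  set B := max 1 (max B₁ (max B₂ (max B₃ (max B₄ B₅)))) with hB
  refine ⟨B, (max 1 B₆)⁻¹, le_max_left _ _, by positivity, fun x hx ξ hξ => ?_, fun x hx ξ hξ => ?_,
    fun x hx ξ hξ => ?_, fun x hx ξ hξ => ?_, fun x hx ξ hξ => ?_, fun x hx ξ hξ w => ?_⟩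
  · exact (h1 (x, ξ) ⟨hx, hξ⟩).trans (by simp [hB])
  · exact (h2 (x, ξ) ⟨hx, hξ⟩).trans (by simp [hB])
  · exact (h3 (x, ξ) ⟨hx, hξ⟩).trans (by simp [hB])
  · exact (h4 (x, ξ) ⟨hx, hξ⟩).trans (by simp [hB])
  · exact (h5 (x, ξ) ⟨hx, hξ⟩).trans (by simp [hB])
  · rcases eq_or_ne w 0 with rfl | hw
    · simp
    have hn : 0 < ‖w‖ := norm_pos_iff.2 hw
    have hpos := hF.inner_fderiv_colegendre_pos hV (hKV hx) (ne_zero_of_dual_eq_one hξ) hw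
    have h7 := h6 ((x, ξ), ‖w‖⁻¹ • w) ⟨⟨hx, hξ⟩, by simp [norm_smul, hn.ne']⟩
    simp only [norm_inv] at h7
    rw [show ((0, ‖w‖⁻¹ • w) : Sp d × Sp d) = ‖w‖⁻¹ • (0, w) by simp, map_smul,
      real_inner_smul_left, inner_smul_right, norm_mul, norm_mul, norm_inv, norm_norm,
      Real.norm_of_nonneg hpos.le] at h7
    set I := inner ℝ w (fderiv ℝ (colegendre F) (x, ξ) (0, w))
    rw [mul_inv, mul_inv, inv_inv, ← mul_assoc, ← div_eq_mul_inv, div_le_iff₀ hpos] at h7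
    rw [inv_mul_le_iff₀ (by positivity)]
    nlinarith [le_max_right 1 B₆]

end Bounds

/-! ### Second-order bounds along short characteristics. -/

section Riccati

variable {V W K : Set (Sp d)} {F : Sp d → Sp d → ℝ} {u : Sp d → ℝ} {B κ : ℝ}

theorem IsEikonal.fderiv_ray (hV : IsOpen V) (hF : IsFinsler V F) (hW : IsOpen W) (hWV : W ⊆ V)
    (hu : IsEikonal F W u) {x : Sp d} (hx : x ∈ W) (w : Sp d) :
    fderiv ℝ (ray F u) x w
      = fderiv ℝ (colegendre F) (x, gradient u x) (w, fderiv ℝ (gradient u) x w) := by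
  have h1 := (hF.contDiffAt_colegendre hV (hWV hx)
    (hu.gradient_ne_zero hx)).differentiableAt_infty.hasFDerivAt.comp x
    ((hasFDerivAt_id x).prodMk
      (contDiffAt_gradient (hu.contDiffAt hW hx)).differentiableAt_infty.hasFDerivAt)
  rw [show fderiv ℝ (ray F u) x = _ from h1.fderiv]
  rfl

theorem norm_pair_le (A : Sp d →L[ℝ] Sp d) (w : Sp d) : ‖(w, A w)‖ ≤ (1 + ‖A‖) * ‖w‖ := by
  have h1 := A.le_opNorm w
  have h2 : 0 ≤ ‖A‖ * ‖w‖ := by positivity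
  have h3 := norm_nonneg w
  rw [Prod.norm_def, add_mul, one_mul]
  exact max_le (by simp only; linarith) (by simp only; linarith)

theorem IsEikonal.norm_fderiv_ray_le (hV : IsOpen V) (hF : IsFinsler V F) (hW : IsOpen W)
    (hWV : W ⊆ V) (hWK : W ⊆ K) (hB : HamiltonianBounds F K B κ) (hu : IsEikonal F W u)
    {x : Sp d} (hx : x ∈ W) (w : Sp d) :
    ‖fderiv ℝ (ray F u) x w‖ ≤ B * (1 + ‖fderiv ℝ (gradient u) x‖) * ‖w‖ := by
  rw [hu.fderiv_ray hV hF hW hWV hx, mul_assoc]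
  refine (ContinuousLinearMap.le_opNorm _ _).trans ?_
  exact mul_le_mul (hB.norm_fderiv_colegendre x (hWK hx) _ (hu.dual_eq x hx)) (norm_pair_le _ _)
    (norm_nonneg _) (by linarith [hB.one_le])

/-- The Riccati inequality for the Hessian of an eikonal solution along a characteristic. -/
theorem IsEikonal.norm_fderiv_hessian_ray_le (hV : IsOpen V) (hF : IsFinsler V F) (hW : IsOpen W)
    (hWV : W ⊆ V) (hWK : W ⊆ K) (hB : HamiltonianBounds F K B κ) (hu : IsEikonal F W u)
    {x : Sp d} (hx : x ∈ W) :
    ‖fderiv ℝ (fderiv ℝ (gradient u)) x (ray F u x)‖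
      ≤ B * (1 + ‖fderiv ℝ (gradient u) x‖) ^ 2 := by
  have hB0 : 0 ≤ B := by linarith [hB.one_le]
  have hne := hu.gradient_ne_zero hx
  have hg := contDiffAt_gradient (hu.contDiffAt hW hx)
  refine ContinuousLinearMap.opNorm_le_bound _ (by positivity) fun w => ?_
  -- Symmetry moves `ray` into the inner slot, where `fderiv_gradient_ray` can be differentiated in
  -- the direction `w`. The two resulting terms contribute `B(1 + ‖G‖)` and `‖G‖ B(1 + ‖G‖)`, which
  -- add up to the square.
  rw [fderiv_fderiv_comm hg]
  have h1 := hg.fderiv_infty.differentiableAt_infty.hasFDerivAt.clm_apply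
    (hu.contDiffAt_ray hV hF hWV hW hx).differentiableAt_infty.hasFDerivAt
  have h2 := (hF.contDiffAt_force hV (hWV hx) hne).differentiableAt_infty.hasFDerivAt.comp x
    ((hasFDerivAt_id x).prodMk hg.differentiableAt_infty.hasFDerivAt)
  have h3 : (fun y => fderiv ℝ (gradient u) y (ray F u y)) =ᶠ[𝓝 x]
      (force F ∘ fun y => (id y, gradient u y)) := by
    filter_upwards [hW.mem_nhds hx] with y hy using hu.fderiv_gradient_ray hV hF hWV hW hy
  have h4 : fderiv ℝ (gradient u) x (fderiv ℝ (ray F u) x w)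
      + fderiv ℝ (fderiv ℝ (gradient u)) x w (ray F u x)
      = fderiv ℝ (force F) (x, gradient u x) (w, fderiv ℝ (gradient u) x w) :=
    congrArg (fun g => g w) (h1.unique (h2.congr_of_eventuallyEq h3))
  rw [← eq_sub_iff_add_eq'] at h4
  rw [h4]
  set G := fderiv ℝ (gradient u) x
  have h5 : ‖fderiv ℝ (force F) (x, gradient u x) (w, G w)‖ ≤ B * ((1 + ‖G‖) * ‖w‖) :=
    (ContinuousLinearMap.le_opNorm _ _).trans (mul_le_mul
      (hB.norm_fderiv_force x (hWK hx) _ (hu.dual_eq x hx)) (norm_pair_le _ _) (norm_nonneg _) hB0)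
  have h6 : ‖G (fderiv ℝ (ray F u) x w)‖ ≤ ‖G‖ * (B * (1 + ‖G‖) * ‖w‖) :=
    (ContinuousLinearMap.le_opNorm _ _).trans (mul_le_mul_of_nonneg_left
      (hu.norm_fderiv_ray_le hV hF hW hWV hWK hB hx w) (norm_nonneg _))
  refine (norm_sub_le _ _).trans ?_
  nlinarith

/-- A function vanishing on a hyperplane has conormal gradient there. -/
theorem inner_gradient_eq_zero_of_vanishing (hW : IsOpen W) {x y ξ w : Sp d} (hx : x ∈ W)
    (hu : DifferentiableAt ℝ u x) (hvan : ∀ x ∈ W, inner ℝ ξ (x - y) = 0 → u x = 0)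
    (hxy : inner ℝ ξ (x - y) = 0) (hw : inner ℝ ξ w = 0) : inner ℝ (gradient u x) w = 0 := by
  rw [inner_gradient]
  have hl : HasDerivAt (fun r : ℝ => x + r • w) w 0 := by
    simpa using ((hasDerivAt_id (0 : ℝ)).smul_const w).const_add x
  have h1 := HasFDerivAt.comp_hasDerivAt_of_eq (l := u) 0 hu.hasFDerivAt hl (by simp)
  have h2 : (u ∘ fun r : ℝ => x + r • w) =ᶠ[𝓝 0] fun _ => 0 := by
    have : ∀ᶠ r : ℝ in 𝓝 0, x + r • w ∈ W :=
      hl.continuousAt.eventually_mem (by simpa using hW.mem_nhds hx)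
    filter_upwards [this] with r hr
    refine hvan _ hr ?_
    rw [add_sub_right_comm, inner_add_right, inner_smul_right, hxy, hw]
    simp
  exact h1.unique ((hasDerivAt_const (0 : ℝ) (0 : ℝ)).congr_of_eventuallyEq h2)

/-- The Hessian of a solution vanishing on a hyperplane is controlled on that hyperplane. -/
theorem IsEikonal.norm_hessian_le_of_vanishing (hV : IsOpen V) (hF : IsFinsler V F)
    (hW : IsOpen W) (hWV : W ⊆ V) (hWK : W ⊆ K) (hB : HamiltonianBounds F K B κ)
    (hu : IsEikonal F W u) {y : Sp d} (hy : y ∈ W)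
    (hvan : ∀ x ∈ W, inner ℝ (gradient u y) (x - y) = 0 → u x = 0) :
    ‖fderiv ℝ (gradient u) y‖ ≤ B ^ 2 * (2 + B ^ 2) := by
  have hB1 := hB.one_le
  have hB0 : 0 ≤ B := by linarith
  set ξ := gradient u y with hξ
  set v := ray F u y with hv
  set G := fderiv ℝ (gradient u) y with hG
  have hξB : ‖ξ‖ ≤ B := hB.norm_covector y (hWK hy) _ (hu.dual_eq y hy)
  have hvB : ‖v‖ ≤ B := hB.norm_colegendre y (hWK hy) _ (hu.dual_eq y hy)
  have hξv : inner ℝ ξ v = 1 := hu.inner_gradient_ray hV hF hWV hy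
  have hf : G v = force F (y, ξ) := hu.fderiv_gradient_ray hV hF hWV hW hy
  have hfB : ‖force F (y, ξ)‖ ≤ B := hB.norm_force y (hWK hy) _ (hu.dual_eq y hy)
  have hsym : ∀ a b, inner ℝ (G a) b = inner ℝ a (G b) := fun a b =>
    inner_fderiv_gradient_comm (hu.contDiffAt hW hy) a b
  -- Along a line inside the hyperplane the gradient stays conormal, so the Hessian vanishes on
  -- pairs of tangent vectors. In the transversal direction `v` it is `force` by the equation;
  -- symmetry supplies the mixed entries.
  have hzero : ∀ a b, inner ℝ ξ a = 0 → inner ℝ ξ b = 0 → inner ℝ (G a) b = 0 := by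
    intro a b ha hb
    have hline : HasDerivAt (fun s : ℝ => y + s • a) a 0 := by
      simpa using ((hasDerivAt_id (0 : ℝ)).smul_const a).const_add y
    have h0 : y + (0 : ℝ) • a = y := by simp
    have hd : HasDerivAt (fun s : ℝ => inner ℝ (gradient u (y + s • a)) b) (inner ℝ (G a) b) 0 := by
      have h1 := (contDiffAt_gradient (hu.contDiffAt hW hy)).differentiableAt_infty.hasFDerivAt
      have h2 := HasFDerivAt.comp_hasDerivAt_of_eq (l := gradient u) 0 h1 hline h0.symm
      simpa using h2.inner ℝ (hasDerivAt_const 0 b)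
    have hev : ∀ᶠ s : ℝ in 𝓝 0, y + s • a ∈ W :=
      hline.continuousAt.eventually_mem (by rw [h0]; exact hW.mem_nhds hy)
    have hev0 : (fun s : ℝ => inner ℝ (gradient u (y + s • a)) b) =ᶠ[𝓝 0] fun _ => 0 := by
      filter_upwards [hev] with s hs
      refine inner_gradient_eq_zero_of_vanishing hW hs
        (hu.contDiffAt hW hs).differentiableAt_infty hvan ?_ hb
      rw [add_sub_cancel_left, inner_smul_right, ha, mul_zero]
    exact hd.unique ((hasDerivAt_const (0 : ℝ) (0 : ℝ)).congr_of_eventuallyEq hev0)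
  refine ContinuousLinearMap.opNorm_le_bound _ (by positivity) fun a => ?_
  -- Splitting along `v` is oblique, which costs the factor `1 + B²` in `ha'n`. The tangential part
  -- then contributes `B²(1 + B²)` and the part along `v` contributes `B²`.
  set a' := a - (inner ℝ ξ a) • v with ha'
  have hξa : |inner ℝ ξ a| ≤ B * ‖a‖ :=
    (abs_real_inner_le_norm _ _).trans (mul_le_mul_of_nonneg_right hξB (norm_nonneg _))
  have hperp : ∀ b, inner ℝ ξ (b - (inner ℝ ξ b) • v) = 0 := fun b => by
    rw [inner_sub_right, inner_smul_right, hξv, mul_one, sub_self]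
  have ha'n : ‖a'‖ ≤ (1 + B ^ 2) * ‖a‖ := by
    refine (norm_sub_le _ _).trans ?_
    rw [norm_smul, Real.norm_eq_abs]
    have := mul_le_mul hξa hvB (norm_nonneg _) (by positivity)
    nlinarith
  have hGa' : ‖G a'‖ ≤ B ^ 2 * ((1 + B ^ 2) * ‖a‖) := by
    have h1 : ∀ b, inner ℝ (G a') b = inner ℝ ξ b * inner ℝ a' (force F (y, ξ)) := by
      intro b
      have h2 := hzero a' (b - (inner ℝ ξ b) • v) (hperp a) (hperp b)
      rw [inner_sub_right, inner_smul_right, hsym a' v, hf] at h2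
      linarith
    have h3 := h1 (G a')
    rw [real_inner_self_eq_norm_sq] at h3
    have h4 : |inner ℝ ξ (G a')| ≤ B * ‖G a'‖ :=
      (abs_real_inner_le_norm _ _).trans (mul_le_mul_of_nonneg_right hξB (norm_nonneg _))
    have h5 : |inner ℝ a' (force F (y, ξ))| ≤ (1 + B ^ 2) * ‖a‖ * B :=
      (abs_real_inner_le_norm _ _).trans (mul_le_mul ha'n hfB (norm_nonneg _) (by positivity))
    have h6 : ‖G a'‖ ^ 2 ≤ B * ‖G a'‖ * ((1 + B ^ 2) * ‖a‖ * B) := by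
      rw [h3]
      refine (le_abs_self _).trans ?_
      rw [abs_mul]
      exact mul_le_mul h4 h5 (abs_nonneg _) (by positivity)
    rcases (norm_nonneg (G a')).eq_or_lt with h7 | h7
    · rw [← h7]; positivity
    · have : ‖G a'‖ * ‖G a'‖ ≤ ‖G a'‖ * (B ^ 2 * ((1 + B ^ 2) * ‖a‖)) := by nlinarith
      exact le_of_mul_le_mul_left this h7
  have hGa : G a = G a' + (inner ℝ ξ a) • force F (y, ξ) := by
    rw [← hf, ← map_smul, ← map_add, ha', sub_add_cancel]
  rw [hGa]
  refine (norm_add_le _ _).trans ?_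
  rw [norm_smul, Real.norm_eq_abs]
  have := mul_le_mul hξa hfB (norm_nonneg _) (by positivity)
  nlinarith

variable {c : ℝ → Sp d} {ℓ : ℝ}

/-- Barrier argument with `m + t`: on contact the Hessian has norm at most `m + 1`, so by the
Riccati inequality it grows at a rate at most `|ℓ| B (2 + m)² < 1`, slower than the barrier. -/
theorem IsEikonal.norm_hessian_le_along (hV : IsOpen V) (hF : IsFinsler V F)
    (hW : IsOpen W) (hWV : W ⊆ V) (hWK : W ⊆ K) (hB : HamiltonianBounds F K B κ)
    (hu : IsEikonal F W u)
    (hc : ∀ t ∈ Icc (0 : ℝ) 1, HasDerivWithinAt c (ℓ • ray F u (c t)) (Icc 0 1) t)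
    (hcW : MapsTo c (Icc 0 1) W) {m : ℝ} (hm : ‖fderiv ℝ (gradient u) (c 0)‖ ≤ m)
    (hℓ : |ℓ| * (B * (2 + m) ^ 2) < 1) {t : ℝ} (ht : t ∈ Icc (0 : ℝ) 1) :
    ‖fderiv ℝ (gradient u) (c t)‖ ≤ m + 1 := by
  have hd : ∀ t ∈ Icc (0 : ℝ) 1, HasDerivWithinAt (fun t => fderiv ℝ (gradient u) (c t))
      (ℓ • fderiv ℝ (fderiv ℝ (gradient u)) (c t) (ray F u (c t))) (Icc 0 1) t := by
    intro t ht
    rw [← map_smul]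
    exact (contDiffAt_gradient
      (hu.contDiffAt hW (hcW ht))).fderiv_infty.differentiableAt_infty.hasFDerivAt.comp_hasDerivWithinAt
        t (hc t ht)
  have hm0 : 0 ≤ m := (norm_nonneg _).trans hm
  have hB0 : 0 ≤ B := by linarith [hB.one_le]
  have key := image_norm_le_of_norm_deriv_right_lt_deriv_boundary
    (fun t ht => (hd t ht).continuousWithinAt)
    (fun t ht => (hd t (Ico_subset_Icc_self ht)).mono_of_mem_nhdsWithin (Icc_mem_nhdsGE_of_mem ht))
    (B := fun t => m + t) (B' := fun _ => 1) (by simpa using hm)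
    (fun t => (hasDerivAt_id t).const_add m) (fun t ht heq => by
      have hx := hcW (Ico_subset_Icc_self ht)
      have h1 := hu.norm_fderiv_hessian_ray_le hV hF hW hWV hWK hB hx
      rw [norm_smul, Real.norm_eq_abs]
      refine lt_of_le_of_lt (mul_le_mul_of_nonneg_left (h1.trans ?_) (abs_nonneg ℓ)) hℓ
      exact mul_le_mul_of_nonneg_left
        (pow_le_pow_left₀ (by positivity) (by rw [heq]; linarith [ht.2]) 2) hB0) ht
  refine key.trans ?_
  linarith [ht.2]

/-- Along a short characteristic, the gradient of a first integral stays close to its initial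
value. -/
theorem IsEikonal.norm_gradient_sub_le (hV : IsOpen V) (hF : IsFinsler V F)
    (hW : IsOpen W) (hWV : W ⊆ V) (hWK : W ⊆ K) (hB : HamiltonianBounds F K B κ)
    (hu : IsEikonal F W u)
    (hc : ∀ t ∈ Icc (0 : ℝ) 1, HasDerivWithinAt c (ℓ • ray F u (c t)) (Icc 0 1) t)
    (hcW : MapsTo c (Icc 0 1) W) {m : ℝ} (hm : ‖fderiv ℝ (gradient u) (c 0)‖ ≤ m)
    (hℓ : |ℓ| * (B * (2 + m) ^ 2) < 1) (hℓ' : |ℓ| * (B * (2 + m)) * 3 < 1)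
    {ψ : Sp d → ℝ} (hψ : ∀ x ∈ W, ContDiffAt ℝ ∞ ψ x)
    (hψr : ∀ x ∈ W, inner ℝ (ray F u x) (gradient ψ x) = 0) {t : ℝ} (ht : t ∈ Icc (0 : ℝ) 1) :
    ‖gradient ψ (c t) - gradient ψ (c 0)‖ ≤ 1 / 2 * ‖gradient ψ (c 0)‖ := by
  have hm0 : 0 ≤ m := (norm_nonneg _).trans hm
  have hB0 : 0 ≤ B := by linarith [hB.one_le]
  -- Differentiating `⟨ray, ∇ψ⟩ = 0` shows that `∇ψ` is transported by minus the transpose of the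
  -- derivative of `ray`. Testing against the vector `z` itself gives the norm bound.
  have hray : ∀ x ∈ W, ‖fderiv ℝ (gradient ψ) x (ray F u x)‖
      ≤ B * (1 + ‖fderiv ℝ (gradient u) x‖) * ‖gradient ψ x‖ := by
    intro x hx
    set z := fderiv ℝ (gradient ψ) x (ray F u x) with hz
    have h1 := (hu.contDiffAt_ray hV hF hWV hW hx).differentiableAt_infty.hasFDerivAt.inner ℝ
      (contDiffAt_gradient (hψ x hx)).differentiableAt_infty.hasFDerivAt
    have h2 : (fun x => inner ℝ (ray F u x) (gradient ψ x)) =ᶠ[𝓝 x] fun _ => 0 := by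
      filter_upwards [hW.mem_nhds hx] with y hy using hψr y hy
    have h3 := congrArg (fun g => g z)
      (h1.unique ((hasFDerivAt_const (0 : ℝ) x).congr_of_eventuallyEq h2))
    have h4 : inner ℝ (ray F u x) (fderiv ℝ (gradient ψ) x z)
        + inner ℝ (fderiv ℝ (ray F u) x z) (gradient ψ x) = 0 := by simpa using h3
    rw [← inner_fderiv_gradient_comm (hψ x hx), ← hz, real_inner_self_eq_norm_sq] at h4
    have h5 : |inner ℝ (fderiv ℝ (ray F u) x z) (gradient ψ x)|
        ≤ B * (1 + ‖fderiv ℝ (gradient u) x‖) * ‖z‖ * ‖gradient ψ x‖ :=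
      (abs_real_inner_le_norm _ _).trans (mul_le_mul_of_nonneg_right
        (hu.norm_fderiv_ray_le hV hF hW hWV hWK hB hx z) (norm_nonneg _))
    have h6 : ‖z‖ ^ 2 ≤ B * (1 + ‖fderiv ℝ (gradient u) x‖) * ‖z‖ * ‖gradient ψ x‖ := by
      have := neg_abs_le (inner ℝ (fderiv ℝ (ray F u) x z) (gradient ψ x))
      linarith
    rcases (norm_nonneg z).eq_or_lt with h7 | h7
    · rw [← h7]; positivity
    · exact le_of_mul_le_mul_left (by nlinarith) h7
  have hd : ∀ t ∈ Icc (0 : ℝ) 1, HasDerivWithinAt (fun t => gradient ψ (c t) - gradient ψ (c 0))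
      (ℓ • fderiv ℝ (gradient ψ) (c t) (ray F u (c t))) (Icc 0 1) t := by
    intro t ht
    rw [← map_smul]
    exact ((contDiffAt_gradient
      (hψ _ (hcW ht))).differentiableAt_infty.hasFDerivAt.comp_hasDerivWithinAt
        t (hc t ht)).sub_const _
  set q₀ := ‖gradient ψ (c 0)‖ with hq₀
  -- The barrier `q₀ t / 2` requires a strict inequality, impossible for `q₀ = 0`; that case is
  -- linear uniqueness.
  rcases (norm_nonneg (gradient ψ (c 0))).eq_or_lt with h0 | h0
  · have h1 : ∀ t ∈ Icc (0 : ℝ) 1, ‖ℓ • fderiv ℝ (gradient ψ) (c t) (ray F u (c t))‖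
        ≤ |ℓ| * (B * (2 + m)) * ‖gradient ψ (c t) - gradient ψ (c 0)‖ := by
      intro t ht
      have h2 := hray _ (hcW ht)
      have h3 := hu.norm_hessian_le_along hV hF hW hWV hWK hB hc hcW hm hℓ ht
      rw [norm_smul, Real.norm_eq_abs, mul_assoc, norm_eq_zero.1 h0.symm, sub_zero]
      refine mul_le_mul_of_nonneg_left (h2.trans ?_) (abs_nonneg _)
      exact mul_le_mul_of_nonneg_right (mul_le_mul_of_nonneg_left (by linarith) hB0) (norm_nonneg _)
    have h2 := eq_zero_of_norm_deriv_le (by simp : (0 : ℝ) ∈ Icc (0 : ℝ) 1) hd h1 (sub_self _) ht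
    rw [h2, norm_zero]; positivity
  · have key := image_norm_le_of_norm_deriv_right_lt_deriv_boundary
      (fun t ht => (hd t ht).continuousWithinAt)
      (fun t ht => (hd t (Ico_subset_Icc_self ht)).mono_of_mem_nhdsWithin
        (Icc_mem_nhdsGE_of_mem ht))
      (B := fun t => 1 / 2 * q₀ * t) (B' := fun _ => 1 / 2 * q₀) (by simp)
      (fun t => by simpa using (hasDerivAt_id t).const_mul (1 / 2 * q₀)) (fun t ht heq => by
        have ht' := Ico_subset_Icc_self ht
        have h2 := hray _ (hcW ht')
        have h3 := hu.norm_hessian_le_along hV hF hW hWV hWK hB hc hcW hm hℓ ht'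
        -- On contact the gradient is at most `3/2` of its initial size; this is where the factor
        -- `3` in `hℓ'` comes from.
        have h4 : ‖gradient ψ (c t)‖ ≤ 3 / 2 * q₀ := by
          have h5 := norm_le_norm_sub_add (gradient ψ (c t)) (gradient ψ (c 0))
          rw [heq] at h5
          nlinarith [ht.2]
        rw [norm_smul, Real.norm_eq_abs]
        calc |ℓ| * ‖fderiv ℝ (gradient ψ) (c t) (ray F u (c t))‖
            ≤ |ℓ| * (B * (2 + m) * (3 / 2 * q₀)) := by
              refine mul_le_mul_of_nonneg_left (h2.trans ?_) (abs_nonneg _)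
              exact mul_le_mul (mul_le_mul_of_nonneg_left (by linarith) hB0) h4 (norm_nonneg _)
                (by positivity)
          _ = |ℓ| * (B * (2 + m)) * 3 * (1 / 2 * q₀) := by ring
          _ < 1 * (1 / 2 * q₀) := by gcongr
          _ = 1 / 2 * q₀ := one_mul _) ht
    refine key.trans ?_
    nlinarith [ht.2]

end Riccati

/-! ### One-parameter families of eikonal solutions. -/

section Family

variable {V W K : Set (Sp d)} {J : Set ℝ} {F : Sp d → Sp d → ℝ} {G : Sp d × ℝ → ℝ} {B κ : ℝ}

/-- A smooth one-parameter family of solutions on `W` of the eikonal equation. -/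
structure IsEikonalFamily (F : Sp d → Sp d → ℝ) (W : Set (Sp d)) (J : Set ℝ)
    (G : Sp d × ℝ → ℝ) : Prop where
  smooth : ContDiffOn ℝ ∞ G (W ×ˢ J)
  dual_eq : ∀ x ∈ W, ∀ a ∈ J, dual F x (gradFst G (x, a)) = 1

/-- The derivative with respect to the parameter. -/
def paramDeriv {E : Type*} [NormedAddCommGroup E] [NormedSpace ℝ E] (f : Sp d × ℝ → E)
    (z : Sp d × ℝ) : E := fderiv ℝ f z (0, 1)

theorem contDiffAt_paramDeriv {E : Type*} [NormedAddCommGroup E] [NormedSpace ℝ E]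
    {f : Sp d × ℝ → E} {z : Sp d × ℝ} (h : ContDiffAt ℝ ∞ f z) :
    ContDiffAt ℝ ∞ (paramDeriv f) z :=
  h.fderiv_infty.clm_apply contDiffAt_const

theorem hasDerivAt_param {E : Type*} [NormedAddCommGroup E] [NormedSpace ℝ E]
    {f : Sp d × ℝ → E} {x : Sp d} {a : ℝ} (h : DifferentiableAt ℝ f (x, a)) :
    HasDerivAt (fun b => f (x, b)) (paramDeriv f (x, a)) a := by
  simpa [paramDeriv] using (hasFDerivAt_snd_slot h).hasDerivAt

namespace IsEikonalFamily

theorem contDiffAt (hG : IsEikonalFamily F W J G) (hW : IsOpen W) (hJ : IsOpen J) {x : Sp d}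
    {a : ℝ} (hx : x ∈ W) (ha : a ∈ J) : ContDiffAt ℝ ∞ G (x, a) :=
  hG.smooth.contDiffAt ((hW.prod hJ).mem_nhds ⟨hx, ha⟩)

theorem gradient_eq (hG : IsEikonalFamily F W J G) (hW : IsOpen W) (hJ : IsOpen J) {x : Sp d}
    {a : ℝ} (hx : x ∈ W) (ha : a ∈ J) :
    gradient (fun x => G (x, a)) x = gradFst G (x, a) :=
  gradient_fst_slot (hG.contDiffAt hW hJ hx ha).differentiableAt_infty

theorem isEikonal (hG : IsEikonalFamily F W J G) (hW : IsOpen W) (hJ : IsOpen J) {a : ℝ}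
    (ha : a ∈ J) : IsEikonal F W fun x => G (x, a) where
  smooth := fun x hx => ((hG.contDiffAt hW hJ hx ha).comp x
    (contDiffAt_id.prodMk contDiffAt_const)).contDiffWithinAt
  dual_eq := fun x hx => by rw [hG.gradient_eq hW hJ hx ha]; exact hG.dual_eq x hx a ha

/-- The parameter derivative of `H(x, ∇G) = 1/2`. It says that the parameter derivative of `G` is a
first integral of the characteristics. -/
theorem inner_colegendre_paramDeriv (hV : IsOpen V) (hF : IsFinsler V F) (hW : IsOpen W)
    (hWV : W ⊆ V) (hJ : IsOpen J) (hG : IsEikonalFamily F W J G) {x : Sp d} {a : ℝ} (hx : x ∈ W)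
    (ha : a ∈ J) :
    inner ℝ (colegendre F (x, gradFst G (x, a))) (paramDeriv (gradFst G) (x, a)) = 0 := by
  have hne := ne_zero_of_dual_eq_one (hG.dual_eq x hx a ha)
  have h1 := (hF.contDiffAt_ham hV (hWV hx) hne).differentiableAt_infty.hasFDerivAt.comp (x, a)
    (hasFDerivAt_fst.prodMk (contDiffAt_gradFst
      (hG.contDiffAt hW hJ hx ha)).differentiableAt_infty.hasFDerivAt)
  have h2 : (ham F ∘ fun z : Sp d × ℝ => (z.1, gradFst G z)) =ᶠ[𝓝 (x, a)] fun _ => 1 / 2 := by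
    filter_upwards [(hW.prod hJ).mem_nhds ⟨hx, ha⟩] with z hz
    simp only [Function.comp_apply]
    rw [hF.ham_eq hV (hWV hz.1) (ne_zero_of_dual_eq_one (hG.dual_eq _ hz.1 _ hz.2)),
      hG.dual_eq _ hz.1 _ hz.2]
    norm_num
  have h3 := congrArg (fun g => g (0, 1))
    (h1.unique ((hasFDerivAt_const (1 / 2 : ℝ) (x, a)).congr_of_eventuallyEq h2))
  simp only [ContinuousLinearMap.comp_apply, ContinuousLinearMap.prod_apply,
    ContinuousLinearMap.coe_fst', zero_apply] at h3
  rw [hF.fderiv_ham hV (hWV hx) hne, inner_zero_right, sub_zero] at h3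
  exact h3

/-- Differentiating the first-integral identity once more: along a characteristic the second
parameter derivative decreases at the rate given by the positive covector Hessian of the
Hamiltonian. -/
theorem inner_colegendre_paramDeriv_two (hV : IsOpen V) (hF : IsFinsler V F) (hW : IsOpen W)
    (hWV : W ⊆ V) (hJ : IsOpen J) (hG : IsEikonalFamily F W J G) {x : Sp d} {a : ℝ} (hx : x ∈ W)
    (ha : a ∈ J) :
    inner ℝ (paramDeriv (paramDeriv (gradFst G)) (x, a)) (colegendre F (x, gradFst G (x, a)))
      = -inner ℝ (paramDeriv (gradFst G) (x, a)) (fderiv ℝ (colegendre F)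
          (x, gradFst G (x, a)) (0, paramDeriv (gradFst G) (x, a))) := by
  have hne := ne_zero_of_dual_eq_one (hG.dual_eq x hx a ha)
  have hg := contDiffAt_gradFst (hG.contDiffAt hW hJ hx ha)
  have h1 := (hF.contDiffAt_colegendre hV (hWV hx) hne).differentiableAt_infty.hasFDerivAt.comp
    (x, a) (hasFDerivAt_fst.prodMk hg.differentiableAt_infty.hasFDerivAt)
  have h2 := h1.inner ℝ (contDiffAt_paramDeriv hg).differentiableAt_infty.hasFDerivAt
  have h3 : (fun z : Sp d × ℝ => inner ℝ ((colegendre F ∘ fun z : Sp d × ℝ => (z.1, gradFst G z)) z)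
      (paramDeriv (gradFst G) z)) =ᶠ[𝓝 (x, a)] fun _ => 0 := by
    filter_upwards [(hW.prod hJ).mem_nhds ⟨hx, ha⟩] with z hz
    exact hG.inner_colegendre_paramDeriv hV hF hW hWV hJ hz.1 hz.2
  have h4 := congrArg (fun g => g (0, 1))
    (h2.unique ((hasFDerivAt_const (0 : ℝ) (x, a)).congr_of_eventuallyEq h3))
  simp only [ContinuousLinearMap.comp_apply, ContinuousLinearMap.prod_apply,
    ContinuousLinearMap.coe_fst', zero_apply, Function.comp_apply,
    fderivInnerCLM_apply] at h4
  rw [real_inner_comm, real_inner_comm (fderiv ℝ (colegendre F)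
    (x, gradFst G (x, a)) (0, paramDeriv (gradFst G) (x, a)))]
  exact eq_neg_of_add_eq_zero_left h4

theorem gradient_paramDeriv (hW : IsOpen W) (hJ : IsOpen J) (hG : IsEikonalFamily F W J G)
    {x : Sp d} {a : ℝ} (hx : x ∈ W) (ha : a ∈ J) :
    gradient (fun y => paramDeriv G (y, a)) x = paramDeriv (gradFst G) (x, a) := by
  have hg := hG.contDiffAt hW hJ hx ha
  refine ext_inner_right ℝ fun w => ?_
  rw [gradient_fst_slot (contDiffAt_paramDeriv hg).differentiableAt_infty, inner_gradFst,
    paramDeriv, inner_fderiv_gradFst hg]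
  change fderiv ℝ (fun z => fderiv ℝ G z (0, 1)) (x, a) (w, 0) = _
  rw [fderiv_clm_apply hg.fderiv_infty.differentiableAt_infty (differentiableAt_const _),
    fderiv_fderiv_comm hg]
  simp

theorem gradient_paramDeriv_two (hW : IsOpen W) (hJ : IsOpen J) (hG : IsEikonalFamily F W J G)
    {x : Sp d} {a : ℝ} (hx : x ∈ W) (ha : a ∈ J) :
    gradient (fun y => paramDeriv (paramDeriv G) (y, a)) x
      = paramDeriv (paramDeriv (gradFst G)) (x, a) := by
  have hg := hG.contDiffAt hW hJ hx ha
  have hg1 := contDiffAt_paramDeriv hg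
  have hg2 := contDiffAt_paramDeriv (contDiffAt_gradFst hg)
  refine ext_inner_right ℝ fun w => ?_
  rw [gradient_fst_slot (contDiffAt_paramDeriv hg1).differentiableAt_infty, inner_gradFst]
  change fderiv ℝ (fun z => fderiv ℝ (paramDeriv G) z (0, 1)) (x, a) (w, 0) = _
  rw [fderiv_apply_comm hg1]
  have h1 : (fun z => fderiv ℝ (paramDeriv G) z (w, 0)) =ᶠ[𝓝 (x, a)]
      fun z => inner ℝ (paramDeriv (gradFst G) z) w := by
    filter_upwards [(hW.prod hJ).mem_nhds ⟨hx, ha⟩] with z hz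
    rw [← hG.gradient_paramDeriv hW hJ hz.1 hz.2, gradient_fst_slot
      (contDiffAt_paramDeriv (hG.contDiffAt hW hJ hz.1 hz.2)).differentiableAt_infty,
      inner_gradFst]
  rw [h1.fderiv_eq, fderiv_inner_apply ℝ hg2.differentiableAt_infty (differentiableAt_const w)]
  simp [paramDeriv]

/-- The second derivative in the parameter of a family of eikonal solutions at the end point of a
short characteristic, when the family vanishes to second order at its initial point. -/
theorem exists_paramDeriv_two_eq (hV : IsOpen V) (hF : IsFinsler V F) (hW : IsOpen W)
    (hWV : W ⊆ V) (hWK : W ⊆ K) (hB : HamiltonianBounds F K B κ) (hJ : IsOpen J)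
    (hG : IsEikonalFamily F W J G) (h0 : (0 : ℝ) ∈ J) {c : ℝ → Sp d} {ℓ : ℝ}
    (hc : ∀ t ∈ Icc (0 : ℝ) 1,
      HasDerivWithinAt c (ℓ • ray F (fun x => G (x, 0)) (c t)) (Icc 0 1) t)
    (hcW : MapsTo c (Icc 0 1) W)
    (hvan : ∀ x ∈ W, inner ℝ (gradFst G (c 0, 0)) (x - c 0) = 0 → G (x, 0) = 0)
    (hbase : ∀ a ∈ J, G (c 0, a) = 0)
    (hℓ : |ℓ| * (B * (2 + B ^ 2 * (2 + B ^ 2)) ^ 2) * 3 < 1) :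
    ∃ m, κ / 4 * ‖paramDeriv (gradFst G) (c 0, 0)‖ ^ 2 ≤ m ∧
      paramDeriv (paramDeriv G) (c 1, 0) = -ℓ * m := by
  set u : Sp d → ℝ := fun x => G (x, 0) with hu_def
  have hu : IsEikonal F W u := hG.isEikonal hW hJ h0
  have hc0 : c 0 ∈ W := hcW (by simp)
  have hm := hu.norm_hessian_le_of_vanishing hV hF hW hWV hWK hB hc0 (by
    rw [hG.gradient_eq hW hJ hc0 h0]; exact hvan)
  set m := B ^ 2 * (2 + B ^ 2) with hm_def
  have hm0 : 0 ≤ m := by positivity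
  have hB1 := hB.one_le
  have hℓ1 : |ℓ| * (B * (2 + m) ^ 2) < 1 := by
    have : 0 ≤ |ℓ| * (B * (2 + m) ^ 2) := by positivity
    linarith
  have hℓ2 : |ℓ| * (B * (2 + m)) * 3 < 1 := by
    refine lt_of_le_of_lt ?_ hℓ
    gcongr
    nlinarith
  set ψ : Sp d → ℝ := fun y => paramDeriv G (y, 0) with hψ_def
  have hψ : ∀ x ∈ W, ContDiffAt ℝ ∞ ψ x := fun x hx =>
    (contDiffAt_paramDeriv (hG.contDiffAt hW hJ hx h0)).comp x
      (contDiffAt_id.prodMk contDiffAt_const)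
  have hgψ : ∀ x ∈ W, gradient ψ x = paramDeriv (gradFst G) (x, 0) := fun x hx =>
    hG.gradient_paramDeriv hW hJ hx h0
  have hray : ∀ x ∈ W, ray F u x = colegendre F (x, gradFst G (x, 0)) := fun x hx => by
    rw [ray, hG.gradient_eq hW hJ hx h0]
  -- The gradient keeps at least half its initial norm, whence the quarter of `κ`.
  have hq : ∀ t ∈ Icc (0 : ℝ) 1, κ / 4 * ‖gradient ψ (c 0)‖ ^ 2 ≤ κ * ‖gradient ψ (c t)‖ ^ 2 := by
    intro t ht
    have h1 := hu.norm_gradient_sub_le hV hF hW hWV hWK hB hc hcW hm hℓ1 hℓ2 hψ (fun x hx => by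
      rw [hray x hx, hgψ x hx]
      exact hG.inner_colegendre_paramDeriv hV hF hW hWV hJ hx h0) ht
    have h2 := norm_sub_norm_le (gradient ψ (c 0)) (gradient ψ (c t))
    rw [norm_sub_rev] at h2
    have h3 : 1 / 2 * ‖gradient ψ (c 0)‖ ≤ ‖gradient ψ (c t)‖ := by linarith
    have h4 := pow_le_pow_left₀ (by positivity) h3 2
    nlinarith [hB.kappa_pos]
  set T : Sp d → ℝ := fun y => paramDeriv (paramDeriv G) (y, 0) with hT_def
  have hTd : ∀ t ∈ Icc (0 : ℝ) 1, HasDerivWithinAt (fun t => T (c t))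
      (-ℓ * inner ℝ (gradient ψ (c t)) (fderiv ℝ (colegendre F) (c t, gradient u (c t))
        (0, gradient ψ (c t)))) (Icc 0 1) t := by
    intro t ht
    have hx := hcW ht
    have h1 := (contDiffAt_paramDeriv (contDiffAt_paramDeriv (hG.contDiffAt hW hJ hx h0)))
    have h2 : DifferentiableAt ℝ T (c t) :=
      (hasFDerivAt_fst_slot h1.differentiableAt_infty).differentiableAt
    have h3 := h2.hasFDerivAt.comp_hasDerivWithinAt t (hc t ht)
    rw [map_smul, ← inner_gradient, hG.gradient_paramDeriv_two hW hJ hx h0, hray _ hx,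
      hG.inner_colegendre_paramDeriv_two hV hF hW hWV hJ hx h0, smul_eq_mul] at h3
    rw [hgψ _ hx, hG.gradient_eq hW hJ hx h0, neg_mul, ← mul_neg]
    exact h3
  -- The mean value theorem replaces integration in time: `m` is the quadratic form at one
  -- intermediate time, and the sign of `ℓ` plays no role.
  obtain ⟨θ, hθ, hθ'⟩ := exists_hasDerivAt_eq_slope (fun t => T (c t)) _ (zero_lt_one' ℝ)
    (fun t ht => (hTd t ht).continuousWithinAt)
    (fun t ht => (hTd t (Ioo_subset_Icc_self ht)).hasDerivAt (Icc_mem_nhds ht.1 ht.2))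
  have hθI := Ioo_subset_Icc_self hθ
  have hT0 : T (c 0) = 0 := by
    have h1 : ∀ a ∈ J, paramDeriv G (c 0, a) = 0 := by
      intro a ha
      have h2 := hasDerivAt_param (hG.contDiffAt hW hJ hc0 ha).differentiableAt_infty
      have h3 : (fun b => G (c 0, b)) =ᶠ[𝓝 a] fun _ => 0 := by
        filter_upwards [hJ.mem_nhds ha] with b hb using hbase b hb
      exact h2.unique ((hasDerivAt_const a (0 : ℝ)).congr_of_eventuallyEq h3)
    have h2 := hasDerivAt_param
      (contDiffAt_paramDeriv (hG.contDiffAt hW hJ hc0 h0)).differentiableAt_infty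
    have h3 : (fun b => paramDeriv G (c 0, b)) =ᶠ[𝓝 0] fun _ => 0 := by
      filter_upwards [hJ.mem_nhds h0] with b hb using h1 b hb
    exact h2.unique ((hasDerivAt_const (0 : ℝ) (0 : ℝ)).congr_of_eventuallyEq h3)
  refine ⟨inner ℝ (gradient ψ (c θ)) (fderiv ℝ (colegendre F) (c θ, gradient u (c θ))
    (0, gradient ψ (c θ))), ?_, ?_⟩
  rotate_left
  · rw [hT0, sub_zero, sub_zero, div_one] at hθ'
    exact hθ'.symm
  · rw [← hgψ _ hc0]
    exact (hq θ hθI).trans (hB.coercive _ (hWK (hcW hθI)) _ (hu.dual_eq _ (hcW hθI)) _)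

end IsEikonalFamily

end Family

/-! ### Gradient control and descent of characteristics to the initial hyperplane. -/

section Descent

variable {V W K : Set (Sp d)} {F : Sp d → Sp d → ℝ} {u : Sp d → ℝ} {B κ : ℝ}

/-- A norm-like function whose sublevel sets are domains of dependence for the hyperplane through
`y` conormal to `ξ`. -/
def coneNorm (B : ℝ) (y ξ x : Sp d) : ℝ := ‖x - y‖ + 4 * B * |inner ℝ ξ (x - y)|

theorem continuous_coneNorm (B : ℝ) (y ξ : Sp d) : Continuous (coneNorm B y ξ) := by
  unfold coneNorm; fun_prop

theorem norm_sub_le_coneNorm (hB : 0 ≤ B) (y ξ x : Sp d) : ‖x - y‖ ≤ coneNorm B y ξ x :=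
  le_add_of_nonneg_right (by positivity)

/-- Picard–Lindelöf on a ball. The displacement rate `2 * B`, twice the bound on the speed, makes
the barrier inequality strict. -/
theorem exists_integral_curve {v : Sp d → Sp d} {x : Sp d} {a T : ℝ} (hB : 0 < B) (hT : 0 ≤ T)
    (ha : 0 ≤ a) (hTa : 2 * B * T ≤ a) (hv : ContDiffOn ℝ 1 v (Metric.closedBall x a))
    (hvB : ∀ z ∈ Metric.closedBall x a, ‖v z‖ ≤ B) :
    ∃ X : ℝ → Sp d, X 0 = x ∧ (∀ t ∈ Icc 0 T, HasDerivWithinAt X (v (X t)) (Icc 0 T) t) ∧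
      ∀ t ∈ Icc 0 T, ‖X t - x‖ ≤ 2 * B * t := by
  obtain ⟨k, hk⟩ := hv.exists_lipschitzOnWith (by simp) (convex_closedBall x a)
    (isCompact_closedBall x a)
  have hPL : IsPicardLindelof (fun _ => v) (⟨0, le_rfl, hT⟩ : Icc (0 : ℝ) T) x ⟨a, ha⟩ 0
      ⟨B, hB.le⟩ k := by
    refine IsPicardLindelof.of_time_independent hvB hk ?_
    simp only [sub_zero, sub_self, NNReal.coe_zero]
    rw [max_eq_left hT]
    change B * T ≤ a
    nlinarith
  obtain ⟨X, hX0, hX⟩ := hPL.exists_eq_forall_mem_Icc_hasDerivWithinAt₀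
  simp only at hX0
  refine ⟨X, hX0, hX, fun t ht => ?_⟩
  refine image_norm_le_of_norm_deriv_right_lt_deriv_boundary (f := fun t => X t - x)
    (f' := fun t => v (X t)) (B := fun t => 2 * B * t) (B' := fun _ => 2 * B)
    (fun t ht => ((hX t ht).sub_const x).continuousWithinAt)
    (fun t ht => ((hX t (Ico_subset_Icc_self ht)).sub_const x).mono_of_mem_nhdsWithin
      (Icc_mem_nhdsGE_of_mem ht)) (by simp [hX0])
    (fun t => by simpa using (hasDerivAt_id t).const_mul (2 * B)) (fun t ht heq => ?_) ht
  have hmem : X t ∈ Metric.closedBall x a := by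
    rw [mem_closedBall_iff_norm, heq]
    nlinarith [ht.2]
  linarith [hvB _ hmem]

/-- Where the gradient of `u` is close to `ξ`, the characteristic through `x` meets the hyperplane
through `y` conormal to `ξ`. -/
theorem IsEikonal.exists_characteristic (hV : IsOpen V) (hF : IsFinsler V F) (hW : IsOpen W)
    (hWV : W ⊆ V) (hWK : W ⊆ K) (hB : HamiltonianBounds F K B κ) (hu : IsEikonal F W u)
    {x y ξ : Sp d} {n₀ : ℝ} (hball : Metric.closedBall y (2 * n₀) ⊆ W)
    (hx : coneNorm B y ξ x ≤ n₀)
    (hclose : ∀ z, coneNorm B y ξ z ≤ coneNorm B y ξ x → ‖gradient u z - ξ‖ ≤ 1 / (4 * B)) :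
    ∃ (τ : ℝ) (X : ℝ → Sp d),
      (∀ t ∈ Icc (0 : ℝ) 1, HasDerivWithinAt X (τ • ray F u (X t)) (Icc 0 1) t) ∧
      MapsTo X (Icc 0 1) W ∧ inner ℝ ξ (X 0 - y) = 0 ∧
      coneNorm B y ξ (X 0) ≤ coneNorm B y ξ x ∧ X 1 = x ∧ |τ| ≤ 2 * |inner ℝ ξ (x - y)| := by
  have hB1 := hB.one_le
  have hB0 : 0 < B := by linarith
  have hxy := norm_sub_le_coneNorm hB0.le y ξ x
  have hn₀ : 0 ≤ n₀ := (norm_nonneg _).trans (hxy.trans hx)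
  set η := inner ℝ ξ (x - y) with hη
  have hηn : 4 * B * |η| ≤ n₀ := by
    have : ‖x - y‖ + 4 * B * |η| ≤ n₀ := hx
    linarith [norm_nonneg (x - y)]
  have hsub : Metric.closedBall x n₀ ⊆ W := by
    refine Subset.trans (fun z hz => ?_) hball
    rw [mem_closedBall_iff_norm] at hz ⊢
    have := norm_sub_le_norm_sub_add_norm_sub z x y
    linarith
  -- `s` records the side of the hyperplane on which `x` lies; the flow of `-s • ray` then heads
  -- towards the hyperplane.
  obtain ⟨s, hs, hsη⟩ : ∃ s : ℝ, (s = 1 ∨ s = -1) ∧ s * η = |η| := by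
    rcases le_total 0 η with h | h
    · exact ⟨1, Or.inl rfl, by rw [abs_of_nonneg h, one_mul]⟩
    · exact ⟨-1, Or.inr rfl, by rw [abs_of_nonpos h, neg_one_mul]⟩
  have hss : s * s = 1 := by rcases hs with rfl | rfl <;> norm_num
  have hsabs : |s| = 1 := by rcases hs with rfl | rfl <;> norm_num
  have hrayB : ∀ z ∈ W, ‖ray F u z‖ ≤ B := fun z hz =>
    hB.norm_colegendre z (hWK hz) _ (hu.dual_eq z hz)
  obtain ⟨Y, hY0, hY, hYn⟩ := exists_integral_curve (v := fun z => (-s) • ray F u z) (x := x)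
    (a := n₀) (T := 2 * |η|) hB0 (by positivity) hn₀ (by linarith)
    (fun z hz => (((hu.contDiffAt_ray hV hF hWV hW (hsub hz)).of_le
      (WithTop.coe_le_coe.2 (le_top : (1 : ℕ∞) ≤ ⊤))).const_smul (-s)).contDiffWithinAt)
    (fun z hz => by
      rw [norm_smul, norm_neg, Real.norm_eq_abs, hsabs, one_mul]; exact hrayB z (hsub hz))
  have hYW : ∀ t ∈ Icc 0 (2 * |η|), Y t ∈ W := fun t ht => hsub (by
    rw [mem_closedBall_iff_norm]
    refine (hYn t ht).trans ?_
    nlinarith [ht.2])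
  have hYy : ∀ t ∈ Icc 0 (2 * |η|), ‖Y t - y‖ ≤ ‖x - y‖ + 2 * B * t := fun t ht => by
    have := norm_sub_le_norm_sub_add_norm_sub (Y t) x y
    linarith [hYn t ht]
  have hk : ∀ t ∈ Icc 0 (2 * |η|), HasDerivWithinAt (fun t => s * inner ℝ ξ (Y t - y))
      (-inner ℝ ξ (ray F u (Y t))) (Icc 0 (2 * |η|)) t := by
    intro t ht
    have h1 := (((hasDerivWithinAt_const t (Icc 0 (2 * |η|)) ξ).inner ℝ
      ((hY t ht).sub_const y)).const_mul s)
    rw [inner_zero_left, add_zero, inner_smul_right, ← mul_assoc, mul_neg, hss, neg_one_mul] at h1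
    exact h1
  -- The height falls below the barrier `|η| - t / 2`, so the hyperplane is met by time `2|η|`. On
  -- contact, displacement at most `2 B t` and descent `t / 2` balance exactly under the weight `4 *
  -- B` of `coneNorm`, so the curve is still in the sublevel set of `x`; there `⟨ξ, ray⟩ ≥ 3/4 >
  -- 1/2`.
  have hkle := image_le_of_deriv_right_lt_deriv_boundary
    (fun t ht => (hk t ht).continuousWithinAt)
    (fun t ht => (hk t (Ico_subset_Icc_self ht)).mono_of_mem_nhdsWithin
      (Icc_mem_nhdsGE_of_mem ht))
    (B := fun t => |η| - t / 2) (B' := fun _ => -(1 / 2)) (by simp [hY0, ← hη, hsη])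
    (fun t => by simpa using ((hasDerivAt_id t).div_const 2).const_sub |η|)
    (fun t ht heq => by
      have ht' := Ico_subset_Icc_self ht
      have hz := hYW t ht'
      have hb : 0 ≤ |η| - t / 2 := by linarith [ht.2]
      have hh : |inner ℝ ξ (Y t - y)| = |η| - t / 2 := by
        rw [← abs_of_nonneg hb, ← heq, abs_mul, hsabs, one_mul]
      have h1 : ‖gradient u (Y t) - ξ‖ ≤ 1 / (4 * B) := by
        refine hclose _ ?_
        rw [coneNorm, coneNorm, hh, ← hη]
        have := hYy t ht'
        nlinarith
      have h2 := hu.inner_gradient_ray hV hF hWV hz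
      have h3 : inner ℝ (gradient u (Y t) - ξ) (ray F u (Y t)) ≤ 1 / (4 * B) * B :=
        (real_inner_le_norm _ _).trans (mul_le_mul h1 (hrayB _ hz) (norm_nonneg _) (by positivity))
      have h4 : 1 / (4 * B) * B = 1 / 4 := by field_simp
      rw [inner_sub_left, h2, h4] at h3
      linarith)
  obtain ⟨t₁, ht₁, hkt₁⟩ : ∃ t₁ ∈ Icc 0 (2 * |η|), s * inner ℝ ξ (Y t₁ - y) = 0 := by
    have h1 := hkle (right_mem_Icc.2 (by positivity : (0 : ℝ) ≤ 2 * |η|))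
    have h2 := intermediate_value_Icc' (by positivity : (0 : ℝ) ≤ 2 * |η|)
      (fun t ht => (hk t ht).continuousWithinAt)
    obtain ⟨t₁, ht₁, h3⟩ := h2 (show (0 : ℝ) ∈ Icc _ _ from
      ⟨h1.trans (by linarith), by simp [hY0, ← hη, hsη]⟩)
    exact ⟨t₁, ht₁, h3⟩
  have hmem : ∀ t ∈ Icc (0 : ℝ) 1, t₁ * (1 - t) ∈ Icc 0 (2 * |η|) := fun t ht =>
    ⟨mul_nonneg ht₁.1 (by linarith [ht.2]),
      (mul_le_of_le_one_right ht₁.1 (by linarith [ht.1])).trans ht₁.2⟩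
  have hplane : inner ℝ ξ (Y t₁ - y) = 0 := by
    have : s ≠ 0 := by rintro rfl; simp at hss
    exact (mul_eq_zero.1 hkt₁).resolve_left this
  -- Reversed and rescaled to the unit interval, the curve starts on the hyperplane and ends at `x`.
  refine ⟨s * t₁, fun t => Y (t₁ * (1 - t)), fun t ht => ?_, fun t ht => hYW _ (hmem t ht), ?_, ?_,
    ?_, ?_⟩
  · have h1 : HasDerivWithinAt (fun t => t₁ * (1 - t)) (-t₁) (Icc 0 1) t := by
      simpa using (((hasDerivWithinAt_id t (Icc (0 : ℝ) 1)).const_sub 1).const_mul t₁)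
    have h2 := (hY _ (hmem t ht)).scomp t h1 hmem
    rw [smul_smul, neg_mul_neg, mul_comm] at h2
    exact h2
  · simpa using hplane
  · simp only [sub_zero, mul_one]
    rw [coneNorm, hplane, abs_zero, mul_zero, add_zero, coneNorm, ← hη]
    have h1 := hYy t₁ ht₁
    nlinarith [ht₁.2]
  · simp [hY0]
  · rw [abs_mul, hsabs, one_mul, abs_of_nonneg ht₁.1]; exact ht₁.2

/-- On the hyperplane where it vanishes, an eikonal solution has gradient proportional to the
conormal. -/
theorem IsEikonal.exists_gradient_eq_smul (hW : IsOpen W) (hu : IsEikonal F W u) {x y ξ : Sp d}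
    (hx : x ∈ W) (hξ : ξ ≠ 0) (hvan : ∀ x ∈ W, inner ℝ ξ (x - y) = 0 → u x = 0)
    (hxy : inner ℝ ξ (x - y) = 0) : ∃ b : ℝ, gradient u x = b • ξ := by
  set p := gradient u x with hp
  have hn : inner ℝ ξ ξ ≠ 0 := by simpa using hξ
  set b := inner ℝ ξ p / inner ℝ ξ ξ with hb
  have h1 : inner ℝ ξ (p - b • ξ) = 0 := by
    rw [inner_sub_right, inner_smul_right, hb, div_mul_cancel₀ _ hn, sub_self]
  have h2 := inner_gradient_eq_zero_of_vanishing hW hx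
    (hu.contDiffAt hW hx).differentiableAt_infty hvan hxy h1
  refine ⟨b, sub_eq_zero.1 ?_⟩
  have h3 : inner ℝ (p - b • ξ) (p - b • ξ) = 0 := by
    rw [inner_sub_left, ← hp.symm, real_inner_smul_left, h1, mul_zero, sub_zero]
    exact h2
  simpa using h3

/-- On the hyperplane `∇u = b ξ`; closeness to `ξ` excludes `b ≤ 0`, and then the equation fixes `b
F_*(x, ξ) = 1`, so `∇u - ξ = (1 - F_*(x, ξ)) ∇u`. -/
theorem IsEikonal.norm_gradient_sub_le_on_plane (hV : IsOpen V) (hF : IsFinsler V F)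
    (hW : IsOpen W) (hWV : W ⊆ V) (hWK : W ⊆ K) (hB : HamiltonianBounds F K B κ)
    (hu : IsEikonal F W u) {x y ξ : Sp d} (hx : x ∈ W) (hξ : 1 / B ≤ ‖ξ‖)
    (hvan : ∀ x ∈ W, inner ℝ ξ (x - y) = 0 → u x = 0) (hxy : inner ℝ ξ (x - y) = 0)
    (hclose : ‖gradient u x - ξ‖ ≤ 1 / (4 * B)) :
    ‖gradient u x - ξ‖ ≤ |1 - dual F x ξ| * B := by
  have hB1 := hB.one_le
  have hBp : 0 < 1 / B := by positivity
  have hξ0 : ξ ≠ 0 := norm_pos_iff.1 (hBp.trans_le hξ)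
  obtain ⟨b, hb⟩ := hu.exists_gradient_eq_smul hW hx hξ0 hvan hxy
  have hbpos : 0 < b := by
    by_contra h
    push Not at h
    rw [hb, ← neg_sub, norm_neg, show ξ - b • ξ = (1 - b) • ξ by module, norm_smul,
      Real.norm_of_nonneg (by linarith), show 1 / (4 * B) = 1 / B / 4 by field_simp] at hclose
    nlinarith
  have hd := hu.dual_eq x hx
  have h1 : gradient u x - ξ = (1 - dual F x ξ) • gradient u x := by
    rw [hb, hF.dual_smul hV (hWV hx) hξ0 hbpos] at hd
    rw [hb, smul_smul, sub_mul, mul_comm (dual F x ξ), hd]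
    module
  rw [h1, norm_smul, Real.norm_eq_abs]
  exact mul_le_mul_of_nonneg_left (hB.norm_covector x (hWK hx) _ (hu.dual_eq x hx)) (abs_nonneg _)

/-- First-failure argument. Let `x'` minimize `coneNorm` among the points where the deviation
reaches `1 / (4B)`. The estimate holds on the sublevel set of `x'`, so a characteristic descends
from `x'` to the hyperplane. The deviation at its foot is at most a quarter of `1 / (4B)`, and by
the bound on `force` it grows by at most half of it on the way to `x'`: a contradiction. -/
theorem IsEikonal.norm_gradient_sub_le_of_coneNorm_le (hV : IsOpen V) (hF : IsFinsler V F)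
    (hW : IsOpen W) (hWV : W ⊆ V) (hWK : W ⊆ K) (hB : HamiltonianBounds F K B κ)
    (hu : IsEikonal F W u) {y ξ : Sp d} {n₀ : ℝ} (hn₀ : 0 ≤ n₀)
    (hball : Metric.closedBall y (2 * n₀) ⊆ W) (hξy : gradient u y = ξ)
    (hvan : ∀ x ∈ W, inner ℝ ξ (x - y) = 0 → u x = 0) (hn₀B : n₀ ≤ 1 / (4 * B))
    (hdual : ∀ z ∈ Metric.closedBall y n₀, |1 - dual F z ξ| ≤ 1 / (16 * B ^ 2)) {x : Sp d}
    (hx : coneNorm B y ξ x ≤ n₀) : ‖gradient u x - ξ‖ ≤ 1 / (4 * B) := by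
  have hB1 := hB.one_le
  have hB0 : 0 < B := by linarith
  have hyW : y ∈ W := hball (Metric.mem_closedBall_self (by positivity))
  have hmem : ∀ z, coneNorm B y ξ z ≤ n₀ → z ∈ Metric.closedBall y n₀ := fun z hz => by
    rw [mem_closedBall_iff_norm]; exact (norm_sub_le_coneNorm hB0.le y ξ z).trans hz
  have hballW : Metric.closedBall y n₀ ⊆ W :=
    (Metric.closedBall_subset_closedBall (by linarith)).trans hball
  have hcont : ∀ z ∈ W, ContinuousAt (fun z => ‖gradient u z - ξ‖) z := fun z hz =>
    ((contDiffAt_gradient (hu.contDiffAt hW hz)).continuousAt.sub continuousAt_const).norm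
  have hξ : 1 / B ≤ ‖ξ‖ := by
    have h1 := hu.inner_gradient_ray hV hF hWV hyW
    have h2 := real_inner_le_norm (gradient u y) (ray F u y)
    have h3 := hB.norm_colegendre y (hWK hyW) _ (hu.dual_eq y hyW)
    rw [h1, hξy] at h2
    rw [div_le_iff₀ hB0]
    exact h2.trans (mul_le_mul_of_nonneg_left h3 (norm_nonneg _))
  by_contra hbad
  push Not at hbad
  set S := Metric.closedBall y n₀ ∩ {z | 1 / (4 * B) ≤ ‖gradient u z - ξ‖} with hS
  have hScpt : IsCompact S := by
    refine (isCompact_closedBall y n₀).of_isClosed_subset ?_ inter_subset_left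
    have h1 : ContinuousOn (fun z => ‖gradient u z - ξ‖) (Metric.closedBall y n₀) := fun z hz =>
      (hcont z (hballW hz)).continuousWithinAt
    exact h1.preimage_isClosed_of_isClosed Metric.isClosed_closedBall isClosed_Ici
  obtain ⟨x', hx'S, hmin⟩ := hScpt.exists_isMinOn ⟨x, hmem x hx, hbad.le⟩
    (continuous_coneNorm B y ξ).continuousOn
  have hx'n : coneNorm B y ξ x' ≤ n₀ :=
    (hmin (show x ∈ S from ⟨hmem x hx, hbad.le⟩)).trans hx
  have hlt : ∀ z, coneNorm B y ξ z < coneNorm B y ξ x' → ‖gradient u z - ξ‖ < 1 / (4 * B) := by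
    intro z hz
    by_contra h
    push Not at h
    exact absurd (hmin (show z ∈ S from ⟨hmem z (hz.le.trans hx'n), h⟩)) (not_le.2 hz)
  have hpos : 0 < coneNorm B y ξ x' := by
    refine lt_of_lt_of_le (norm_pos_iff.2 fun h => ?_) (norm_sub_le_coneNorm hB0.le y ξ x')
    have h1 := hx'S.2
    rw [mem_ofPred_eq, sub_eq_zero.1 h, hξy, sub_self, norm_zero] at h1
    have : 0 < 1 / (4 * B) := by positivity
    linarith
  -- Minimality controls only the open sublevel set; the boundary is reached as a limit along the
  -- ray from `y`, on which `coneNorm` scales linearly.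
  have hle : ∀ z, coneNorm B y ξ z ≤ coneNorm B y ξ x' → ‖gradient u z - ξ‖ ≤ 1 / (4 * B) := by
    intro z hz
    have hzW : z ∈ W := hballW (hmem z (hz.trans hx'n))
    have h1 : ContinuousAt (fun s : ℝ => ‖gradient u (y + s • (z - y)) - ξ‖) 1 := by
      refine ContinuousAt.comp_of_eq (g := fun z => ‖gradient u z - ξ‖) (hcont z hzW) (by fun_prop)
        (by simp)
    have h2 : Tendsto (fun s : ℝ => ‖gradient u (y + s • (z - y)) - ξ‖) (𝓝[Ioo 0 1] 1)
        (𝓝 ‖gradient u z - ξ‖) := by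
      have := h1.tendsto.mono_left (nhdsWithin_le_nhds (s := Ioo (0 : ℝ) 1))
      simpa using this
    have : (𝓝[Ioo (0 : ℝ) 1] 1).NeBot := by
      rw [← mem_closure_iff_nhdsWithin_neBot, closure_Ioo zero_ne_one]; simp
    refine le_of_tendsto h2 ?_
    filter_upwards [self_mem_nhdsWithin] with s hs
    refine (hlt _ ?_).le
    have h3 : coneNorm B y ξ (y + s • (z - y)) = s * coneNorm B y ξ z := by
      rw [coneNorm, coneNorm, add_sub_cancel_left, norm_smul, inner_smul_right, abs_mul,
        Real.norm_eq_abs, abs_of_pos hs.1]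
      ring
    rw [h3]
    nlinarith [hs.1, hs.2]
  obtain ⟨τ, X, hX, hXW, hX0, hX0n, hX1, hτ⟩ :=
    hu.exists_characteristic hV hF hW hWV hWK hB hball hx'n hle
  have h0 : (0 : ℝ) ∈ Icc (0 : ℝ) 1 := by simp
  have h1 := hu.norm_gradient_sub_le_on_plane hV hF hW hWV hWK hB (hXW h0) hξ hvan hX0
    (hle _ hX0n)
  have h2 := hdual _ (hmem _ (hX0n.trans hx'n))
  have h3 : ∀ t ∈ Icc (0 : ℝ) 1, HasDerivWithinAt (fun t => gradient u (X t))
      (τ • force F (X t, gradient u (X t))) (Icc 0 1) t := by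
    intro t ht
    rw [← hu.fderiv_gradient_ray hV hF hWV hW (hXW ht), ← map_smul]
    exact (contDiffAt_gradient
      (hu.contDiffAt hW (hXW ht))).differentiableAt_infty.hasFDerivAt.comp_hasDerivWithinAt t
        (hX t ht)
  have h4 := norm_image_sub_le_of_norm_deriv_le_segment_01' h3 (C := |τ| * B) (fun t ht => by
    rw [norm_smul, Real.norm_eq_abs]
    exact mul_le_mul_of_nonneg_left (hB.norm_force _ (hWK (hXW (Ico_subset_Icc_self ht))) _
      (hu.dual_eq _ (hXW (Ico_subset_Icc_self ht)))) (abs_nonneg _))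
  rw [hX1] at h4
  have h5 := norm_sub_le_norm_sub_add_norm_sub (gradient u x') (gradient u (X 0)) ξ
  have h6 : 1 / (4 * B) ≤ ‖gradient u x' - ξ‖ := hx'S.2
  have h7 : 4 * B * |inner ℝ ξ (x' - y)| ≤ n₀ := by
    have : ‖x' - y‖ + 4 * B * |inner ℝ ξ (x' - y)| ≤ n₀ := hx'n
    linarith [norm_nonneg (x' - y)]
  have h8 : |τ| * B ≤ n₀ / 2 := by nlinarith
  have h9 : |1 - dual F (X 0) ξ| * B ≤ 1 / (4 * B) / 4 :=
    (mul_le_mul_of_nonneg_right h2 hB0.le).trans_eq (by field_simp; norm_num)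
  have : 0 < 1 / (4 * B) := by positivity
  linarith

end Descent

/-! ### Curves, critical points and Hessians on the cosphere. -/

section Cosphere

variable {V : Set (Sp d)} {F : Sp d → Sp d → ℝ}

theorem IsFinsler.contDiffAt_dual_snd (hV : IsOpen V) (hF : IsFinsler V F) {y ξ : Sp d}
    (hy : y ∈ V) (hξ : ξ ≠ 0) : ContDiffAt ℝ ∞ (dual F y) ξ :=
  (hF.contDiffAt_dual hV hy hξ).comp ξ (contDiffAt_const.prodMk contDiffAt_id)

theorem IsFinsler.fderiv_dual (hV : IsOpen V) (hF : IsFinsler V F) {y ξ : Sp d}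
    (hy : y ∈ V) (hξ : dual F y ξ = 1) (w : Sp d) :
    fderiv ℝ (dual F y) ξ w = inner ℝ (colegendre F (y, ξ)) w := by
  have hξ0 := ne_zero_of_dual_eq_one hξ
  have h1 := ((hF.contDiffAt_dual_snd hV hy hξ0).differentiableAt_infty.hasFDerivAt.pow 2).const_mul
    (1 / 2 : ℝ)
  have h2 := hasFDerivAt_snd_slot (hF.contDiffAt_ham hV hy hξ0).differentiableAt_infty
  have h3 : (fun η => ham F (y, η)) =ᶠ[𝓝 ξ] fun η => 1 / 2 * dual F y η ^ 2 := by
    filter_upwards [isOpen_compl_singleton.mem_nhds hξ0] with η hη using hF.ham_eq hV hy hη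
  have h4 := congrArg (fun g => g w) (h2.unique (h1.congr_of_eventuallyEq h3))
  have h5 : fderiv ℝ (ham F) (y, ξ) (0, w) = fderiv ℝ (dual F y) ξ w := by
    simpa [hξ] using h4
  rw [← h5, hF.fderiv_ham hV hy hξ0, inner_zero_right, sub_zero]

/-- The curve in the cosphere obtained by radial projection of a line. -/
def radialCurve (F : Sp d → Sp d → ℝ) (y ξ ζ : Sp d) (a : ℝ) : Sp d :=
  (dual F y (ξ + a • ζ))⁻¹ • (ξ + a • ζ)

theorem isOpen_line_ne_zero (ξ ζ : Sp d) : IsOpen {a : ℝ | ξ + a • ζ ≠ 0} :=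
  isOpen_ne_fun (by fun_prop) continuous_const

theorem IsFinsler.dual_radialCurve (hV : IsOpen V) (hF : IsFinsler V F) {y ξ ζ : Sp d}
    (hy : y ∈ V) {a : ℝ} (ha : ξ + a • ζ ≠ 0) : dual F y (radialCurve F y ξ ζ a) = 1 := by
  have h := hF.dual_pos hV hy ha
  rw [radialCurve, hF.dual_smul hV hy ha (inv_pos.2 h), inv_mul_cancel₀ h.ne']

theorem IsFinsler.contDiffAt_radialCurve (hV : IsOpen V) (hF : IsFinsler V F) {y ξ ζ : Sp d}
    (hy : y ∈ V) {a : ℝ} (ha : ξ + a • ζ ≠ 0) : ContDiffAt ℝ ∞ (radialCurve F y ξ ζ) a := by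
  have h1 : ContDiffAt ℝ ∞ (fun a : ℝ => ξ + a • ζ) a := by fun_prop
  have h2 : ContDiffAt ℝ ∞ (fun a : ℝ => dual F y (ξ + a • ζ)) a :=
    ContDiffAt.comp (g := dual F y) a (hF.contDiffAt_dual_snd hV hy ha) h1
  exact (h2.inv (hF.dual_pos hV hy ha).ne').smul h1

theorem radialCurve_zero {y ξ ζ : Sp d} (hξ : dual F y ξ = 1) : radialCurve F y ξ ζ 0 = ξ := by
  simp [radialCurve, hξ]

theorem IsFinsler.hasDerivAt_radialCurve (hV : IsOpen V) (hF : IsFinsler V F) {y ξ ζ : Sp d}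
    (hy : y ∈ V) (hξ : dual F y ξ = 1) (hζ : fderiv ℝ (dual F y) ξ ζ = 0) :
    HasDerivAt (radialCurve F y ξ ζ) ζ 0 := by
  have hξ0 := ne_zero_of_dual_eq_one hξ
  have h1 : HasDerivAt (fun a : ℝ => ξ + a • ζ) ζ 0 := by
    simpa using ((hasDerivAt_id (0 : ℝ)).smul_const ζ).const_add ξ
  have h2 := HasFDerivAt.comp_hasDerivAt_of_eq (l := dual F y) 0
    (hF.contDiffAt_dual_snd hV hy hξ0).differentiableAt_infty.hasFDerivAt h1 (by simp)
  rw [hζ] at h2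
  have h3 := (h2.inv (by simp [hξ])).smul h1
  have h4 : HasDerivAt (radialCurve F y ξ ζ) _ 0 := h3
  exact h4.congr_deriv (by simp [hξ])

theorem IsFinsler.isCurveThrough_radialCurve (hV : IsOpen V) (hF : IsFinsler V F) {y ξ ζ : Sp d}
    (hy : y ∈ V) (hξ : dual F y ξ = 1) (hζ : fderiv ℝ (dual F y) ξ ζ = 0) :
    IsCurveThrough (cosphere F y) ξ ζ (radialCurve F y ξ ζ) where
  smooth := hF.contDiffAt_radialCurve hV hy (by simpa using ne_zero_of_dual_eq_one hξ)
  mem := by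
    filter_upwards [(isOpen_line_ne_zero ξ ζ).mem_nhds
      (show (0 : ℝ) ∈ {a : ℝ | ξ + a • ζ ≠ 0} by simpa using ne_zero_of_dual_eq_one hξ)] with a ha
    exact hF.dual_radialCurve hV hy ha
  base := radialCurve_zero hξ
  vel := hF.hasDerivAt_radialCurve hV hy hξ hζ

theorem deriv_deriv_comp {g : Sp d → ℝ} {η : ℝ → Sp d} (hg : ContDiffAt ℝ ∞ g (η 0))
    (hη : ContDiffAt ℝ ∞ η 0) :
    deriv (deriv fun a => g (η a)) 0 = fderiv ℝ (fderiv ℝ g) (η 0) (deriv η 0) (deriv η 0)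
      + fderiv ℝ g (η 0) (deriv (deriv η) 0) := by
  have h1 : ∀ᶠ a in 𝓝 (0 : ℝ), ContDiffAt ℝ 1 η a :=
    (hη.of_le (WithTop.coe_le_coe.2 (le_top : (1 : ℕ∞) ≤ ⊤))).eventually (by simp)
  have h2 : ∀ᶠ x in 𝓝 (η 0), ContDiffAt ℝ 1 g x :=
    (hg.of_le (WithTop.coe_le_coe.2 (le_top : (1 : ℕ∞) ≤ ⊤))).eventually (by simp)
  have h3 : (deriv fun a => g (η a)) =ᶠ[𝓝 0] fun a => fderiv ℝ g (η a) (deriv η a) := by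
    filter_upwards [h1, hη.continuousAt.eventually h2] with a ha ha'
    exact ((ha'.differentiableAt (by simp)).hasFDerivAt.comp_hasDerivAt a
      (ha.differentiableAt (by simp)).hasDerivAt).deriv
  have h4 : DifferentiableAt ℝ (deriv η) 0 := by
    have : deriv η = fun a => fderiv ℝ η a 1 := funext fun a => fderiv_apply_one_eq_deriv.symm
    rw [this]
    exact hη.fderiv_infty.differentiableAt_infty.clm_apply (differentiableAt_const _)
  have h5 := hg.fderiv_infty.differentiableAt_infty.hasFDerivAt.comp_hasDerivAt 0
    hη.differentiableAt_infty.hasDerivAt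
  rw [h3.deriv_eq]
  exact (h5.clm_apply h4.hasDerivAt).deriv

/-- The Hessian of a function on the cosphere exists at every critical point. -/
theorem IsFinsler.exists_isHessian (hV : IsOpen V) (hF : IsFinsler V F) {y ξ : Sp d}
    (hy : y ∈ V) {g : Sp d → ℝ} (hg : ContDiffAt ℝ ∞ g ξ)
    (hcrit : IsCritical (cosphere F y) g ξ) :
    ∃ H : QuadraticForm ℝ (cosphereTangent F y ξ),
      IsHessian (cosphere F y) g ξ (cosphereTangent F y ξ) H := by
  have hξ : dual F y ξ = 1 := hcrit.1
  have hξ0 := ne_zero_of_dual_eq_one hξ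
  have hD := hF.contDiffAt_dual_snd hV hy hξ0
  have hker : ∀ ζ, fderiv ℝ (dual F y) ξ ζ = 0 → fderiv ℝ g ξ ζ = 0 := by
    intro ζ hζ
    have h1 := hF.isCurveThrough_radialCurve hV hy hξ hζ
    have h2 := HasFDerivAt.comp_hasDerivAt_of_eq (l := g) 0
      hg.differentiableAt_infty.hasFDerivAt h1.vel h1.base.symm
    exact h2.unique (hcrit.2 ζ _ h1)
  have hDξ : fderiv ℝ (dual F y) ξ ξ = 1 := by
    rw [hF.fderiv_dual hV hy hξ, real_inner_comm, hF.inner_colegendre hV hy hξ0, hξ, one_pow]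
  -- Lagrange multiplier rule; evaluating at `ξ`, where the differential of the dual metric is one,
  -- identifies the multiplier.
  have hlag : ∀ w, fderiv ℝ g ξ w = fderiv ℝ g ξ ξ * fderiv ℝ (dual F y) ξ w := by
    intro w
    have h1 := hker (w - (fderiv ℝ (dual F y) ξ w) • ξ) (by simp [hDξ])
    simp only [map_sub, map_smul, smul_eq_mul] at h1
    linarith
  -- Second derivative of the Lagrangian. Since the dual metric is constant along the curve, the
  -- multiplier term cancels the contribution of its acceleration.
  let b : Sp d →L[ℝ] Sp d →L[ℝ] ℝ := fderiv ℝ (fderiv ℝ g) ξ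
    - fderiv ℝ g ξ ξ • fderiv ℝ (fderiv ℝ (dual F y)) ξ
  let bT : cosphereTangent F y ξ →ₗ[ℝ] cosphereTangent F y ξ →ₗ[ℝ] ℝ :=
    LinearMap.mk₂ ℝ (fun v w => b v w) (by intros; simp) (by intros; simp)
      (by intros; simp) (by intros; simp)
  refine ⟨LinearMap.BilinMap.toQuadraticMap bT, fun ζ η hη => ?_⟩
  have h1 := deriv_deriv_comp (g := g) (η := η) (by rw [hη.base]; exact hg) hη.smooth
  have h2 := deriv_deriv_comp (g := dual F y) (η := η) (by rw [hη.base]; exact hD) hη.smooth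
  have h3 : (fun a => dual F y (η a)) =ᶠ[𝓝 0] fun _ => 1 := hη.mem
  have h4 : deriv (deriv fun a => dual F y (η a)) 0 = 0 := by
    rw [h3.deriv.deriv_eq]; simp
  rw [h4, hη.base, hη.vel.deriv] at h2
  rw [hη.base, hη.vel.deriv, hlag] at h1
  have h5 : iteratedDeriv 2 (fun a => g (η a)) 0 = deriv (deriv fun a => g (η a)) 0 := by
    rw [iteratedDeriv_succ, iteratedDeriv_one]
  rw [h5, h1]
  change _ = b ζ ζ
  simp only [b, sub_apply, smul_apply, smul_eq_mul]
  rw [eq_neg_of_add_eq_zero_right h2.symm]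
  ring

end Cosphere

/-! ### Eikonal phases: characteristics, Hessian and critical covectors. -/

section Phase

variable {V W U K : Set (Sp d)} {F : Sp d → Sp d → ℝ} {φ : Sp d → Sp d → Sp d → ℝ}
  {B κ : ℝ} {y ξ : Sp d}

namespace IsEikonalPhase

theorem contDiffAt (hφ : IsEikonalPhase F W U φ) (hW : IsOpen W) (hU : IsOpen U) (hy : y ∈ U)
    {x : Sp d} (hx : x ∈ W) (hξ : ξ ≠ 0) :
    ContDiffAt ℝ ∞ (fun z : Sp d × Sp d => φ z.1 y z.2) (x, ξ) := by
  have h1 : ContDiffAt ℝ ∞ (fun z : Sp d × Sp d × Sp d => φ z.1 z.2.1 z.2.2) (x, y, ξ) :=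
    hφ.smooth.contDiffAt ((hW.prod (hU.prod isOpen_compl_singleton)).mem_nhds ⟨hx, hy, hξ⟩)
  have h2 : ContDiffAt ℝ ∞ (fun z : Sp d × Sp d => (z.1, y, z.2)) (x, ξ) :=
    contDiffAt_fst.prodMk (contDiffAt_const.prodMk contDiffAt_snd)
  exact h1.comp (x, ξ) h2

theorem contDiffAt_covector (hφ : IsEikonalPhase F W U φ) (hW : IsOpen W) (hU : IsOpen U)
    (hy : y ∈ U) {x : Sp d} (hx : x ∈ W) (hξ : ξ ≠ 0) : ContDiffAt ℝ ∞ (fun ξ => φ x y ξ) ξ :=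
  (hφ.contDiffAt hW hU hy hx hξ).comp ξ (contDiffAt_const.prodMk contDiffAt_id)

theorem isEikonal (hφ : IsEikonalPhase F W U φ) (hW : IsOpen W) (hU : IsOpen U) (hy : y ∈ U)
    (hξ : dual F y ξ = 1) : IsEikonal F W fun z => φ z y ξ where
  smooth := fun x hx => (ContDiffAt.comp (g := fun z : Sp d × Sp d => φ z.1 y z.2)
    (f := fun z : Sp d => (z, ξ)) x (hφ.contDiffAt hW hU hy hx (ne_zero_of_dual_eq_one hξ))
    (contDiffAt_id.prodMk contDiffAt_const)).contDiffWithinAt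
  dual_eq := fun x hx => by rw [hφ.eikonal x hx y hy ξ (ne_zero_of_dual_eq_one hξ), hξ]

theorem base (hφ : IsEikonalPhase F W U φ) (hUW : U ⊆ W) (hy : y ∈ U) (hξ : ξ ≠ 0) :
    φ y y ξ = 0 :=
  hφ.vanishing y (hUW hy) y hy ξ hξ (by simp)

theorem isEikonalFamily (hV : IsOpen V) (hF : IsFinsler V F) (hW : IsOpen W) (hWV : W ⊆ V)
    (hU : IsOpen U) (hUW : U ⊆ W) (hφ : IsEikonalPhase F W U φ) (hy : y ∈ U) (ζ : Sp d) :
    IsEikonalFamily F W {a : ℝ | ξ + a • ζ ≠ 0}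
      (fun z => φ z.1 y (radialCurve F y ξ ζ z.2)) := by
  have hyV := hWV (hUW hy)
  have hsm : ∀ x ∈ W, ∀ a ∈ {a : ℝ | ξ + a • ζ ≠ 0},
      ContDiffAt ℝ ∞ (fun z : Sp d × ℝ => φ z.1 y (radialCurve F y ξ ζ z.2)) (x, a) := by
    intro x hx a ha
    have h1 := hφ.contDiffAt hW hU hy hx (ne_zero_of_dual_eq_one (hF.dual_radialCurve hV hyV ha))
    exact h1.comp (x, a) (contDiffAt_fst.prodMk
      ((hF.contDiffAt_radialCurve hV hyV ha).comp (x, a) contDiffAt_snd))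
  refine ⟨fun z hz => (hsm z.1 hz.1 z.2 hz.2).contDiffWithinAt, fun x hx a ha => ?_⟩
  have h1 := gradient_fst_slot (hsm x hx a ha).differentiableAt_infty
  rw [← h1]
  exact (hφ.isEikonal hW hU hy (hF.dual_radialCurve hV hyV ha)).dual_eq x hx

/-- A short geodesic through `y` is a characteristic of the phase whose covector is dual to its
velocity at `y`. -/
theorem velocity_eq (hV : IsOpen V) (hF : IsFinsler V F) (hW : IsOpen W) (hWV : W ⊆ V)
    (hU : IsOpen U) (hUW : U ⊆ W) (hφ : IsEikonalPhase F W U φ) (hy : y ∈ U) {c : ℝ → Sp d}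
    (hc : IsGeodesic F c) (hcU : MapsTo c (Icc 0 1) U) (hne : c 0 ≠ c 1) {t₀ : ℝ}
    (ht₀ : t₀ ∈ Icc (0 : ℝ) 1) (hct₀ : c t₀ = y)
    (hξ : ξ = legendre F y (unit F y (velocity c t₀))) :
    0 < length F c ∧ dual F y ξ = 1 ∧
      (∀ t ∈ Icc (0 : ℝ) 1, F (c t) (velocity c t) = length F c) ∧
      ∀ t ∈ Icc (0 : ℝ) 1, velocity c t = length F c • ray F (fun z => φ z y ξ) (c t) := by
  have hyV := hWV (hUW hy)
  have hcW : MapsTo c (Icc 0 1) W := hcU.mono_right hUW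
  have hcV : MapsTo c (Icc 0 1) V := hcW.mono_right hWV
  have hL : 0 < length F c := by
    rw [hc.length_eq hV hF hcV]; exact hc.speed_pos hV hF hcV hne
  have hspeed : ∀ t ∈ Icc (0 : ℝ) 1, F (c t) (velocity c t) = length F c := fun t ht => by
    rw [hc.length_eq hV hF hcV]; exact hc.speed_eq hV hF hcV ht
  have hFy : F y (velocity c t₀) = length F c := by rw [← hspeed t₀ ht₀, hct₀]
  have hv0 : velocity c t₀ ≠ 0 := by
    intro h; rw [h, hF.apply_zero hyV] at hFy; exact hL.ne hFy
  have hunit : unit F y (velocity c t₀) = (length F c)⁻¹ • velocity c t₀ := by rw [unit, hFy]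
  have hu0 : unit F y (velocity c t₀) ≠ 0 := by
    rw [hunit]; exact smul_ne_zero (inv_pos.2 hL).ne' hv0
  rw [hF.legendre_eq hV hyV hu0] at hξ
  have hdual : dual F y ξ = 1 := by
    rw [hξ, hF.dual_momentum hV hyV hu0, hunit, hF.homogeneous y hyV _ _ (inv_pos.2 hL).le, hFy,
      inv_mul_cancel₀ hL.ne']
  refine ⟨hL, hdual, hspeed, fun t ht => ?_⟩
  refine hc.velocity_eq_ray hV hF hW hWV (hφ.isEikonal hW hU hy hdual) hcW hL ht₀ ?_ ht
  rw [hct₀, ray, hφ.orientation y hy ξ (ne_zero_of_dual_eq_one hdual), hξ,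
    hF.colegendre_momentum hV hyV hu0, hunit, smul_smul, mul_inv_cancel₀ hL.ne', one_smul]

/-- The covector of a phase is recovered from the direction of its characteristic at `y`. -/
theorem eq_legendre (hV : IsOpen V) (hF : IsFinsler V F) (hWV : W ⊆ V) (hUW : U ⊆ W)
    (hφ : IsEikonalPhase F W U φ) (hy : y ∈ U) (hξ : dual F y ξ = 1) {L : ℝ} (hL : 0 < L)
    {w : Sp d} (hw : w = L • ray F (fun z => φ z y ξ) y) : legendre F y (unit F y w) = ξ := by
  have hyV := hWV (hUW hy)
  have hξ0 := ne_zero_of_dual_eq_one hξ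
  have hray : ray F (fun z => φ z y ξ) y = colegendre F (y, ξ) := by
    rw [ray, hφ.orientation y hy ξ hξ0]
  obtain ⟨h1, h2⟩ := hF.colegendre_spec hV hyV hξ0
  have h3 : unit F y w = colegendre F (y, ξ) := by
    rw [unit, hw, hray, hF.homogeneous y hyV _ L hL.le, hF.apply_colegendre hV hyV hξ0, hξ, mul_one,
      smul_smul, inv_mul_cancel₀ hL.ne', one_smul]
  rw [h3, hF.legendre_eq hV hyV h1, h2]

/-- The Hessian of the phase in the covector, at the end point of a short characteristic. -/
theorem exists_iteratedDeriv_two_eq (hV : IsOpen V) (hF : IsFinsler V F) (hW : IsOpen W)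
    (hWV : W ⊆ V) (hWK : W ⊆ K) (hB : HamiltonianBounds F K B κ) (hU : IsOpen U) (hUW : U ⊆ W)
    (hφ : IsEikonalPhase F W U φ) (hy : y ∈ U) (hξ : dual F y ξ = 1) {c : ℝ → Sp d} {ℓ : ℝ}
    (hc : ∀ t ∈ Icc (0 : ℝ) 1,
      HasDerivWithinAt c (ℓ • ray F (fun z => φ z y ξ) (c t)) (Icc 0 1) t)
    (hcW : MapsTo c (Icc 0 1) W) (hc0 : c 0 = y)
    (hℓ : |ℓ| * (B * (2 + B ^ 2 * (2 + B ^ 2)) ^ 2) * 3 < 1) {ζ : Sp d}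
    (hζ : fderiv ℝ (dual F y) ξ ζ = 0) :
    ∃ m, κ / 4 * ‖ζ‖ ^ 2 ≤ m ∧
      iteratedDeriv 2 (fun a => φ (c 1) y (radialCurve F y ξ ζ a)) 0 = -ℓ * m := by
  have hyV := hWV (hUW hy)
  have hξ0 := ne_zero_of_dual_eq_one hξ
  have hG := hφ.isEikonalFamily (ξ := ξ) hV hF hW hWV hU hUW hy ζ
  set G : Sp d × ℝ → ℝ := fun z => φ z.1 y (radialCurve F y ξ ζ z.2) with hG_def
  have hJ := isOpen_line_ne_zero ξ ζ
  have h0 : (0 : ℝ) ∈ {a : ℝ | ξ + a • ζ ≠ 0} := by simpa using hξ0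
  have hr0 : radialCurve F y ξ ζ 0 = ξ := radialCurve_zero hξ
  have hu : (fun x => G (x, 0)) = fun z => φ z y ξ := by
    funext x; simp only [hG_def, hr0]
  have hgy : ∀ a ∈ {a : ℝ | ξ + a • ζ ≠ 0}, gradFst G (y, a) = radialCurve F y ξ ζ a := by
    intro a ha
    rw [← hG.gradient_eq hW hJ (hUW hy) ha]
    exact hφ.orientation y hy _ (ne_zero_of_dual_eq_one (hF.dual_radialCurve hV hyV ha))
  have hvel : paramDeriv (gradFst G) (c 0, 0) = ζ := by
    rw [hc0]
    have h1 := hasDerivAt_param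
      (contDiffAt_gradFst (hG.contDiffAt hW hJ (hUW hy) h0)).differentiableAt_infty
    have h2 : (fun b => gradFst G (y, b)) =ᶠ[𝓝 0] radialCurve F y ξ ζ := by
      filter_upwards [hJ.mem_nhds h0] with b hb using hgy b hb
    exact h1.unique ((hF.hasDerivAt_radialCurve hV hyV hξ hζ).congr_of_eventuallyEq h2)
  obtain ⟨m, hm, hm'⟩ := hG.exists_paramDeriv_two_eq hV hF hW hWV hWK hB hJ h0
    (by rw [hu]; exact hc) hcW (fun x hx hx0 => by
      rw [hc0, hgy 0 h0, hr0] at hx0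
      simp only [hG_def, hr0]
      exact hφ.vanishing x hx y hy ξ hξ0 hx0)
    (fun a ha => by
      rw [hc0]
      exact hφ.base hUW hy (ne_zero_of_dual_eq_one (hF.dual_radialCurve hV hyV ha))) hℓ
  rw [hvel] at hm
  refine ⟨m, hm, ?_⟩
  rw [← hm', iteratedDeriv_succ, iteratedDeriv_one]
  have hx1 : c 1 ∈ W := hcW (by simp)
  have h1 : (deriv fun a => G (c 1, a)) =ᶠ[𝓝 0] fun a => paramDeriv G (c 1, a) := by
    filter_upwards [hJ.mem_nhds h0] with a ha
    exact (hasDerivAt_param (hG.contDiffAt hW hJ hx1 ha).differentiableAt_infty).deriv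
  rw [h1.deriv_eq]
  exact (hasDerivAt_param (contDiffAt_paramDeriv
    (hG.contDiffAt hW hJ hx1 h0)).differentiableAt_infty).deriv

/-- If `ξ` is critical for `φ(x, y, ·)`, then the characteristic through `x` passes through `y`. -/
theorem eq_of_isCritical (hV : IsOpen V) (hF : IsFinsler V F) (hW : IsOpen W)
    (hWV : W ⊆ V) (hU : IsOpen U) (hUW : U ⊆ W)
    (hφ : IsEikonalPhase F W U φ) (hy : y ∈ U) (hξ : dual F y ξ = 1) {X : ℝ → Sp d} {τ : ℝ}
    (hX : ∀ t ∈ Icc (0 : ℝ) 1,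
      HasDerivWithinAt X (τ • ray F (fun z => φ z y ξ) (X t)) (Icc 0 1) t)
    (hXW : MapsTo X (Icc 0 1) W) (hX0 : inner ℝ ξ (X 0 - y) = 0)
    (hcrit : IsCritical (cosphere F y) (fun ξ => φ (X 1) y ξ) ξ) : X 0 = y := by
  have hyV := hWV (hUW hy)
  have hξ0 := ne_zero_of_dual_eq_one hξ
  have hzW : X 0 ∈ W := hXW (by simp)
  have hu := hφ.isEikonal hW hU hy hξ
  set v := colegendre F (y, ξ) with hv
  have hξv : inner ℝ ξ v = 1 := by rw [hF.inner_colegendre hV hyV hξ0, hξ, one_pow]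
  set z := X 0 with hz
  -- The displacement of the foot point, corrected to be tangent to the cosphere. As `ξ` annihilates
  -- `z - y`, the pairing of `ζ` with `z - y` is still `‖z - y‖²`.
  set ζ := (z - y) - (inner ℝ v (z - y)) • ξ with hζ_def
  have hvζ : inner ℝ v ζ = 0 := by
    rw [hζ_def, inner_sub_right, inner_smul_right, real_inner_comm ξ v, hξv, mul_one, sub_self]
  have hζ : fderiv ℝ (dual F y) ξ ζ = 0 := by rw [hF.fderiv_dual hV hyV hξ]; exact hvζ
  have hζz : inner ℝ ζ (z - y) = ‖z - y‖ ^ 2 := by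
    rw [hζ_def, inner_sub_left, real_inner_smul_left, hX0, mul_zero, sub_zero,
      real_inner_self_eq_norm_sq]
  have hG := hφ.isEikonalFamily (ξ := ξ) hV hF hW hWV hU hUW hy ζ
  set G : Sp d × ℝ → ℝ := fun z => φ z.1 y (radialCurve F y ξ ζ z.2) with hG_def
  have hJ := isOpen_line_ne_zero ξ ζ
  have h0 : (0 : ℝ) ∈ {a : ℝ | ξ + a • ζ ≠ 0} := by simpa using hξ0
  have hr0 : radialCurve F y ξ ζ 0 = ξ := radialCurve_zero hξ
  have hu0 : (fun x => G (x, 0)) = fun z => φ z y ξ := by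
    funext x; simp only [hG_def, hr0]
  have hcurve := hF.isCurveThrough_radialCurve hV hyV hξ hζ
  have hend : paramDeriv G (X 1, 0) = 0 :=
    (hasDerivAt_param (hG.contDiffAt hW hJ (hXW (by simp)) h0).differentiableAt_infty).unique
      (hcrit.2 ζ _ hcurve)
  -- Criticality is known at `X 1`; the first integral carries it back to the foot point `z`.
  have hder : ∀ t ∈ Icc (0 : ℝ) 1, HasDerivWithinAt (fun t => paramDeriv G (X t, 0)) 0
      (Icc 0 1) t := by
    intro t ht
    have hx := hXW ht
    have h1 : DifferentiableAt ℝ (fun x => paramDeriv G (x, 0)) (X t) :=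
      (hasFDerivAt_fst_slot (contDiffAt_paramDeriv
        (hG.contDiffAt hW hJ hx h0)).differentiableAt_infty).differentiableAt
    have h2 := h1.hasFDerivAt.comp_hasDerivWithinAt t (hX t ht)
    have h3 := hG.inner_colegendre_paramDeriv hV hF hW hWV hJ hx h0
    rw [← hG.gradient_eq hW hJ hx h0, hu0] at h3
    rw [map_smul, ← inner_gradient, hG.gradient_paramDeriv hW hJ hx h0, real_inner_comm, ray, h3,
      smul_zero] at h2
    exact h2
  have hstart : paramDeriv G (z, 0) = 0 := by
    have := constant_of_derivWithin_zero (fun t ht => (hder t ht).differentiableWithinAt)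
      (fun t ht => (hder t (Ico_subset_Icc_self ht)).derivWithin
        (uniqueDiffOn_Icc zero_lt_one t (Ico_subset_Icc_self ht))) 1 (by simp)
    rw [hz, ← this, hend]
  have hf := (hφ.contDiffAt hW hU hy hzW hξ0).differentiableAt_infty
  set f : Sp d × Sp d → ℝ := fun z => φ z.1 y z.2 with hf_def
  have hfζ : fderiv ℝ f (z, ξ) (0, ζ) = 0 := by
    have h1 := HasFDerivAt.comp_hasDerivAt_of_eq (l := fun w => f (z, w)) 0
      (hasFDerivAt_snd_slot hf) hcurve.vel hr0.symm
    have h2 := (hasDerivAt_param (hG.contDiffAt hW hJ hzW h0).differentiableAt_infty).unique h1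
    rw [hstart] at h2
    simpa using h2.symm
  -- Tilting the covector by `a ζ` while moving `z` by `-a ‖z - y‖² v` keeps the point exactly on
  -- the tilted hyperplane, where the phase vanishes. The covector part of the derivative is zero,
  -- and the spatial part is `-b ‖z - y‖²` with `b ≠ 0`.
  have hplane : fderiv ℝ f (z, ξ) (-(‖z - y‖ ^ 2) • v, ζ) = 0 := by
    have h1 : HasDerivAt (fun a : ℝ => (z + a • (-(‖z - y‖ ^ 2) • v), ξ + a • ζ))
        (-(‖z - y‖ ^ 2) • v, ζ) 0 := by
      refine HasDerivAt.prodMk ?_ ?_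
      · simpa using ((hasDerivAt_id (0 : ℝ)).smul_const (-(‖z - y‖ ^ 2) • v)).const_add z
      · simpa using ((hasDerivAt_id (0 : ℝ)).smul_const ζ).const_add ξ
    have h2 := HasFDerivAt.comp_hasDerivAt_of_eq (l := f) 0 hf.hasFDerivAt h1 (by simp)
    have h3 : (f ∘ fun a : ℝ => (z + a • (-(‖z - y‖ ^ 2) • v), ξ + a • ζ)) =ᶠ[𝓝 0] fun _ => 0 := by
      have h4 : ∀ᶠ a : ℝ in 𝓝 0, (z + a • (-(‖z - y‖ ^ 2) • v), ξ + a • ζ)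
          ∈ W ×ˢ ({0}ᶜ : Set (Sp d)) :=
        h1.continuousAt.eventually_mem ((hW.prod isOpen_compl_singleton).mem_nhds
          (by simpa using ⟨hzW, hξ0⟩))
      filter_upwards [h4] with a ha
      refine hφ.vanishing _ ha.1 y hy _ ha.2 ?_
      rw [add_sub_right_comm, inner_add_left, inner_add_right, inner_add_right, hX0]
      simp only [real_inner_smul_left, inner_smul_right]
      rw [hξv, hζz, real_inner_comm v ζ, hvζ]
      ring
    exact h2.unique ((hasDerivAt_const (0 : ℝ) (0 : ℝ)).congr_of_eventuallyEq h3)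
  obtain ⟨b, hb⟩ := hu.exists_gradient_eq_smul hW hzW hξ0
    (fun x hx h => hφ.vanishing x hx y hy ξ hξ0 h) hX0
  have hb0 : b ≠ 0 := by
    rintro rfl
    exact hu.gradient_ne_zero hzW (by rw [hb, zero_smul])
  have hgz : gradFst f (z, ξ) = b • ξ := by
    rw [← gradient_fst_slot hf]; exact hb
  rw [show (-(‖z - y‖ ^ 2) • v, ζ) = (-(‖z - y‖ ^ 2) • v, 0) + (0, ζ) by simp, map_add, hfζ,
    add_zero, ← inner_gradFst, hgz, real_inner_smul_left, inner_smul_right, hξv, mul_one] at hplane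
  have h5 : ‖z - y‖ ^ 2 = 0 := by
    rcases mul_eq_zero.1 hplane with h | h
    · exact absurd h hb0
    · linarith
  exact sub_eq_zero.1 (norm_eq_zero.1 (pow_eq_zero_iff two_ne_zero |>.1 h5))

end IsEikonalPhase

end Phase

/-! ### Classification of the critical points. -/

theorem isCritical_of_isExtrOn {S : Set (Sp d)} {g : Sp d → ℝ} {ξ : Sp d} (hξ : ξ ∈ S)
    (hg : DifferentiableAt ℝ g ξ) (h : IsExtrOn g S ξ) : IsCritical S g ξ := by
  refine ⟨hξ, fun ζ η hη => ?_⟩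
  have h1 := HasFDerivAt.comp_hasDerivAt_of_eq (l := g) 0 hg.hasFDerivAt hη.vel hη.base.symm
  have h2 : IsLocalExtr (g ∘ η) 0 := by
    rcases h with h | h
    · refine Or.inl ?_
      filter_upwards [hη.mem] with a ha
      simpa [hη.base] using h ha
    · refine Or.inr ?_
      filter_upwards [hη.mem] with a ha
      simpa [hη.base] using h ha
  rw [h2.hasDerivAt_eq_zero h1] at h1
  exact h1

theorem hasDerivWithinAt_reverse {c : ℝ → Sp d} {v : Sp d} {t : ℝ}
    (h : HasDerivWithinAt c v (Icc 0 1) (1 - t)) :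
    HasDerivWithinAt (fun t => c (1 - t)) (-v) (Icc 0 1) t := by
  have h1 : HasDerivWithinAt (fun t : ℝ => 1 - t) (-1) (Icc 0 1) t :=
    (hasDerivWithinAt_id t _).const_sub 1
  have h2 := h.scomp t h1 (fun s hs => ⟨by linarith [hs.2], by linarith [hs.1]⟩)
  rw [neg_one_smul] at h2
  exact h2

theorem one_sub_mem_Icc {t : ℝ} (ht : t ∈ Icc (0 : ℝ) 1) : 1 - t ∈ Icc (0 : ℝ) 1 :=
  ⟨by linarith [ht.2], by linarith [ht.1]⟩

/-- Applied to the phase, this bounds the lengths of the minimizing geodesics, which are values of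
`|Ψ|`, by the Euclidean distance of the end points. -/
theorem IsEikonal.abs_sub_le {W K : Set (Sp d)} {F : Sp d → Sp d → ℝ} {B κ : ℝ} {u : Sp d → ℝ}
    (hW : IsOpen W) (hWK : W ⊆ K) (hB : HamiltonianBounds F K B κ) (hu : IsEikonal F W u)
    {y x : Sp d} (hball : Metric.closedBall y ‖x - y‖ ⊆ W) : |u x - u y| ≤ B * ‖x - y‖ := by
  have h1 : ∀ z ∈ Metric.closedBall y ‖x - y‖, ‖fderiv ℝ u z‖ ≤ B := fun z hz => by
    have h2 : ‖gradient u z‖ = ‖fderiv ℝ u z‖ := by simp [gradient]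
    rw [← h2]
    exact hB.norm_covector z (hWK (hball hz)) _ (hu.dual_eq z (hball hz))
  exact (convex_closedBall y ‖x - y‖).norm_image_sub_le_of_norm_fderiv_le
    (fun z hz => (hu.contDiffAt hW (hball hz)).differentiableAt_infty) h1
    (Metric.mem_closedBall_self (norm_nonneg _)) (by rw [mem_closedBall_iff_norm])

/-- The critical points of an eikonal phase `φ(x₁, x₀, ·)`, under explicit smallness conditions on
the distance of `x₀` and `x₁`. -/
theorem IsEikonalPhase.criticalPoints {V W U U₀ K : Set (Sp d)} {F : Sp d → Sp d → ℝ}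
    {φ : Sp d → Sp d → Sp d → ℝ} {B κ : ℝ} (hV : IsOpen V) (hF : IsFinsler V F) (hW : IsOpen W)
    (hWV : W ⊆ V) (hWK : W ⊆ K) (hB : HamiltonianBounds F K B κ) (hU : IsOpen U) (hUW : U ⊆ W)
    (hφ : IsEikonalPhase F W U φ) {x₀ x₁ : Sp d} (hx₀ : x₀ ∈ U) (hx₁ : x₁ ∈ U) (hne : x₀ ≠ x₁)
    {n₀ : ℝ} (hball : Metric.closedBall x₀ (2 * n₀) ⊆ W)
    (hn₀ : (1 + 4 * B ^ 2) * ‖x₁ - x₀‖ ≤ n₀) (hn₀B : n₀ ≤ 1 / (4 * B))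
    (hdual : ∀ ξ, dual F x₀ ξ = 1 →
      ∀ z ∈ Metric.closedBall x₀ n₀, |1 - dual F z ξ| ≤ 1 / (16 * B ^ 2))
    (hsmall : B * ‖x₁ - x₀‖ * (B * (2 + B ^ 2 * (2 + B ^ 2)) ^ 2) * 3 < 1)
    {cp cm : ℝ → Sp d} (hcp : IsMinimizingGeodesic F U₀ U x₀ x₁ cp)
    (hcm : IsMinimizingGeodesic F U₀ U x₁ x₀ cm) {ξp ξm : Sp d}
    (hξp : ξp = legendre F x₀ (unit F x₀ (velocity cp 0)))
    (hξm : ξm = legendre F x₀ (unit F x₀ (velocity cm 1))) :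
    ξp ≠ ξm ∧ {ξ | IsCritical (cosphere F x₀) (fun ξ => φ x₁ x₀ ξ) ξ} = {ξp, ξm} ∧
      φ x₁ x₀ ξp = dPlus F U₀ x₀ x₁ ∧ φ x₁ x₀ ξm = -dMinus F U₀ x₀ x₁ ∧
      (∃ H : QuadraticForm ℝ (cosphereTangent F x₀ ξp),
        IsHessian (cosphere F x₀) (fun ξ => φ x₁ x₀ ξ) ξp (cosphereTangent F x₀ ξp) H ∧
        ∀ ζ, H ζ ≤ -(κ / 4 * dPlus F U₀ x₀ x₁ * ‖ζ‖ ^ 2)) ∧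
      (∃ H : QuadraticForm ℝ (cosphereTangent F x₀ ξm),
        IsHessian (cosphere F x₀) (fun ξ => φ x₁ x₀ ξ) ξm (cosphereTangent F x₀ ξm) H ∧
        ∀ ζ, κ / 4 * dMinus F U₀ x₀ x₁ * ‖ζ‖ ^ 2 ≤ H ζ) := by
  have hB1 := hB.one_le
  have hB0 : 0 < B := by linarith
  have hx₀W := hUW hx₀
  have hx₁W := hUW hx₁
  have hx₀V := hWV hx₀W
  have hN : 0 < ‖x₁ - x₀‖ := norm_pos_iff.2 (sub_ne_zero.2 hne.symm)
  have hn₀0 : 0 ≤ n₀ := le_trans (by positivity) hn₀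
  have hballN : Metric.closedBall x₀ ‖x₁ - x₀‖ ⊆ W :=
    (Metric.closedBall_subset_closedBall (by nlinarith [sq_nonneg B])).trans hball
  have hcp0 := hcp.path.source
  have hcp1 := hcp.path.target
  have hcm0 := hcm.path.source
  have hcm1 := hcm.path.target
  have h0I : (0 : ℝ) ∈ Icc (0 : ℝ) 1 := by simp
  have h1I : (1 : ℝ) ∈ Icc (0 : ℝ) 1 := by simp
  obtain ⟨hLp, hξp1, hFp, hvp⟩ := hφ.velocity_eq hV hF hW hWV hU hUW hx₀ hcp.geodesic
    hcp.path.mapsTo (by rw [hcp0, hcp1]; exact hne) h0I hcp0 hξp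
  obtain ⟨hLm, hξm1, hFm, hvm⟩ := hφ.velocity_eq hV hF hW hWV hU hUW hx₀ hcm.geodesic
    hcm.path.mapsTo (by rw [hcm0, hcm1]; exact hne.symm) h1I hcm1 hξm
  rw [dMinus, ← hcp.minimizing, ← hcm.minimizing]
  set p := length F cp
  set m := length F cm
  have hcpW : MapsTo cp (Icc 0 1) W := hcp.path.mapsTo.mono_right hUW
  have hcmW : MapsTo cm (Icc 0 1) W := hcm.path.mapsTo.mono_right hUW
  have hcpd : ∀ t ∈ Icc (0 : ℝ) 1, HasDerivWithinAt cp (velocity cp t) (Icc 0 1) t :=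
    fun t ht => hcp.geodesic.hasDerivWithinAt ht
  have hcmd : ∀ t ∈ Icc (0 : ℝ) 1, HasDerivWithinAt cm (velocity cm t) (Icc 0 1) t :=
    fun t ht => hcm.geodesic.hasDerivWithinAt ht
  have heik : ∀ ξ, dual F x₀ ξ = 1 → IsEikonal F W fun z => φ z x₀ ξ := fun ξ hξ =>
    hφ.isEikonal hW hU hx₀ hξ
  have hbase : ∀ ξ, dual F x₀ ξ = 1 → φ x₀ x₀ ξ = 0 := fun ξ hξ =>
    hφ.base hUW hx₀ (ne_zero_of_dual_eq_one hξ)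
  have hray_p : ∀ t ∈ Icc (0 : ℝ) 1,
      HasDerivWithinAt cp (p • ray F (fun z => φ z x₀ ξp) (cp t)) (Icc 0 1) t :=
    fun t ht => by rw [← hvp t ht]; exact hcpd t ht
  have hray_m : ∀ t ∈ Icc (0 : ℝ) 1,
      HasDerivWithinAt cm (m • ray F (fun z => φ z x₀ ξm) (cm t)) (Icc 0 1) t :=
    fun t ht => by rw [← hvm t ht]; exact hcmd t ht
  have hΨp : φ x₁ x₀ ξp = p := by
    have h := (heik ξp hξp1).sub_eq_of_ray hV hF hW hWV hray_p hcpW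
    simpa [hcp0, hcp1, hbase ξp hξp1] using h
  have hΨm : φ x₁ x₀ ξm = -m := by
    have h := (heik ξm hξm1).sub_eq_of_ray hV hF hW hWV hray_m hcmW
    simp only [hcm0, hcm1, hbase ξm hξm1] at h
    linarith
  -- Every phase, not only that of `ξp`, calibrates the fixed geodesic `cp`.
  have hle : ∀ ξ, dual F x₀ ξ = 1 → φ x₁ x₀ ξ ≤ p := by
    intro ξ hξ
    have h := (heik ξ hξ).sub_le hV hF hW hWV hcpd hcpW fun t ht => (hFp t ht).le
    simpa [hcp0, hcp1, hbase ξ hξ] using h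
  have hge : ∀ ξ, dual F x₀ ξ = 1 → -m ≤ φ x₁ x₀ ξ := by
    intro ξ hξ
    have h := (heik ξ hξ).sub_le hV hF hW hWV hcmd hcmW fun t ht => (hFm t ht).le
    simp only [hcm0, hcm1, hbase ξ hξ] at h
    linarith
  have hsm : ∀ ξ, dual F x₀ ξ = 1 → ContDiffAt ℝ ∞ (fun ξ => φ x₁ x₀ ξ) ξ := fun ξ hξ =>
    hφ.contDiffAt_covector hW hU hx₀ hx₁W (ne_zero_of_dual_eq_one hξ)
  have hcrit_p : IsCritical (cosphere F x₀) (fun ξ => φ x₁ x₀ ξ) ξp :=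
    isCritical_of_isExtrOn hξp1 (hsm ξp hξp1).differentiableAt_infty
      (Or.inr fun ξ hξ => by simpa [hΨp] using hle ξ hξ)
  have hcrit_m : IsCritical (cosphere F x₀) (fun ξ => φ x₁ x₀ ξ) ξm :=
    isCritical_of_isExtrOn hξm1 (hsm ξm hξm1).differentiableAt_infty
      (Or.inl fun ξ hξ => by simpa [hΨm] using hge ξ hξ)
  have hℓ : ∀ ξ, dual F x₀ ξ = 1 →
      |φ x₁ x₀ ξ| * (B * (2 + B ^ 2 * (2 + B ^ 2)) ^ 2) * 3 < 1 := by
    intro ξ hξ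
    have h := (heik ξ hξ).abs_sub_le hW hWK hB hballN
    simp only [hbase ξ hξ, sub_zero] at h
    refine lt_of_le_of_lt ?_ hsmall
    gcongr
  refine ⟨?_, ?_, hΨp, hΨm, ?_, ?_⟩
  · rintro rfl
    linarith
  · refine Subset.antisymm (fun ξ hξc => ?_) ?_
    · have hξ : dual F x₀ ξ = 1 := hξc.1
      have hξ0 := ne_zero_of_dual_eq_one hξ
      have hu := heik ξ hξ
      -- The weight `4 * B` times `|⟨ξ, x₁ - x₀⟩| ≤ B ‖x₁ - x₀‖` explains the factor `1 + 4 * B ^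
      -- 2`.
      have hcone : coneNorm B x₀ ξ x₁ ≤ n₀ := by
        refine le_trans ?_ hn₀
        have h1 : |inner ℝ ξ (x₁ - x₀)| ≤ B * ‖x₁ - x₀‖ :=
          (abs_real_inner_le_norm _ _).trans
            (mul_le_mul_of_nonneg_right (hB.norm_covector x₀ (hWK hx₀W) ξ hξ) (norm_nonneg _))
        rw [coneNorm]
        nlinarith
      obtain ⟨τ, X, hX, hXW, hX0, -, hX1, -⟩ := hu.exists_characteristic hV hF hW hWV hWK hB hball
        hcone fun z hz => hu.norm_gradient_sub_le_of_coneNorm_le hV hF hW hWV hWK hB hn₀0 hball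
          (hφ.orientation x₀ hx₀ ξ hξ0) (fun x hx h => hφ.vanishing x hx x₀ hx₀ ξ hξ0 h) hn₀B
          (hdual ξ hξ) (hz.trans hcone)
      have hXx₀ : X 0 = x₀ := hφ.eq_of_isCritical hV hF hW hWV hU hUW hx₀ hξ hX hXW hX0
        (by rw [hX1]; exact hξc)
      have hΨτ : φ x₁ x₀ ξ = τ := by
        have h := hu.sub_eq_of_ray hV hF hW hWV hX hXW
        simpa [hX1, hXx₀, hbase ξ hξ] using h
      rcases lt_trichotomy τ 0 with hτ | hτ | hτ
      · right
        -- The reversed characteristic is only known to lie in `W`, so it is compared with `cm`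
        -- through the calibration by the phase of `ξm` rather than through the distance in `U₀`.
        -- This gives `m ≤ -τ`, and with `hge` equality, so `cm` is itself a characteristic for `ξ`.
        have h1 := (heik ξm hξm1).sub_le hV hF hW hWV (L := -τ)
          (fun t ht => hasDerivWithinAt_reverse (hX (1 - t) (one_sub_mem_Icc ht)))
          (fun t ht => hXW (one_sub_mem_Icc ht)) (fun t ht => by
            rw [← neg_smul, hF.homogeneous _ (hWV (hXW (one_sub_mem_Icc ht))) _ _ (by linarith),
              hu.apply_ray hV hF hWV (hXW (one_sub_mem_Icc ht)), mul_one])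
        simp only [sub_self, sub_zero, hX1, hXx₀, hbase ξm hξm1, hΨm] at h1
        have h2 := hge ξ hξ
        have h3 := hu.eq_ray_of_sub_eq hV hF hW hWV hcmd hcmW hLm hFm
          (by simp only [hcm0, hcm1, hbase ξ hξ]; linarith) h1I
        rw [hcm1] at h3
        rw [mem_singleton_iff, hξm]
        exact (hφ.eq_legendre hV hF hWV hUW hx₀ hξ hLm h3).symm
      · exfalso
        have h1 := constant_of_derivWithin_zero (f := X) (a := 0) (b := 1)
          (fun t ht => (hX t ht).differentiableWithinAt)
          (fun t ht => by
            rw [(hX t (Ico_subset_Icc_self ht)).derivWithin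
              (uniqueDiffOn_Icc zero_lt_one t (Ico_subset_Icc_self ht)), hτ, zero_smul]) 1 h1I
        rw [hX1, hXx₀] at h1
        exact hne h1.symm
      · left
        -- The mirror image: the phase of `ξp` gives `p ≤ τ`, and `hle` the converse.
        have h1 := (heik ξp hξp1).sub_le hV hF hW hWV (L := τ) hX hXW (fun t ht => by
            rw [hF.homogeneous _ (hWV (hXW ht)) _ _ hτ.le, hu.apply_ray hV hF hWV (hXW ht),
              mul_one])
        simp only [sub_zero, hX1, hXx₀, hbase ξp hξp1, hΨp] at h1
        have h2 := hle ξ hξ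
        have h3 := hu.eq_ray_of_sub_eq hV hF hW hWV hcpd hcpW hLp hFp
          (by simp only [hcp0, hcp1, hbase ξ hξ]; linarith) h0I
        rw [hcp0] at h3
        rw [hξp]
        exact (hφ.eq_legendre hV hF hWV hUW hx₀ hξ hLp h3).symm
    · rintro ξ (rfl | rfl)
      · exact hcrit_p
      · exact hcrit_m
  · obtain ⟨H, hH⟩ := hF.exists_isHessian hV hx₀V (hsm ξp hξp1) hcrit_p
    refine ⟨H, hH, fun ζ => ?_⟩
    obtain ⟨M, hM, hM'⟩ := hφ.exists_iteratedDeriv_two_eq hV hF hW hWV hWK hB hU hUW hx₀ hξp1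
      hray_p hcpW hcp0 (by rw [← hΨp]; exact hℓ ξp hξp1) ζ.2
    rw [← hH ζ _ (hF.isCurveThrough_radialCurve hV hx₀V hξp1 ζ.2), ← hcp1, hM']
    have : p * (κ / 4 * ‖(ζ : Sp d)‖ ^ 2) ≤ p * M := mul_le_mul_of_nonneg_left hM hLp.le
    rw [Submodule.coe_norm]
    linarith
  · obtain ⟨H, hH⟩ := hF.exists_isHessian hV hx₀V (hsm ξm hξm1) hcrit_m
    refine ⟨H, hH, fun ζ => ?_⟩
    obtain ⟨M, hM, hM'⟩ := hφ.exists_iteratedDeriv_two_eq hV hF hW hWV hWK hB hU hUW hx₀ hξm1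
      -- Reversal makes the characteristic start at `x₀`; the negative `ℓ` turns the sign of the
      -- Hessian.
      (c := fun t => cm (1 - t)) (ℓ := -m)
      (fun t ht => by
        rw [neg_smul]; exact hasDerivWithinAt_reverse (hray_m (1 - t) (one_sub_mem_Icc ht)))
      (fun t ht => hcmW (one_sub_mem_Icc ht)) (by simp [hcm1])
      (by rw [← hΨm]; exact hℓ ξm hξm1) ζ.2
    simp only [sub_self, hcm0] at hM'
    rw [← hH ζ _ (hF.isCurveThrough_radialCurve hV hx₀V hξm1 ζ.2), hM', neg_neg]
    have : m * (κ / 4 * ‖(ζ : Sp d)‖ ^ 2) ≤ m * M := mul_le_mul_of_nonneg_left hM hLm.le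
    rw [Submodule.coe_norm]
    linarith

/-- Over a compact set, the dual metric of unit covectors is uniformly continuous in the point. -/
theorem IsFinsler.exists_abs_one_sub_dual_le {V K : Set (Sp d)} {F : Sp d → Sp d → ℝ}
    (hV : IsOpen V) (hF : IsFinsler V F) (hK : IsCompact K) (hKV : K ⊆ V) {ε : ℝ} (hε : 0 < ε) :
    ∃ δ > 0, ∀ x ∈ K, ∀ z ∈ K, dist z x ≤ δ → ∀ ξ, dual F x ξ = 1 → |1 - dual F z ξ| ≤ ε := by
  have hZ := hF.isCompact_cosphereBundle hV hK hKV
  have hS := hZ.image continuous_snd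
  have hcont : ContinuousOn (fun z : Sp d × Sp d => dual F z.1 z.2)
      (K ×ˢ (Prod.snd '' cosphereBundle F K)) := by
    rintro ⟨x, ξ⟩ ⟨hx, w, hw, rfl⟩
    exact (hF.contDiffAt_dual hV (hKV hx)
      (ne_zero_of_dual_eq_one hw.2)).continuousAt.continuousWithinAt
  have huc := (hK.prod hS).uniformContinuousOn_of_continuous hcont
  obtain ⟨δ, hδ, h⟩ := Metric.uniformContinuousOn_iff_le.1 huc ε hε
  refine ⟨δ, hδ, fun x hx z hz hzx ξ hξ => ?_⟩
  have hm : ξ ∈ Prod.snd '' cosphereBundle F K := ⟨(x, ξ), ⟨hx, hξ⟩, rfl⟩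
  have h1 := h (x, ξ) ⟨hx, hm⟩ (z, ξ) ⟨hz, hm⟩
    (by rw [Prod.dist_eq, dist_self, max_eq_left dist_nonneg, dist_comm]; exact hzx)
  simpa [Real.dist_eq, hξ] using h1

end Finsler

end

/-! ### Choice of the uniform constants. -/

theorem mainTheorem7 (d : ℕ) (U₀ V : Set (Finsler.Sp d)) (F : Finsler.Sp d → Finsler.Sp d → ℝ)
    (hU₀ : IsOpen U₀) (hU₀b : Bornology.IsBounded U₀)
    (hV : IsOpen V) (hU₀V : closure U₀ ⊆ V) (hF : Finsler.IsFinsler V F) :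
    ∃ K > (0 : ℝ), ∃ r > (0 : ℝ), ∃ C > (0 : ℝ),
      ∀ U : Set (Finsler.Sp d), IsOpen U → U ⊆ U₀ → Metric.diam U ≤ r →
      Finsler.GeodesicallyConvex F U₀ U →
      ∀ φ : Finsler.Sp d → Finsler.Sp d → Finsler.Sp d → ℝ,
      Finsler.IsEikonalPhase F (Metric.thickening (K * Metric.diam U) U) U φ →
      ∀ x₀ ∈ U, ∀ x₁ ∈ U, x₀ ≠ x₁ →
      -- the forward geodesics from `x₀` to `x₁` and from `x₁` to `x₀`
      ∀ cp cm : ℝ → Finsler.Sp d,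
      Finsler.IsMinimizingGeodesic F U₀ U x₀ x₁ cp →
      Finsler.IsMinimizingGeodesic F U₀ U x₁ x₀ cm →
      ∀ ξp ξm : Finsler.Sp d,
      -- `ξp` and `ξm` are dual to the unit tangent vectors of these geodesics at `x₀`
      ξp = Finsler.legendre F x₀ (Finsler.unit F x₀ (Finsler.velocity cp 0)) →
      ξm = Finsler.legendre F x₀ (Finsler.unit F x₀ (Finsler.velocity cm 1)) →
      ∀ Ψ : Finsler.Sp d → ℝ, Ψ = (fun ξ => φ x₁ x₀ ξ) →
        ξp ≠ ξm ∧
        {ξ | Finsler.IsCritical (Finsler.cosphere F x₀) Ψ ξ} = {ξp, ξm} ∧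
        Ψ ξp = Finsler.dPlus F U₀ x₀ x₁ ∧
        Ψ ξm = -Finsler.dMinus F U₀ x₀ x₁ ∧
        (∃ H : QuadraticForm ℝ (Finsler.cosphereTangent F x₀ ξp),
          Finsler.IsHessian (Finsler.cosphere F x₀) Ψ ξp (Finsler.cosphereTangent F x₀ ξp) H ∧
          ∀ ζ, H ζ ≤ -(C * Finsler.dPlus F U₀ x₀ x₁ * ‖ζ‖ ^ 2)) ∧
        (∃ H : QuadraticForm ℝ (Finsler.cosphereTangent F x₀ ξm),
          Finsler.IsHessian (Finsler.cosphere F x₀) Ψ ξm (Finsler.cosphereTangent F x₀ ξm) H ∧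
          ∀ ζ, C * Finsler.dMinus F U₀ x₀ x₁ * ‖ζ‖ ^ 2 ≤ H ζ) := by

  obtain ⟨δ, hδ, hδV⟩ := (hU₀b.isCompact_closure).exists_cthickening_subset_open hV hU₀V
  have hKc : IsCompact (Metric.cthickening δ U₀) :=
    Metric.isCompact_of_isClosed_isBounded Metric.isClosed_cthickening hU₀b.cthickening
  rw [Metric.cthickening_closure] at hδV
  obtain ⟨B, κ, hB⟩ := hF.exists_hamiltonianBounds hV hKc hδV
  have hB1 := hB.one_le
  have hB0 : 0 < B := by linarith
  obtain ⟨ε, hε, hdual⟩ := hF.exists_abs_one_sub_dual_le hV hKc hδV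
    (show (0 : ℝ) < 1 / (16 * B ^ 2) by positivity)
  -- The cone radius is `A * diam U`, and `W` must contain the closed ball of twice that radius
  -- about `x₀`; hence the neighborhood factor `2 * A + 1`.
  set A : ℝ := 1 + 4 * B ^ 2 with hA
  have hA0 : 0 < A := by positivity
  set D : ℝ := B * (B * (2 + B ^ 2 * (2 + B ^ 2)) ^ 2) * 3 with hD
  have hD0 : 0 < D := by positivity
  -- In turn: `W` stays in the compact thickening, the cone radius is within the gradient tolerance
  -- and within the scale on which unit covectors stay almost unit, and the characteristics are
  -- short enough for the Riccati bounds.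
  have hev : ∀ᶠ r : ℝ in 𝓝[>] 0, 0 < r ∧ (2 * A + 1) * r < δ ∧ A * r < 1 / (4 * B) ∧ A * r < ε ∧
      D * r < 1 := by
    have h : ∀ a b : ℝ, 0 < b → ∀ᶠ r : ℝ in 𝓝[>] 0, a * r < b := fun a b hb =>
      nhdsWithin_le_nhds ((continuous_const.mul continuous_id).continuousAt.eventually_lt
        continuousAt_const (by simpa using hb))
    filter_upwards [self_mem_nhdsWithin, h _ _ hδ, h A (1 / (4 * B)) (by positivity), h A ε hε,
      h D 1 one_pos] with r h1 h2 h3 h4 h5 using ⟨h1, h2, h3, h4, h5⟩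
  obtain ⟨r, hr0, hr1, hr2, hr3, hr4⟩ := hev.exists
  refine ⟨2 * A + 1, by positivity, r, hr0, κ / 4, by linarith [hB.kappa_pos], ?_⟩
  intro U hU hUU₀ hdiam _ φ hφ x₀ hx₀ x₁ hx₁ hne cp cm hcp hcm ξp ξm hξp hξm Ψ hΨ
  subst hΨ
  have hdist : ‖x₁ - x₀‖ ≤ Metric.diam U := by
    rw [← dist_eq_norm]; exact Metric.dist_le_diam_of_mem (hU₀b.subset hUU₀) hx₁ hx₀
  have hN : 0 < ‖x₁ - x₀‖ := norm_pos_iff.2 (sub_ne_zero.2 hne.symm)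
  set N := Metric.diam U
  have hN0 : 0 < N := hN.trans_le hdist
  have hWK : Metric.thickening ((2 * A + 1) * N) U ⊆ Metric.cthickening δ U₀ :=
    (Metric.thickening_subset_cthickening _ _).trans
      ((Metric.cthickening_subset_of_subset _ hUU₀).trans
        (Metric.cthickening_mono (by nlinarith) _))
  have hball : Metric.closedBall x₀ (2 * (A * N)) ⊆ Metric.thickening ((2 * A + 1) * N) U :=
    (Metric.closedBall_subset_ball (by nlinarith)).trans (Metric.ball_subset_thickening hx₀ _)
  have hUW : U ⊆ Metric.thickening ((2 * A + 1) * N) U :=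
    Metric.self_subset_thickening (by positivity) U
  have hAN : A * N ≤ A * r := mul_le_mul_of_nonneg_left hdiam hA0.le
  refine hφ.criticalPoints hV hF Metric.isOpen_thickening (hWK.trans hδV) hWK hB hU hUW hx₀ hx₁
    hne hball (mul_le_mul_of_nonneg_left hdist hA0.le) (by linarith) (fun ξ hξ z hz => ?_) ?_
    hcp hcm hξp hξm
  · refine hdual x₀ (hWK (hUW hx₀)) z (hWK (hball ?_)) ?_ ξ hξ
    · exact Metric.closedBall_subset_closedBall (by nlinarith) hz
    · exact (Metric.mem_closedBall.1 hz).trans (by linarith)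
  · have h1 : D * ‖x₁ - x₀‖ ≤ D * r := mul_le_mul_of_nonneg_left (hdist.trans hdiam) hD0.le
    rw [hD] at h1 hr4
    linarith
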